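/- **Proposition 1.5.** There exists a bounded vector field $b:\mathbb{R}^2\to\mathbb{R}^2$ (i.e. $b\in L^\infty(\mathbb{R}^2;\mathbb{R}^2)$) such that 1. $\operatorname{div} b=0$ in the sense of distributions; 2. $b\in W^{1,p}_{\rm loc}(\mathbb{R}^2;\mathbb{R}^2)$ for every $p\in[1,\infty)$; 3. $b(z)\cdot e_1>0$ for $\mathscr L^2$-a.e. $z\in\mathbb{R}^2$; 4. $b$ has a regular Lagrangian flow on $[0,\infty)$; for every $T\in(0,\infty]$ any two regular Lagrangian flows $X,Y$ of $b$ on $[0,T)$ satisfy, for $\mathscr L^2$-a.e. $z$, $X(t,z)=Y(t,z)$ for all $t\in[0,T)$; and for every $T\in(0,\infty]$, every regular Lagrangian flow $X$ of $b$ on $[0,T)$ and every $0<t<T$, $$X(t,\cdot)\notin BV_{\rm loc}(\mathbb{R}^2;\mathbb{R}^2).$$ Here a regular Lagrangian flow of $b$ on $[0,T)$ is a map $X:[0,T)\times\mathbb{R}^2\to\mathbb{R}^2$ such that (i) for $\mathscr L^2$-a.e. $z$ the curve $t\mapsto X(t,z)$ is absolutely continuous on every compact interval $[0,s]\subset[0,T)$,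 $X(0,z)=z$, and $\partial_tX(t,z)=b(X(t,z))$ for $\mathscr L^1$-a.e. $t\in(0,T)$; and (ii) there is a constant $L>0$ such that, for every $t\in[0,T)$, the map $X(t,\cdot)$ is Lebesgue measurable and $X(t,\cdot)_\sharp\mathscr L^2\le L\,\mathscr L^2$. A map $u=(u_1,u_2)$ belongs to $BV_{\rm loc}(\mathbb{R}^2;\mathbb{R}^2)$ if, for $i=1,2$, $u_i\in L^1_{\rm loc}(\mathbb{R}^2)$ and for every bounded open $V\subset\mathbb{R}^2$ one has $\sup\{\int u_i\operatorname{div}\varphi\,dz:\varphi\in C^1_c(V;\mathbb{R}^2),\ |\varphi|\le1\}<\infty$. -/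

import Mathlib

open MeasureTheory Set
open scoped NNReal ENNReal ContDiff

/-- The Euclidean space `ℝ^d`; it carries the Euclidean norm and Lebesgue measure `volume`. -/
abbrev Euc (d : ℕ) : Type := EuclideanSpace ℝ (Fin d)

/-- The classical divergence `∑ᵢ ∂ᵢ φᵢ` of a differentiable vector field. -/
noncomputable def classicalDiv {d : ℕ} (φ : Euc d → Euc d) (x : Euc d) : ℝ :=
  ∑ i : Fin d, (fderiv ℝ φ x (EuclideanSpace.single i 1)) i

/-- `f ∈ L^p_loc(ℝ^d; F)`. -/
def MemLpLoc {d : ℕ} {F : Type*} [NormedAddCommGroup F] (f : Euc d → F) (p : ℝ≥0∞) : Prop :=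
  ∀ K : Set (Euc d), IsCompact K → MemLp f p (volume.restrict K)

/-- `G` is the weak derivative of `f` on `ℝ^d`: for every test function `φ ∈ C_c^∞(ℝ^d)` and
every direction `v`, `∫ (∂_v φ) f = - ∫ φ (G v)`. -/
def IsWeakDeriv {d m : ℕ} (f : Euc d → Euc m) (G : Euc d → (Euc d →L[ℝ] Euc m)) : Prop :=
  LocallyIntegrable f volume ∧ LocallyIntegrable G volume ∧
    ∀ φ : Euc d → ℝ, ContDiff ℝ ∞ φ → HasCompactSupport φ → ∀ v : Euc d,
      ∫ x, (fderiv ℝ φ x v) • f x = - ∫ x, φ x • G x v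

/-- `f ∈ W^{1,p}_loc(ℝ^d; ℝ^m)`. -/
def MemW1pLoc {d m : ℕ} (f : Euc d → Euc m) (p : ℝ≥0∞) : Prop :=
  MemLpLoc f p ∧ ∃ G : Euc d → (Euc d →L[ℝ] Euc m), IsWeakDeriv f G ∧ MemLpLoc G p

/-- `div b = 0` in the sense of distributions: `∫ b · ∇φ = 0` for every `φ ∈ C_c^∞(ℝ^d)`. -/
def IsDivFree {d : ℕ} (b : Euc d → Euc d) : Prop :=
  LocallyIntegrable b volume ∧
    ∀ φ : Euc d → ℝ, ContDiff ℝ ∞ φ → HasCompactSupport φ → ∫ x, fderiv ℝ φ x (b x) = 0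

/-- A real function `u` is in `BV_loc(ℝ^d)`: `u ∈ L^1_loc` and for every bounded open set `V` its
variation `sup {∫ u div φ : φ ∈ C_c^1(V; ℝ^d), |φ| ≤ 1}` in `V` is finite. -/
def MemBVLocReal {d : ℕ} (u : Euc d → ℝ) : Prop :=
  LocallyIntegrable u volume ∧
    ∀ V : Set (Euc d), IsOpen V → Bornology.IsBounded V →
      BddAbove {r : ℝ | ∃ φ : Euc d → Euc d, ContDiff ℝ 1 φ ∧ HasCompactSupport φ ∧
        tsupport φ ⊆ V ∧ (∀ x, ‖φ x‖ ≤ 1) ∧ r = ∫ x, u x * classicalDiv φ x}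

/-- `f ∈ BV_loc(ℝ^d; ℝ^m)`: every component of `f` is in `BV_loc(ℝ^d)`. -/
def MemBVLoc {d m : ℕ} (f : Euc d → Euc m) : Prop :=
  ∀ i : Fin m, MemBVLocReal fun x => f x i

/-- `X : [0,T) × ℝ^d → ℝ^d` is a regular Lagrangian flow of the vector field `b` on
`(0,T) × ℝ^d`, where `T` may be `⊤` (that is, `+∞`). Only the values `X t x` with `0 ≤ t < T`
matter. Absolute continuity is required on all compact intervals `[0,s] ⊆ [0,T)`. -/
structure IsRegularLagrangianFlow {d : ℕ} (T : EReal) (b : ℝ → Euc d → Euc d)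
    (X : ℝ → Euc d → Euc d) : Prop where
  trajectory : ∀ᵐ x : Euc d,
    (∀ s : ℝ, 0 ≤ s → (s : EReal) < T → AbsolutelyContinuousOnInterval (fun t => X t x) 0 s) ∧
    X 0 x = x ∧
    ∀ᵐ t : ℝ, 0 < t → (t : EReal) < T → HasDerivAt (fun s => X s x) (b t (X t x)) t
  compression : ∃ L : ℝ≥0, 0 < L ∧ ∀ t : ℝ, 0 ≤ t → (t : EReal) < T →
    AEMeasurable (X t) volume ∧ Measure.map (X t) volume ≤ L • (volume : Measure (Euc d))

/-!
Let `M(s) ≈ √s log² s` near `0`. The field is `∇^⊥ H` for the stream function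
`H = y M(x² + y²) (1 + q g(log (y M)) / 20)`, where `q = y² / (x² + y²)` and `g` oscillates like
`sin (u²) / u`. Its derivatives are bounded by powers of logarithms of `x² + y²` and `|y|`, hence
locally in every `L^p`, `p < ∞`. The level sets of `H` are graphs over the horizontal axis along
which the first component of the field is positive, so the flow is a translation in the coordinates
(travel time, level). These determine every regular Lagrangian flow, because almost every
trajectory stays on its level set and its clock runs at unit speed.

The level sets `H = c` pass the origin in finite time, since `1 / (r log² r)` is integrable at `0`.
On the levels `c_n = exp (-√(nπ))` the perturbation `g` vanishes and its derivative is close to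
`±2`, alternately. Within the cone `|x| ≲ y` about the vertical axis the speed thus varies by a
fixed factor between consecutive `c_n`, and the passage times differ by at least a multiple of
`1 / log² c_n = 1 / (nπ)`. Points starting at the same abscissa left of the origin are therefore
driven apart by distances whose sum over `n` diverges. The averages of the first component of the
flow over the level sets consequently have infinite variation in `c`, whereas testing a flow in
`BV_loc` with vertical fields `ζ(x) g(H) e₂`, of divergence `ζ g'(H) b₁`, bounds it.
-/

open Filter Topology

/-! ### Flows along the level sets of a stream function -/

theorem continuous_inverse_of_strictMono {P : Type*} [TopologicalSpace P] {F G : P → ℝ → ℝ}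
    (hF : ∀ y, Continuous fun p => F p y) (hm : ∀ p, StrictMono (F p))
    (hG : ∀ p c, F p (G p c) = c) : Continuous fun z : P × ℝ => G z.1 z.2 := by
  refine continuous_iff_continuousAt.2 fun ⟨p, c⟩ =>
    tendsto_order.2 ⟨fun a ha => ?_, fun a ha => ?_⟩
  · have below : F p a < c := by simpa only [hG] using hm p ha
    filter_upwards [((hF a).comp continuous_fst).continuousAt.eventually_lt continuousAt_snd below]
      with z hz
    rwa [Function.comp_apply, ← hG z.1 z.2, (hm z.1).lt_iff_lt] at hz
  · have above : c < F p a := by simpa only [hG] using hm p ha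
    filter_upwards [continuousAt_snd.eventually_lt ((hF a).comp continuous_fst).continuousAt above]
      with z hz
    rwa [Function.comp_apply, ← hG z.1 z.2, (hm z.1).lt_iff_lt] at hz

theorem measurable_of_continuous_off_zero {F : ℝ → ℝ → ℝ} (h0 : ∀ x, F 0 x = 0)
    (hF : Continuous fun z : {c : ℝ // c ≠ 0} × ℝ => F z.1 z.2) :
    Measurable fun z : ℝ × ℝ => F z.1 z.2 := by
  have hs : MeasurableSet {z : ℝ × ℝ | z.1 ≠ 0} :=
    (measurableSet_eq_fun measurable_fst measurable_const).compl
  have hcont : ContinuousOn (fun z : ℝ × ℝ => F z.1 z.2) {z | z.1 ≠ 0} :=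
    continuousOn_iff_continuous_domRestrict.2 <| hF.comp
      (by fun_prop : Continuous fun z : {z : ℝ × ℝ | z.1 ≠ 0} =>
        ((⟨z.1.1, z.2⟩, z.1.2) : {c : ℝ // c ≠ 0} × ℝ))
  classical
  convert hcont.measurable_piecewise (g := fun _ => (0 : ℝ)) continuousOn_const hs using 1
  funext z
  by_cases hz : z.1 = 0 <;> simp [Set.piecewise, hz, h0]

theorem lintegral_abs_deriv_mul_comp_of_bijective {f f' : ℝ → ℝ}
    (hf : ∀ x, HasDerivAt f (f' x) x) (hbij : Function.Bijective f) (g : ℝ → ℝ≥0∞) :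
    ∫⁻ x, ENNReal.ofReal |f' x| * g (f x) = ∫⁻ y, g y := by
  have change_of_variables := lintegral_image_eq_lintegral_abs_deriv_mul MeasurableSet.univ
    (fun x _ => (hf x).hasDerivWithinAt) hbij.injective.injOn g
  rwa [image_univ, hbij.surjective.range_eq, Measure.restrict_univ, eq_comm] at change_of_variables

theorem absolutelyContinuousOnInterval_comp_of_locallyLipschitz {X Y : Type*}
    [SeminormedAddCommGroup X] [PseudoMetricSpace Y] {g : X → Y} {f : ℝ → X} {a b : ℝ}
    (hg : LocallyLipschitz g) (hf : AbsolutelyContinuousOnInterval f a b) :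
    AbsolutelyContinuousOnInterval (fun t => g (f t)) a b := by
  obtain ⟨K, hK⟩ := (hg.locallyLipschitzOn (s := f '' uIcc a b)).exists_lipschitzOnWith_of_compact
    (isCompact_uIcc.image_of_continuousOn hf.continuousOn)
  refine (absolutelyContinuousOnInterval_iff _ _ _).2 fun ε hε => ?_
  obtain ⟨δ, hδ, small⟩ :=
    (absolutelyContinuousOnInterval_iff _ _ _).1 hf (ε / (K + 1)) (by positivity)
  refine ⟨δ, hδ, fun E hE hEδ => ?_⟩
  calc ∑ i ∈ Finset.range E.1, dist (g (f (E.2 i).1)) (g (f (E.2 i).2))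
      ≤ ∑ i ∈ Finset.range E.1, (K + 1) * dist (f (E.2 i).1) (f (E.2 i).2) := by
        refine Finset.sum_le_sum fun i hi => ?_
        obtain ⟨left_mem, right_mem⟩ := hE.1 i hi
        refine (hK.dist_le_mul _ (mem_image_of_mem f left_mem) _
          (mem_image_of_mem f right_mem)).trans ?_
        gcongr
        exact le_add_of_nonneg_right zero_le_one
    _ = (K + 1) * ∑ i ∈ Finset.range E.1, dist (f (E.2 i).1) (f (E.2 i).2) :=
        (Finset.mul_sum ..).symm
    _ < ε := by
        rw [mul_comm, ← lt_div_iff₀ (by positivity)]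
        exact small E hE hEδ

/-- `H` is a stream function of the bounded continuous field `(b₁, b₂)`, that is,
`∇H = (-b₂, b₁)`. The first component of the field is positive off the horizontal axis, the axis
is a level set, and every level set is a graph over it. -/
structure IsGraphStreamFunction (H b₁ b₂ : ℝ → ℝ → ℝ) (B : ℝ) : Prop where
  hasFDerivAt : ∀ x y, HasFDerivAt (fun z : ℝ × ℝ => H z.1 z.2)
    (b₁ x y • ContinuousLinearMap.snd ℝ ℝ ℝ - b₂ x y • ContinuousLinearMap.fst ℝ ℝ ℝ) (x, y)
  cont_fst : Continuous fun z : ℝ × ℝ => b₁ z.1 z.2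
  cont_snd : Continuous fun z : ℝ × ℝ => b₂ z.1 z.2
  abs_fst_le : ∀ x y, |b₁ x y| ≤ B
  abs_snd_le : ∀ x y, |b₂ x y| ≤ B
  pos : ∀ x y, y ≠ 0 → 0 < b₁ x y
  map_zero : ∀ x, H x 0 = 0
  surjective : ∀ x, Function.Surjective (H x)

/-- The height over `x` of the level set `{H = c}`. -/
noncomputable def streamHeight (H : ℝ → ℝ → ℝ) (x c : ℝ) : ℝ := Function.invFun (H x) c

/-- The horizontal speed over `x` along the level set `{H = c}`. -/
noncomputable def streamSpeed (H b₁ : ℝ → ℝ → ℝ) (c x : ℝ) : ℝ := b₁ x (streamHeight H x c)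

/-- The time needed to travel from abscissa `0` to abscissa `x` along `{H = c}`. On the axis
`{H = 0}` the speed may vanish, and the value `0` is chosen to make the function measurable
in `(c, x)`. -/
noncomputable def streamClock (H b₁ : ℝ → ℝ → ℝ) (c x : ℝ) : ℝ :=
  if c = 0 then 0 else ∫ r in (0 : ℝ)..x, 1 / streamSpeed H b₁ c r

/-- The abscissa at time `τ` along `{H = c}`, the clock being at `0` when the abscissa is `0`;
it is given the value `0` on the axis. -/
noncomputable def streamAbscissa (H b₁ : ℝ → ℝ → ℝ) (c τ : ℝ) : ℝ :=
  if c = 0 then 0 else Function.invFun (streamClock H b₁ c) τ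

/-- The coordinates (clock, level) of a point, in which the flow is a translation. -/
noncomputable def streamCoord (H b₁ : ℝ → ℝ → ℝ) (z : ℝ × ℝ) : ℝ × ℝ :=
  (streamClock H b₁ (H z.1 z.2) z.1, H z.1 z.2)

/-- The point with coordinates (clock, level) `w`. -/
noncomputable def streamPoint (H b₁ : ℝ → ℝ → ℝ) (w : ℝ × ℝ) : ℝ × ℝ :=
  (streamAbscissa H b₁ w.2 w.1, streamHeight H (streamAbscissa H b₁ w.2 w.1) w.2)

/-- The flow along the level sets of `H`. -/
noncomputable def streamFlow (H b₁ : ℝ → ℝ → ℝ) (t : ℝ) (z : ℝ × ℝ) : ℝ × ℝ :=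
  streamPoint H b₁ (streamCoord H b₁ z + (t, 0))

theorem streamClock_zero (H b₁ : ℝ → ℝ → ℝ) (c : ℝ) : streamClock H b₁ c 0 = 0 := by
  simp [streamClock]

namespace IsGraphStreamFunction

variable {H b₁ b₂ : ℝ → ℝ → ℝ} {B : ℝ}

theorem bound_pos (h : IsGraphStreamFunction H b₁ b₂ B) : 0 < B :=
  (h.pos 0 1 one_ne_zero).trans_le ((le_abs_self _).trans (h.abs_fst_le 0 1))

theorem contDiff (h : IsGraphStreamFunction H b₁ b₂ B) :
    ContDiff ℝ 1 fun z : ℝ × ℝ => H z.1 z.2 := by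
  refine contDiff_one_iff_fderiv.2 ⟨fun z => (h.hasFDerivAt z.1 z.2).differentiableAt, ?_⟩
  have fderiv_eq : fderiv ℝ (fun z : ℝ × ℝ => H z.1 z.2) = fun z => b₁ z.1 z.2 •
      ContinuousLinearMap.snd ℝ ℝ ℝ - b₂ z.1 z.2 • ContinuousLinearMap.fst ℝ ℝ ℝ :=
    funext fun z => (h.hasFDerivAt z.1 z.2).fderiv
  rw [fderiv_eq]
  exact (h.cont_fst.smul continuous_const).sub (h.cont_snd.smul continuous_const)

theorem continuous_stream_right (h : IsGraphStreamFunction H b₁ b₂ B) (x : ℝ) :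
    Continuous (H x) := h.contDiff.continuous.comp (Continuous.prodMk_right x)

theorem hasDerivAt_snd (h : IsGraphStreamFunction H b₁ b₂ B) (x y : ℝ) :
    HasDerivAt (H x) (b₁ x y) y := by
  simpa [Function.comp_def] using (h.hasFDerivAt x y).comp_hasDerivAt y
    ((hasDerivAt_const y x).prodMk (hasDerivAt_id y))

theorem strictMono (h : IsGraphStreamFunction H b₁ b₂ B) (x : ℝ) : StrictMono (H x) := by
  have strictMonoOn {s : Set ℝ} (hs : Convex ℝ s) (h0 : (0 : ℝ) ∉ interior s) :
      StrictMonoOn (H x) s :=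
    strictMonoOn_of_deriv_pos hs (h.continuous_stream_right x).continuousOn fun y hy => by
      rw [(h.hasDerivAt_snd x y).deriv]
      exact h.pos x y (ne_of_mem_of_not_mem hy h0)
  exact (strictMonoOn (convex_Iic 0) (by simp)).Iic_union_Ici
    (strictMonoOn (convex_Ici 0) (by simp))

theorem stream_height (h : IsGraphStreamFunction H b₁ b₂ B) (x c : ℝ) :
    H x (streamHeight H x c) = c := Function.rightInverse_invFun (h.surjective x) c

theorem height_stream (h : IsGraphStreamFunction H b₁ b₂ B) (x y : ℝ) :
    streamHeight H x (H x y) = y := Function.leftInverse_invFun (h.strictMono x).injective y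

theorem stream_ne_zero (h : IsGraphStreamFunction H b₁ b₂ B) (x : ℝ) {y : ℝ} (hy : y ≠ 0) :
    H x y ≠ 0 := by
  simpa only [h.map_zero] using (h.strictMono x).injective.ne hy

theorem height_ne_zero (h : IsGraphStreamFunction H b₁ b₂ B) (x : ℝ) {c : ℝ} (hc : c ≠ 0) :
    streamHeight H x c ≠ 0 := fun h0 => hc (by rw [← h.stream_height x c, h0, h.map_zero])

theorem continuous_height (h : IsGraphStreamFunction H b₁ b₂ B) :
    Continuous fun z : ℝ × ℝ => streamHeight H z.1 z.2 :=
  continuous_inverse_of_strictMono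
    (fun y => h.contDiff.continuous.comp (Continuous.prodMk_left y)) h.strictMono h.stream_height

theorem continuous_speed (h : IsGraphStreamFunction H b₁ b₂ B) :
    Continuous fun z : ℝ × ℝ => streamSpeed H b₁ z.1 z.2 :=
  h.cont_fst.comp (continuous_snd.prodMk (h.continuous_height.comp continuous_swap))

theorem speed_pos (h : IsGraphStreamFunction H b₁ b₂ B) {c : ℝ} (hc : c ≠ 0) (x : ℝ) :
    0 < streamSpeed H b₁ c x := h.pos _ _ (h.height_ne_zero x hc)

theorem speed_le (h : IsGraphStreamFunction H b₁ b₂ B) (c x : ℝ) :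
    streamSpeed H b₁ c x ≤ B := (le_abs_self _).trans (h.abs_fst_le _ _)

theorem continuous_one_div_speed (h : IsGraphStreamFunction H b₁ b₂ B) {c : ℝ} (hc : c ≠ 0) :
    Continuous fun x => 1 / streamSpeed H b₁ c x :=
  continuous_const.div (h.continuous_speed.comp (Continuous.prodMk_right c))
    fun x => (h.speed_pos hc x).ne'

theorem hasDerivAt_clock (h : IsGraphStreamFunction H b₁ b₂ B) {c : ℝ} (hc : c ≠ 0) (x : ℝ) :
    HasDerivAt (streamClock H b₁ c) (1 / streamSpeed H b₁ c x) x := by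
  have clock_eq : streamClock H b₁ c = fun x => ∫ r in (0 : ℝ)..x, 1 / streamSpeed H b₁ c r :=
    funext fun x => if_neg hc
  rw [clock_eq]
  exact ((h.continuous_one_div_speed hc).integral_hasStrictDerivAt 0 x).hasDerivAt

theorem contDiff_clock (h : IsGraphStreamFunction H b₁ b₂ B) {c : ℝ} (hc : c ≠ 0) :
    ContDiff ℝ 1 (streamClock H b₁ c) := by
  refine contDiff_one_iff_deriv.2 ⟨fun x => (h.hasDerivAt_clock hc x).differentiableAt, ?_⟩
  rw [funext fun x => (h.hasDerivAt_clock hc x).deriv]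
  exact h.continuous_one_div_speed hc

theorem clock_sub (h : IsGraphStreamFunction H b₁ b₂ B) {c : ℝ} (hc : c ≠ 0) (x x' : ℝ) :
    streamClock H b₁ c x' - streamClock H b₁ c x = ∫ r in x..x', 1 / streamSpeed H b₁ c r := by
  simp only [streamClock, hc, if_false]
  exact intervalIntegral.integral_interval_sub_left
    ((h.continuous_one_div_speed hc).intervalIntegrable _ _)
    ((h.continuous_one_div_speed hc).intervalIntegrable _ _)

theorem strictMono_clock (h : IsGraphStreamFunction H b₁ b₂ B) {c : ℝ} (hc : c ≠ 0) :
    StrictMono (streamClock H b₁ c) :=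
  strictMono_of_deriv_pos fun x => by
    rw [(h.hasDerivAt_clock hc x).deriv]
    exact one_div_pos.2 (h.speed_pos hc x)

theorem le_clock_sub (h : IsGraphStreamFunction H b₁ b₂ B) {c : ℝ} (hc : c ≠ 0) {x x' : ℝ}
    (hx : x ≤ x') : (x' - x) / B ≤ streamClock H b₁ c x' - streamClock H b₁ c x :=
  calc (x' - x) / B = ∫ _r in x..x', 1 / B := by
        rw [intervalIntegral.integral_const, smul_eq_mul, mul_one_div]
    _ ≤ ∫ r in x..x', 1 / streamSpeed H b₁ c r :=
        intervalIntegral.integral_mono_on hx intervalIntegrable_const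
          ((h.continuous_one_div_speed hc).intervalIntegrable _ _)
          fun r _ => one_div_le_one_div_of_le (h.speed_pos hc r) (h.speed_le c r)
    _ = streamClock H b₁ c x' - streamClock H b₁ c x := (h.clock_sub hc x x').symm

theorem surjective_clock (h : IsGraphStreamFunction H b₁ b₂ B) {c : ℝ} (hc : c ≠ 0) :
    Function.Surjective (streamClock H b₁ c) := by
  refine (h.contDiff_clock hc).continuous.surjective ?_ ?_
  · refine tendsto_atTop_mono' atTop ?_
      (tendsto_id.atTop_div_const h.bound_pos : Tendsto (fun x : ℝ => x / B) atTop atTop)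
    filter_upwards [eventually_ge_atTop 0] with x hx
    simpa only [streamClock_zero, sub_zero] using h.le_clock_sub hc hx
  · refine tendsto_atBot_mono' atBot ?_
      (tendsto_id.atBot_div_const h.bound_pos : Tendsto (fun x : ℝ => x / B) atBot atBot)
    filter_upwards [eventually_le_atBot 0] with x hx
    have := h.le_clock_sub hc hx
    rwa [streamClock_zero, zero_sub, zero_sub, neg_div, neg_le_neg_iff] at this

theorem clock_abscissa (h : IsGraphStreamFunction H b₁ b₂ B) {c : ℝ} (hc : c ≠ 0) (τ : ℝ) :
    streamClock H b₁ c (streamAbscissa H b₁ c τ) = τ := by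
  simp only [streamAbscissa, hc, if_false]
  exact Function.rightInverse_invFun (h.surjective_clock hc) τ

theorem abscissa_clock (h : IsGraphStreamFunction H b₁ b₂ B) {c : ℝ} (hc : c ≠ 0) (x : ℝ) :
    streamAbscissa H b₁ c (streamClock H b₁ c x) = x := by
  simp only [streamAbscissa, hc, if_false]
  exact Function.leftInverse_invFun (h.strictMono_clock hc).injective x

theorem continuous_clock (h : IsGraphStreamFunction H b₁ b₂ B) :
    Continuous fun z : {c : ℝ // c ≠ 0} × ℝ => streamClock H b₁ z.1 z.2 := by
  have continuous_slowness : Continuous (Function.uncurry fun (c : {c : ℝ // c ≠ 0}) (r : ℝ) =>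
      1 / streamSpeed H b₁ c r) :=
    continuous_const.div (h.continuous_speed.comp
      (by fun_prop : Continuous fun z : {c : ℝ // c ≠ 0} × ℝ => (z.1.1, z.2)))
      fun z => (h.speed_pos z.1.2 z.2).ne'
  refine (intervalIntegral.continuous_parametric_primitive_of_continuous (μ := volume) (a₀ := 0)
    continuous_slowness).congr fun z => ?_
  simp only [streamClock, z.1.2, if_false]

theorem continuous_abscissa (h : IsGraphStreamFunction H b₁ b₂ B) :
    Continuous fun z : {c : ℝ // c ≠ 0} × ℝ => streamAbscissa H b₁ z.1 z.2 :=
  continuous_inverse_of_strictMono (P := {c : ℝ // c ≠ 0})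
    (F := fun c x => streamClock H b₁ c x) (G := fun c x => streamAbscissa H b₁ c x)
    (fun x => h.continuous_clock.comp (Continuous.prodMk_left x))
    (fun c => h.strictMono_clock c.2) (fun c => h.clock_abscissa c.2)

theorem measurable_clock (h : IsGraphStreamFunction H b₁ b₂ B) :
    Measurable fun z : ℝ × ℝ => streamClock H b₁ z.1 z.2 :=
  measurable_of_continuous_off_zero (fun x => by simp [streamClock]) h.continuous_clock

theorem measurable_abscissa (h : IsGraphStreamFunction H b₁ b₂ B) :
    Measurable fun z : ℝ × ℝ => streamAbscissa H b₁ z.1 z.2 :=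
  measurable_of_continuous_off_zero (fun x => by simp [streamAbscissa]) h.continuous_abscissa

theorem measurable_coord (h : IsGraphStreamFunction H b₁ b₂ B) :
    Measurable (streamCoord H b₁) := by
  have measurable_stream := h.contDiff.continuous.measurable
  exact (h.measurable_clock.comp (measurable_stream.prodMk measurable_fst)).prodMk measurable_stream

theorem measurable_point (h : IsGraphStreamFunction H b₁ b₂ B) :
    Measurable (streamPoint H b₁) := by
  have measurable_fst := h.measurable_abscissa.comp measurable_swap
  exact measurable_fst.prodMk
    (h.continuous_height.measurable.comp (measurable_fst.prodMk measurable_snd))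

theorem point_coord (h : IsGraphStreamFunction H b₁ b₂ B) {z : ℝ × ℝ} (hz : z.2 ≠ 0) :
    streamPoint H b₁ (streamCoord H b₁ z) = z := by
  simp only [streamPoint, streamCoord, h.abscissa_clock (h.stream_ne_zero z.1 hz), h.height_stream]

theorem flow_zero (h : IsGraphStreamFunction H b₁ b₂ B) {z : ℝ × ℝ} (hz : z.2 ≠ 0) :
    streamFlow H b₁ 0 z = z := by
  rw [streamFlow, Prod.mk_zero_zero, add_zero, h.point_coord hz]

theorem lintegral_stream_eq (h : IsGraphStreamFunction H b₁ b₂ B) (x : ℝ) (g : ℝ → ℝ≥0∞) :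
    ∫⁻ y, g (H x y) = ∫⁻ c, ENNReal.ofReal (1 / streamSpeed H b₁ c x) * g c := by
  refine Eq.trans (lintegral_congr_ae ?_) (lintegral_abs_deriv_mul_comp_of_bijective
    (h.hasDerivAt_snd x) ⟨(h.strictMono x).injective, h.surjective x⟩ _)
  filter_upwards [Measure.ae_ne volume 0] with y hy
  have speed_pos := h.pos x y hy
  rw [streamSpeed, h.height_stream, ← mul_assoc, ← ENNReal.ofReal_mul (abs_nonneg _),
    abs_of_pos speed_pos, mul_one_div_cancel speed_pos.ne', ENNReal.ofReal_one, one_mul]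

theorem lintegral_clock_eq (h : IsGraphStreamFunction H b₁ b₂ B) {c : ℝ} (hc : c ≠ 0)
    (g : ℝ → ℝ≥0∞) :
    ∫⁻ x, ENNReal.ofReal (1 / streamSpeed H b₁ c x) * g (streamClock H b₁ c x) = ∫⁻ τ, g τ := by
  simpa only [abs_of_pos (one_div_pos.2 (h.speed_pos hc _))] using
    lintegral_abs_deriv_mul_comp_of_bijective (h.hasDerivAt_clock hc)
      ⟨(h.strictMono_clock hc).injective, h.surjective_clock hc⟩ g

theorem measurePreserving_coord (h : IsGraphStreamFunction H b₁ b₂ B) :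
    MeasurePreserving (streamCoord H b₁) := by
  refine ⟨h.measurable_coord, Measure.ext_of_lintegral _ fun F hF => ?_⟩
  have measurable_speed := h.continuous_speed.measurable
  have measurable_clock := h.measurable_clock
  rw [lintegral_map hF h.measurable_coord]
  calc ∫⁻ z, F (streamCoord H b₁ z)
      = ∫⁻ x, ∫⁻ y, F (streamClock H b₁ (H x y) x, H x y) := by
        rw [Measure.volume_eq_prod]
        exact lintegral_prod _ (hF.comp h.measurable_coord).aemeasurable
    _ = ∫⁻ x, ∫⁻ c, ENNReal.ofReal (1 / streamSpeed H b₁ c x) * F (streamClock H b₁ c x, c) :=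
        lintegral_congr fun x => h.lintegral_stream_eq x fun c => F (streamClock H b₁ c x, c)
    _ = ∫⁻ c, ∫⁻ x, ENNReal.ofReal (1 / streamSpeed H b₁ c x) * F (streamClock H b₁ c x, c) :=
        lintegral_lintegral_swap <| Measurable.aemeasurable <|
          (by fun_prop : Measurable fun p : ℝ × ℝ => ENNReal.ofReal (1 / streamSpeed H b₁ p.1 p.2) *
            F (streamClock H b₁ p.1 p.2, p.1)).comp measurable_swap
    _ = ∫⁻ c, ∫⁻ τ, F (τ, c) := by
        refine lintegral_congr_ae ?_
        filter_upwards [Measure.ae_ne volume 0] with c hc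
        exact h.lintegral_clock_eq hc fun τ => F (τ, c)
    _ = ∫⁻ w, F w := by
        rw [Measure.volume_eq_prod, lintegral_prod_symm _ hF.aemeasurable]

theorem measurePreserving_flow (h : IsGraphStreamFunction H b₁ b₂ B) (t : ℝ) :
    MeasurePreserving (streamFlow H b₁ t) := by
  have point_coord_ae : streamPoint H b₁ ∘ streamCoord H b₁ =ᵐ[volume] id := by
    rw [Measure.volume_eq_prod]
    filter_upwards [Measure.quasiMeasurePreserving_snd.ae (Measure.ae_ne volume 0)] with z hz
    exact h.point_coord hz
  have measurePreserving_point : MeasurePreserving (streamPoint H b₁) := by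
    refine ⟨h.measurable_point, ?_⟩
    conv_lhs => rw [← h.measurePreserving_coord.map_eq]
    rw [Measure.map_map h.measurable_point h.measurable_coord, Measure.map_congr point_coord_ae,
      Measure.map_id]
  exact measurePreserving_point.comp
    ((measurePreserving_add_right volume (t, 0)).comp h.measurePreserving_coord)

theorem hasDerivAt_height (h : IsGraphStreamFunction H b₁ b₂ B) {c : ℝ} (hc : c ≠ 0) (x : ℝ) :
    HasDerivAt (fun r => streamHeight H r c)
      (b₂ x (streamHeight H x c) / b₁ x (streamHeight H x c)) x := by
  set y := streamHeight H x c
  have speed_ne_zero : b₁ x y ≠ 0 := (h.pos x y (h.height_ne_zero x hc)).ne'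
  let D : (ℝ × ℝ) →L[ℝ] ℝ × ℝ := (ContinuousLinearMap.fst ℝ ℝ ℝ).prod
    (b₁ x y • ContinuousLinearMap.snd ℝ ℝ ℝ - b₂ x y • ContinuousLinearMap.fst ℝ ℝ ℝ)
  let D' : (ℝ × ℝ) →L[ℝ] ℝ × ℝ := (ContinuousLinearMap.fst ℝ ℝ ℝ).prod
    ((b₁ x y)⁻¹ • ContinuousLinearMap.snd ℝ ℝ ℝ +
      (b₂ x y / b₁ x y) • ContinuousLinearMap.fst ℝ ℝ ℝ)
  let e : (ℝ × ℝ) ≃L[ℝ] ℝ × ℝ := ContinuousLinearEquiv.equivOfInverse D D'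
    (fun z => Prod.ext rfl (by simp [D, D']; field))
    (fun z => Prod.ext rfl (by simp [D, D']; field))
  -- `(x, c) ↦ (x, streamHeight H x c)` is the inverse of `(x, y) ↦ (x, H x y)`.
  have hasFDerivAt_graph : HasFDerivAt (fun w : ℝ × ℝ => (w.1, streamHeight H w.1 w.2))
      (e.symm : (ℝ × ℝ) →L[ℝ] ℝ × ℝ) (x, c) :=
    HasFDerivAt.of_local_left_inverse (f := fun z : ℝ × ℝ => (z.1, H z.1 z.2))
      (continuous_fst.prodMk h.continuous_height).continuousAt
      (hasFDerivAt_fst.prodMk (h.hasFDerivAt x y) : HasFDerivAt _ (e : (ℝ × ℝ) →L[ℝ] ℝ × ℝ) _)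
      (Eventually.of_forall fun w => by rw [h.stream_height])
  have hasDerivAt_snd := (hasFDerivAt_snd.comp _ hasFDerivAt_graph).comp_hasDerivAt x
    ((hasDerivAt_id x).prodMk (hasDerivAt_const x c))
  have derivative_eq : ((ContinuousLinearMap.snd ℝ ℝ ℝ).comp (e.symm : (ℝ × ℝ) →L[ℝ] ℝ × ℝ))
      ((1 : ℝ), (0 : ℝ)) = b₂ x y / b₁ x y := by
    change (D' (1, 0)).2 = _
    simp [D']
  rwa [derivative_eq] at hasDerivAt_snd

theorem hasDerivAt_abscissa (h : IsGraphStreamFunction H b₁ b₂ B) {c : ℝ} (hc : c ≠ 0) (τ : ℝ) :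
    HasDerivAt (streamAbscissa H b₁ c) (streamSpeed H b₁ c (streamAbscissa H b₁ c τ)) τ := by
  have continuous : Continuous (streamAbscissa H b₁ c) :=
    h.continuous_abscissa.comp (Continuous.prodMk_right (⟨c, hc⟩ : {c : ℝ // c ≠ 0}))
  simpa only [one_div, inv_inv] using HasDerivAt.of_local_left_inverse continuous.continuousAt
    (h.hasDerivAt_clock hc (streamAbscissa H b₁ c τ)) (one_div_pos.2 (h.speed_pos hc _)).ne'
    (Eventually.of_forall (h.clock_abscissa hc))

theorem hasDerivAt_flow (h : IsGraphStreamFunction H b₁ b₂ B) {z : ℝ × ℝ} (hz : z.2 ≠ 0)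
    (t : ℝ) : HasDerivAt (fun t => streamFlow H b₁ t z)
      (b₁ (streamFlow H b₁ t z).1 (streamFlow H b₁ t z).2,
        b₂ (streamFlow H b₁ t z).1 (streamFlow H b₁ t z).2) t := by
  have level_ne_zero := h.stream_ne_zero z.1 hz
  have hasDerivAt_fst := (h.hasDerivAt_abscissa level_ne_zero _).comp_const_add
    (streamClock H b₁ (H z.1 z.2) z.1) t
  have hasDerivAt_snd := (h.hasDerivAt_height level_ne_zero _).comp t hasDerivAt_fst
  rw [streamSpeed, div_mul_cancel₀ _ (h.pos _ _ (h.height_ne_zero _ level_ne_zero)).ne']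
    at hasDerivAt_snd
  simpa only [streamFlow, streamPoint, streamCoord, streamSpeed, Prod.mk_add_mk, add_zero]
    using! hasDerivAt_fst.prodMk hasDerivAt_snd

section Uniqueness

variable {γ : ℝ → ℝ × ℝ} {s : ℝ}

theorem stream_eq_of_ae_hasDerivAt (h : IsGraphStreamFunction H b₁ b₂ B)
    (hγ : AbsolutelyContinuousOnInterval γ 0 s)
    (hd : ∀ᵐ t, t ∈ uIcc 0 s → HasDerivAt γ (b₁ (γ t).1 (γ t).2, b₂ (γ t).1 (γ t).2) t) {t : ℝ}
    (ht : t ∈ uIcc 0 s) : H (γ t).1 (γ t).2 = H (γ 0).1 (γ 0).2 := by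
  obtain ⟨C, hC⟩ := (absolutelyContinuousOnInterval_comp_of_locallyLipschitz
    h.contDiff.locallyLipschitz hγ).const_of_ae_hasDerivAt_zero (by
      filter_upwards [hd] with r hr hrs
      have chain_rule := (h.hasFDerivAt (γ r).1 (γ r).2).comp_hasDerivAt r (hr hrs)
      simpa [mul_comm, Function.comp_def] using chain_rule)
  rw [hC t ht, hC 0 left_mem_uIcc]

theorem clock_eq_of_ae_hasDerivAt (h : IsGraphStreamFunction H b₁ b₂ B)
    (hγ : AbsolutelyContinuousOnInterval γ 0 s)
    (hd : ∀ᵐ t, t ∈ uIcc 0 s → HasDerivAt γ (b₁ (γ t).1 (γ t).2, b₂ (γ t).1 (γ t).2) t) {c : ℝ}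
    (hc : c ≠ 0) (hlevel : ∀ t ∈ uIcc 0 s, H (γ t).1 (γ t).2 = c) :
    streamClock H b₁ c (γ s).1 = streamClock H b₁ c (γ 0).1 + s := by
  obtain ⟨C, hC⟩ := ((absolutelyContinuousOnInterval_comp_of_locallyLipschitz
      ((h.contDiff_clock hc).comp contDiff_fst).locallyLipschitz hγ).sub
      (absolutelyContinuousOnInterval_comp_of_locallyLipschitz LocallyLipschitz.id
        LipschitzWith.id.lipschitzOnWith.absolutelyContinuousOnInterval)
      ).const_of_ae_hasDerivAt_zero (by
      filter_upwards [hd] with r hr hrs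
      have slowness_mul_speed : 1 / streamSpeed H b₁ c (γ r).1 * b₁ (γ r).1 (γ r).2 - 1 = 0 := by
        have speed_eq : b₁ (γ r).1 (γ r).2 = streamSpeed H b₁ c (γ r).1 := by
          rw [streamSpeed, ← hlevel r hrs, h.height_stream]
        rw [speed_eq, one_div_mul_cancel (h.speed_pos hc _).ne', sub_self]
      rw [← slowness_mul_speed]
      exact ((h.hasDerivAt_clock hc (γ r).1).comp r
        (hasFDerivAt_fst.comp_hasDerivAt r (hr hrs))).sub (hasDerivAt_id r))
  have at_end := hC s right_mem_uIcc
  have at_start := hC 0 left_mem_uIcc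
  simp only [Pi.sub_apply, Function.comp_apply, id_eq] at at_end at_start
  linarith

theorem eq_flow_of_ae_hasDerivAt (h : IsGraphStreamFunction H b₁ b₂ B)
    (hγ : AbsolutelyContinuousOnInterval γ 0 s)
    (hd : ∀ᵐ t, t ∈ uIcc 0 s → HasDerivAt γ (b₁ (γ t).1 (γ t).2, b₂ (γ t).1 (γ t).2) t)
    (h0 : (γ 0).2 ≠ 0) : γ s = streamFlow H b₁ s (γ 0) := by
  have level := fun t (ht : t ∈ uIcc 0 s) => h.stream_eq_of_ae_hasDerivAt hγ hd ht
  have hc := h.stream_ne_zero (γ 0).1 h0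
  have clock := h.clock_eq_of_ae_hasDerivAt hγ hd hc level
  have coord_eq : streamCoord H b₁ (γ 0) + (s, 0) = streamCoord H b₁ (γ s) := by
    simp only [streamCoord, Prod.mk_add_mk, add_zero, ← clock, level s right_mem_uIcc]
  have end_ne_zero : (γ s).2 ≠ 0 := fun hs =>
    hc (by rw [← level s right_mem_uIcc, hs, h.map_zero])
  rw [streamFlow, coord_eq, h.point_coord end_ne_zero]

end Uniqueness

end IsGraphStreamFunction

/-- The linear identification of the Euclidean plane with `ℝ × ℝ`. -/
noncomputable def planeCLE : Euc 2 ≃L[ℝ] ℝ × ℝ :=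
  (EuclideanSpace.equiv (Fin 2) ℝ).trans (ContinuousLinearEquiv.finTwoArrow ℝ ℝ)

@[simp]
theorem planeCLE_apply (z : Euc 2) : planeCLE z = (z 0, z 1) := rfl

@[simp]
theorem planeCLE_symm_apply_zero (w : ℝ × ℝ) : planeCLE.symm w 0 = w.1 := rfl

@[simp]
theorem planeCLE_symm_apply_one (w : ℝ × ℝ) : planeCLE.symm w 1 = w.2 := rfl

theorem measurePreserving_planeCLE : MeasurePreserving planeCLE :=
  (volume_preserving_finTwoArrow ℝ).comp (PiLp.volume_preserving_ofLp (Fin 2))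

theorem measurableEmbedding_planeCLE : MeasurableEmbedding planeCLE :=
  planeCLE.toHomeomorph.measurableEmbedding

theorem measurePreserving_planeCLE_symm : MeasurePreserving planeCLE.symm :=
  measurePreserving_planeCLE.symm planeCLE.toHomeomorph.toMeasurableEquiv

theorem ae_plane_snd_ne_zero : ∀ᵐ z : Euc 2, z 1 ≠ 0 :=
  (Measure.quasiMeasurePreserving_snd.comp
    measurePreserving_planeCLE.quasiMeasurePreserving).ae (Measure.ae_ne volume 0)

/-- The plane field with components `b₁` and `b₂`. -/
noncomputable def planeField (b₁ b₂ : ℝ → ℝ → ℝ) (z : Euc 2) : Euc 2 :=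
  planeCLE.symm (b₁ (z 0) (z 1), b₂ (z 0) (z 1))

/-- The flow along the level sets of `H`, as a map of the Euclidean plane. -/
noncomputable def planeFlow (H b₁ : ℝ → ℝ → ℝ) (t : ℝ) (z : Euc 2) : Euc 2 :=
  planeCLE.symm (streamFlow H b₁ t (planeCLE z))

namespace IsGraphStreamFunction

variable {H b₁ b₂ : ℝ → ℝ → ℝ} {B : ℝ}

theorem norm_planeField_le (h : IsGraphStreamFunction H b₁ b₂ B) (z : Euc 2) :
    ‖planeField b₁ b₂ z‖ ≤ 2 * B := by
  have B_pos := h.bound_pos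
  have fst_sq_le := sq_le_sq₀ (abs_nonneg _) B_pos.le |>.2 (h.abs_fst_le (z 0) (z 1))
  have snd_sq_le := sq_le_sq₀ (abs_nonneg _) B_pos.le |>.2 (h.abs_snd_le (z 0) (z 1))
  rw [EuclideanSpace.norm_eq, Real.sqrt_le_left (by positivity), Fin.sum_univ_two]
  simp only [planeField, planeCLE_symm_apply_zero, planeCLE_symm_apply_one, Real.norm_eq_abs]
  nlinarith

theorem continuous_planeField (h : IsGraphStreamFunction H b₁ b₂ B) :
    Continuous (planeField b₁ b₂) :=
  planeCLE.symm.continuous.comp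
    ((h.cont_fst.comp planeCLE.continuous).prodMk (h.cont_snd.comp planeCLE.continuous))

theorem hasDerivAt_planeFlow (h : IsGraphStreamFunction H b₁ b₂ B) {z : Euc 2} (hz : z 1 ≠ 0)
    (t : ℝ) : HasDerivAt (fun t => planeFlow H b₁ t z)
      (planeField b₁ b₂ (planeFlow H b₁ t z)) t :=
  planeCLE.symm.hasFDerivAt.comp_hasDerivAt t (h.hasDerivAt_flow (z := planeCLE z) hz t)

theorem measurePreserving_planeFlow (h : IsGraphStreamFunction H b₁ b₂ B) (t : ℝ) :
    MeasurePreserving (planeFlow H b₁ t) :=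
  measurePreserving_planeCLE_symm.comp
    ((h.measurePreserving_flow t).comp measurePreserving_planeCLE)

theorem lipschitzWith_planeFlow (h : IsGraphStreamFunction H b₁ b₂ B) {z : Euc 2}
    (hz : z 1 ≠ 0) : LipschitzWith (2 * B).toNNReal fun t => planeFlow H b₁ t z :=
  lipschitzWith_of_nnnorm_deriv_le
    (fun t => (h.hasDerivAt_planeFlow hz t).differentiableAt) fun t => by
      rw [(h.hasDerivAt_planeFlow hz t).deriv, ← norm_toNNReal]
      exact Real.toNNReal_le_toNNReal (h.norm_planeField_le _)

theorem isRegularLagrangianFlow_planeFlow (h : IsGraphStreamFunction H b₁ b₂ B) :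
    IsRegularLagrangianFlow ⊤ (fun _ => planeField b₁ b₂) (planeFlow H b₁) where
  trajectory := by
    filter_upwards [ae_plane_snd_ne_zero] with z hz
    refine ⟨fun s _ _ =>
        (h.lipschitzWith_planeFlow hz).lipschitzOnWith.absolutelyContinuousOnInterval, ?_,
      Eventually.of_forall fun t _ _ => h.hasDerivAt_planeFlow hz t⟩
    rw [planeFlow, h.flow_zero hz, planeCLE.symm_apply_apply]
  compression := ⟨1, one_pos, fun t _ _ =>
    ⟨(h.measurePreserving_planeFlow t).aemeasurable,
      by rw [(h.measurePreserving_planeFlow t).map_eq, one_smul]⟩⟩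

theorem regularLagrangianFlow_eq (h : IsGraphStreamFunction H b₁ b₂ B) {T : EReal}
    {X : ℝ → Euc 2 → Euc 2} (hX : IsRegularLagrangianFlow T (fun _ => planeField b₁ b₂) X) :
    ∀ᵐ z : Euc 2, ∀ t : ℝ, 0 ≤ t → (t : EReal) < T → X t z = planeFlow H b₁ t z := by
  filter_upwards [hX.trajectory, ae_plane_snd_ne_zero] with z ⟨absolutelyContinuous, start, ode⟩
    hz s hs hsT
  have hasDerivAt_coordinates : ∀ᵐ t, t ∈ uIcc 0 s → HasDerivAt (fun t => planeCLE (X t z))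
      (b₁ (planeCLE (X t z)).1 (planeCLE (X t z)).2,
        b₂ (planeCLE (X t z)).1 (planeCLE (X t z)).2) t := by
    filter_upwards [ode, Measure.ae_ne volume 0] with t ht t_ne_zero t_mem
    rw [uIcc_of_le hs] at t_mem
    exact planeCLE.hasFDerivAt.comp_hasDerivAt t <|
      ht (t_mem.1.lt_of_ne' t_ne_zero) ((EReal.coe_le_coe_iff.2 t_mem.2).trans_lt hsT)
  have flow_eq := h.eq_flow_of_ae_hasDerivAt
    (absolutelyContinuousOnInterval_comp_of_locallyLipschitz
      planeCLE.contDiff.locallyLipschitz (absolutelyContinuous s hs hsT))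
    hasDerivAt_coordinates (by rw [start]; exact hz)
  rw [planeFlow, ← planeCLE.symm_apply_apply (X s z), flow_eq, start]

end IsGraphStreamFunction

/-! ### The radial speed profile -/

/-- The logarithmic factor of the speed profile. The constant `8` makes the profile monotone. -/
noncomputable def logFactor (s : ℝ) : ℝ := 8 + Real.log (1 + s⁻¹)

/-- The speed of the saddle flow as a function of the squared distance to the origin, comparable
to `√s log² s` as `s → 0` and bounded. -/
noncomputable def speedProfile (s : ℝ) : ℝ := √(s / (1 + s)) * logFactor s ^ 2

/-- The logarithmic derivative `s M' / M` of the speed profile `M`. -/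
noncomputable def speedExponent (s : ℝ) : ℝ := (1 / 2 - 2 / logFactor s) / (1 + s)

theorem eight_le_logFactor {s : ℝ} (hs : 0 ≤ s) : 8 ≤ logFactor s :=
  le_add_of_nonneg_right (Real.log_nonneg (le_add_of_nonneg_right (inv_nonneg.2 hs)))

theorem logFactor_pos {s : ℝ} (hs : 0 ≤ s) : 0 < logFactor s :=
  lt_of_lt_of_le (by norm_num) (eight_le_logFactor hs)

theorem hasDerivAt_logFactor {s : ℝ} (hs : 0 < s) :
    HasDerivAt logFactor (-1 / (s * (1 + s))) s := by
  convert! (((hasDerivAt_inv hs.ne').const_add 1).log (by positivity)).const_add 8 using 1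
  field

theorem hasDerivAt_speedProfile {s : ℝ} (hs : 0 < s) :
    HasDerivAt speedProfile (speedExponent s * speedProfile s / s) s := by
  have ratio_pos : 0 < s / (1 + s) := by positivity
  have hasDerivAt_ratio : HasDerivAt (fun s : ℝ => s / (1 + s))
      ((1 * (1 + s) - s * 1) / (1 + s) ^ 2) s :=
    (hasDerivAt_id s).div ((hasDerivAt_id s).const_add 1) (by positivity)
  convert! (hasDerivAt_ratio.sqrt ratio_pos.ne').mul ((hasDerivAt_logFactor hs).pow 2) using 1
  have logFactor_ne_zero := (logFactor_pos hs.le).ne'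
  have sqrt_ne_zero := (Real.sqrt_pos.2 ratio_pos).ne'
  have sq_sqrt := Real.sq_sqrt ratio_pos.le
  simp only [speedExponent, speedProfile]
  generalize √(s / (1 + s)) = p at *
  have s_eq : s = p ^ 2 * (1 + s) := by rw [sq_sqrt]; field
  field_simp
  norm_num
  linear_combination (-1 : ℝ) * logFactor s ^ 2 * s_eq

theorem speedProfile_zero : speedProfile 0 = 0 := by simp [speedProfile]

theorem speedProfile_nonneg (s : ℝ) : 0 ≤ speedProfile s := by
  unfold speedProfile; positivity

theorem speedProfile_pos {s : ℝ} (hs : 0 < s) : 0 < speedProfile s :=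
  mul_pos (Real.sqrt_pos.2 (by positivity)) (pow_pos (logFactor_pos hs.le) 2)

theorem speedProfile_le {s : ℝ} (hs : 0 ≤ s) : speedProfile s ≤ 64 * √√(s / (1 + s)) := by
  rcases hs.eq_or_lt with rfl | hs
  · simp [speedProfile]
  set w := s / (1 + s) with w_def
  have w_pos : 0 < w := by positivity
  set t := √√√w
  have t_pos : 0 < t := by positivity
  have t_sq : t ^ 2 = √√w := Real.sq_sqrt (by positivity)
  have t_pow_four : t ^ 4 = √w := by
    rw [pow_mul t 2 2, t_sq, Real.sq_sqrt (by positivity)]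
  have t_pow_eight : t ^ 8 = w := by
    rw [pow_mul t 4 2, t_pow_four, Real.sq_sqrt w_pos.le]
  -- `log (1 + 1 / s) = 8 log (1 / t) ≤ 8 (1 / t - 1)`
  have logFactor_le : logFactor s ≤ 8 / t := by
    have one_add_inv : 1 + s⁻¹ = (t⁻¹) ^ 8 := by
      rw [inv_pow, t_pow_eight, w_def]; field
    have log_le := Real.log_le_sub_one_of_pos (inv_pos.2 t_pos)
    rw [logFactor, one_add_inv, Real.log_pow, div_eq_mul_inv]
    push_cast
    linarith
  have := logFactor_pos hs.le
  calc speedProfile s = t ^ 4 * logFactor s ^ 2 := by rw [speedProfile, ← t_pow_four]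
    _ ≤ t ^ 4 * (8 / t) ^ 2 := by gcongr
    _ = 64 * t ^ 2 := by field
    _ = 64 * √√w := by rw [t_sq]

theorem speedProfile_le_const {s : ℝ} (hs : 0 ≤ s) : speedProfile s ≤ 64 := by
  have ratio_le_one : s / (1 + s) ≤ 1 := (div_le_one (by positivity)).2 (by linarith)
  have root_le_one : √√(s / (1 + s)) ≤ 1 :=
    Real.sqrt_le_one.2 (Real.sqrt_le_one.2 ratio_le_one)
  linarith [speedProfile_le hs]

theorem speedProfile_le_sqrt_sqrt {s : ℝ} (hs : 0 ≤ s) : speedProfile s ≤ 64 * √√s := by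
  refine (speedProfile_le hs).trans ?_
  gcongr
  exact div_le_self hs (by linarith)

theorem le_speedExponent {s : ℝ} (hs : 0 ≤ s) : 1 / 4 / (1 + s) ≤ speedExponent s := by
  have two_div_le : 2 / logFactor s ≤ 1 / 4 := by
    rw [div_le_div_iff₀ (logFactor_pos hs) (by norm_num)]
    linarith [eight_le_logFactor hs]
  rw [speedExponent]
  gcongr
  linarith

theorem speedExponent_nonneg {s : ℝ} (hs : 0 ≤ s) : 0 ≤ speedExponent s :=
  le_trans (by positivity) (le_speedExponent hs)

theorem speedExponent_le {s : ℝ} (hs : 0 ≤ s) : speedExponent s ≤ 1 / 2 := by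
  have := logFactor_pos hs
  have : 0 ≤ 2 / logFactor s := by positivity
  rw [speedExponent, div_le_iff₀ (by linarith)]
  linarith

theorem continuousOn_speedProfile : ContinuousOn speedProfile (Ici 0) := fun s hs => by
  rcases (mem_Ici.1 hs).eq_or_lt with rfl | hs
  · rw [ContinuousWithinAt, speedProfile_zero]
    have majorant_tendsto : Tendsto (fun s : ℝ => 64 * √√s) (𝓝[Ici 0] 0) (𝓝 0) := by
      have continuous_majorant : Continuous fun s : ℝ => 64 * √√s := by fun_prop
      simpa using (continuous_majorant.tendsto 0).mono_left nhdsWithin_le_nhds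
    refine squeeze_zero' (Eventually.of_forall speedProfile_nonneg) ?_ majorant_tendsto
    filter_upwards [self_mem_nhdsWithin] with s hs using speedProfile_le_sqrt_sqrt hs
  · exact (hasDerivAt_speedProfile hs).continuousAt.continuousWithinAt

theorem monotoneOn_speedProfile : MonotoneOn speedProfile (Ici 0) := by
  refine monotoneOn_of_hasDerivWithinAt_nonneg
    (f' := fun s => speedExponent s * speedProfile s / s) (convex_Ici 0)
    continuousOn_speedProfile ?_ ?_ <;> intro s hs <;> rw [interior_Ici, mem_Ioi] at hs
  · exact (hasDerivAt_speedProfile hs).hasDerivWithinAt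
  · exact div_nonneg (mul_nonneg (speedExponent_nonneg hs.le) (speedProfile_nonneg s)) hs.le

theorem hasDerivAt_speedExponent {s : ℝ} (hs : 0 < s) :
    HasDerivAt speedExponent
      (-speedExponent s / (1 + s) - 2 / (logFactor s ^ 2 * s * (1 + s) ^ 2)) s := by
  have logFactor_ne_zero := (logFactor_pos hs.le).ne'
  have hasDerivAt_div := (hasDerivAt_const s (2 : ℝ)).fun_div (hasDerivAt_logFactor hs)
    logFactor_ne_zero
  convert! (hasDerivAt_div.const_sub (1 / 2)).div ((hasDerivAt_id s).const_add 1)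
    (by positivity) using 1
  simp only [speedExponent, id]
  field

theorem abs_mul_deriv_speedExponent_le {s : ℝ} (hs : 0 < s) :
    s * |-speedExponent s / (1 + s) - 2 / (logFactor s ^ 2 * s * (1 + s) ^ 2)| ≤ 1 := by
  have eight_le := eight_le_logFactor hs.le
  have exponent_nonneg := speedExponent_nonneg hs.le
  have exponent_le := speedExponent_le hs.le
  have first_le : s * (speedExponent s / (1 + s)) ≤ 1 / 2 := by
    rw [mul_div_assoc', div_le_iff₀ (by positivity)]
    nlinarith
  have second_le : s * (2 / (logFactor s ^ 2 * s * (1 + s) ^ 2)) ≤ 1 / 2 := by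
    have cancel : s * (2 / (logFactor s ^ 2 * s * (1 + s) ^ 2)) =
        2 / (logFactor s ^ 2 * (1 + s) ^ 2) := by field
    rw [cancel, div_le_div_iff₀ (by positivity) (by norm_num)]
    have one_le_sq : 1 ≤ (1 + s) ^ 2 := one_le_pow₀ (by linarith)
    have le_logFactor_sq : 8 ^ 2 ≤ logFactor s ^ 2 := by gcongr
    nlinarith
  rw [neg_div, ← neg_add', abs_neg, abs_of_nonneg (by positivity), mul_add]
  linarith

/-! ### The oscillating profile -/

/-- A bounded oscillation with bounded derivative, whose second derivative grows linearly. Its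
derivative is close to `±2`, alternately, at the zeros `√(n π)` of `sin (u ^ 2)`. -/
noncomputable def wiggle (u : ℝ) : ℝ := u * Real.sin (u ^ 2) / (1 + u ^ 2)

/-- The derivative of `wiggle`. -/
noncomputable def wiggleDeriv (u : ℝ) : ℝ :=
  Real.sin (u ^ 2) * ((1 - u ^ 2) / (1 + u ^ 2) ^ 2) +
    Real.cos (u ^ 2) * (2 * u ^ 2 / (1 + u ^ 2))

/-- The second derivative of `wiggle`. -/
noncomputable def wiggleDeriv₂ (u : ℝ) : ℝ :=
  Real.cos (u ^ 2) * (2 * u) * ((1 - u ^ 2) / (1 + u ^ 2) ^ 2) +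
    Real.sin (u ^ 2) * ((2 * u ^ 3 - 6 * u) / (1 + u ^ 2) ^ 3) +
    (-Real.sin (u ^ 2) * (2 * u) * (2 * u ^ 2 / (1 + u ^ 2)) +
      Real.cos (u ^ 2) * (4 * u / (1 + u ^ 2) ^ 2))

theorem hasDerivAt_sq (u : ℝ) : HasDerivAt (fun u : ℝ => u ^ 2) (2 * u) u := by
  simpa using hasDerivAt_pow 2 u

theorem hasDerivAt_wiggle (u : ℝ) : HasDerivAt wiggle (wiggleDeriv u) u := by
  have denominator_ne_zero : 1 + u ^ 2 ≠ 0 := by positivity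
  convert! ((hasDerivAt_id u).mul (hasDerivAt_sq u).sin).div ((hasDerivAt_sq u).const_add 1)
    denominator_ne_zero using 1
  simp only [wiggleDeriv, Pi.mul_apply, id]
  field

theorem hasDerivAt_wiggleDeriv (u : ℝ) : HasDerivAt wiggleDeriv (wiggleDeriv₂ u) u := by
  have denominator_ne_zero : 1 + u ^ 2 ≠ 0 := by positivity
  have hasDerivAt_denominator := (hasDerivAt_sq u).const_add 1
  have hasDerivAt_sin_factor : HasDerivAt (fun u : ℝ => (1 - u ^ 2) / (1 + u ^ 2) ^ 2)
      ((2 * u ^ 3 - 6 * u) / (1 + u ^ 2) ^ 3) u := by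
    convert! ((hasDerivAt_sq u).const_sub 1).div (hasDerivAt_denominator.fun_pow 2)
      (pow_ne_zero 2 denominator_ne_zero) using 1
    field
  have hasDerivAt_cos_factor : HasDerivAt (fun u : ℝ => 2 * u ^ 2 / (1 + u ^ 2))
      (4 * u / (1 + u ^ 2) ^ 2) u := by
    convert! ((hasDerivAt_sq u).const_mul 2).div hasDerivAt_denominator denominator_ne_zero
      using 1
    field
  exact ((hasDerivAt_sq u).sin.mul hasDerivAt_sin_factor).add
    ((hasDerivAt_sq u).cos.mul hasDerivAt_cos_factor)

theorem abs_wiggle_le (u : ℝ) : |wiggle u| ≤ 1 / 2 := by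
  rw [wiggle, abs_div, abs_mul, abs_of_pos (by positivity : 0 < 1 + u ^ 2),
    div_le_iff₀ (by positivity)]
  have abs_mul_sin_le := mul_le_of_le_one_right (abs_nonneg u) (Real.abs_sin_le_one (u ^ 2))
  nlinarith [sq_abs u, sq_nonneg (|u| - 1)]

theorem abs_one_sub_sq_div_le (u : ℝ) : |(1 - u ^ 2) / (1 + u ^ 2) ^ 2| ≤ 1 := by
  rw [abs_div, abs_of_pos (by positivity : 0 < (1 + u ^ 2) ^ 2), div_le_one (by positivity),
    abs_le]
  constructor <;> nlinarith [sq_nonneg u, sq_nonneg (u ^ 2)]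

theorem abs_two_mul_sq_div_le (u : ℝ) : |2 * u ^ 2 / (1 + u ^ 2)| ≤ 2 := by
  rw [abs_of_nonneg (by positivity), div_le_iff₀ (by positivity)]
  linarith

theorem abs_cubic_div_le (u : ℝ) : |(2 * u ^ 3 - 6 * u) / (1 + u ^ 2) ^ 3| ≤ 6 * |u| := by
  rw [abs_div, abs_of_pos (by positivity : 0 < (1 + u ^ 2) ^ 3), div_le_iff₀ (by positivity)]
  have one_le : 1 ≤ 1 + u ^ 2 := le_add_of_nonneg_right (sq_nonneg u)
  calc |2 * u ^ 3 - 6 * u| = |u| * |2 * u ^ 2 - 6| := by rw [← abs_mul]; ring_nf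
    _ ≤ |u| * (6 * (1 + u ^ 2)) := by
        gcongr
        rw [abs_le]
        constructor <;> nlinarith
    _ = 6 * |u| * (1 + u ^ 2) := by ring
    _ ≤ 6 * |u| * (1 + u ^ 2) ^ 3 := by
        gcongr
        exact le_self_pow₀ one_le (by norm_num)

theorem abs_four_mul_div_le (u : ℝ) : |4 * u / (1 + u ^ 2) ^ 2| ≤ 4 * |u| := by
  rw [abs_div, abs_mul, abs_of_pos (by positivity : 0 < (1 + u ^ 2) ^ 2),
    abs_of_pos (by norm_num : (0 : ℝ) < 4)]
  exact div_le_self (by positivity) (one_le_pow₀ (le_add_of_nonneg_right (sq_nonneg u)))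

theorem abs_wiggleDeriv_le (u : ℝ) : |wiggleDeriv u| ≤ 3 := by
  calc |wiggleDeriv u| ≤ |Real.sin (u ^ 2)| * |(1 - u ^ 2) / (1 + u ^ 2) ^ 2| +
        |Real.cos (u ^ 2)| * |2 * u ^ 2 / (1 + u ^ 2)| := by
        rw [wiggleDeriv, ← abs_mul, ← abs_mul]
        exact abs_add_le _ _
    _ ≤ 1 * 1 + 1 * 2 := by
        gcongr
        · exact Real.abs_sin_le_one _
        · exact abs_one_sub_sq_div_le u
        · exact Real.abs_cos_le_one _
        · exact abs_two_mul_sq_div_le u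
    _ = 3 := by norm_num

theorem abs_wiggleDeriv₂_le (u : ℝ) : |wiggleDeriv₂ u| ≤ 18 * (1 + |u|) := by
  have abs_sin_le := Real.abs_sin_le_one (u ^ 2)
  have abs_cos_le := Real.abs_cos_le_one (u ^ 2)
  calc |wiggleDeriv₂ u| ≤ |Real.cos (u ^ 2)| * (2 * |u|) * |(1 - u ^ 2) / (1 + u ^ 2) ^ 2| +
        |Real.sin (u ^ 2)| * |(2 * u ^ 3 - 6 * u) / (1 + u ^ 2) ^ 3| +
        (|Real.sin (u ^ 2)| * (2 * |u|) * |2 * u ^ 2 / (1 + u ^ 2)| +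
          |Real.cos (u ^ 2)| * |4 * u / (1 + u ^ 2) ^ 2|) := by
        rw [wiggleDeriv₂]
        refine (abs_add_le _ _).trans
          (add_le_add ((abs_add_le _ _).trans ?_) ((abs_add_le _ _).trans ?_)) <;>
        simp only [abs_mul, abs_neg, Nat.abs_ofNat, le_refl]
    _ ≤ 1 * (2 * |u|) * 1 + 1 * (6 * |u|) + (1 * (2 * |u|) * 2 + 1 * (4 * |u|)) := by
        gcongr
        exacts [abs_one_sub_sq_div_le u, abs_cubic_div_le u, abs_two_mul_sq_div_le u,
          abs_four_mul_div_le u]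
    _ ≤ 18 * (1 + |u|) := by linarith [abs_nonneg u]

/-! ### Partial derivatives in the plane -/

/-- `F` is differentiable at `z` with partial derivatives `a` and `b`. -/
def HasPartials (F : ℝ × ℝ → ℝ) (a b : ℝ) (z : ℝ × ℝ) : Prop :=
  HasFDerivAt F (a • ContinuousLinearMap.fst ℝ ℝ ℝ + b • ContinuousLinearMap.snd ℝ ℝ ℝ) z

namespace HasPartials

variable {F G : ℝ × ℝ → ℝ} {a b a' b' : ℝ} {z : ℝ × ℝ}

theorem fst (z : ℝ × ℝ) : HasPartials (fun z => z.1) 1 0 z := by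
  simpa [HasPartials] using hasFDerivAt_fst (𝕜 := ℝ) (p := z)

theorem snd (z : ℝ × ℝ) : HasPartials (fun z => z.2) 0 1 z := by
  simpa [HasPartials] using hasFDerivAt_snd (𝕜 := ℝ) (p := z)

theorem const (c : ℝ) (z : ℝ × ℝ) : HasPartials (fun _ => c) 0 0 z := by
  simpa [HasPartials] using hasFDerivAt_const c z

theorem congr_partials (h : HasPartials F a b z) (ha : a = a') (hb : b = b') :
    HasPartials F a' b' z := by
  rwa [← ha, ← hb]

theorem add (hF : HasPartials F a b z) (hG : HasPartials G a' b' z) :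
    HasPartials (fun z => F z + G z) (a + a') (b + b') z := by
  unfold HasPartials
  convert! HasFDerivAt.add hF hG using 1
  ext <;> simp

theorem mul (hF : HasPartials F a b z) (hG : HasPartials G a' b' z) :
    HasPartials (fun z => F z * G z) (a * G z + F z * a') (b * G z + F z * b') z := by
  unfold HasPartials
  convert! HasFDerivAt.mul hF hG using 1
  ext <;> simp <;> ring

theorem comp {φ : ℝ → ℝ} {φ' : ℝ} (hφ : HasDerivAt φ φ' (F z)) (hF : HasPartials F a b z) :
    HasPartials (fun z => φ (F z)) (φ' * a) (φ' * b) z := by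
  unfold HasPartials
  convert! hφ.comp_hasFDerivAt z hF using 1
  ext <;> simp

theorem inv (hF : HasPartials F a b z) (h0 : F z ≠ 0) :
    HasPartials (fun z => (F z)⁻¹) (-(F z ^ 2)⁻¹ * a) (-(F z ^ 2)⁻¹ * b) z :=
  comp (hasDerivAt_inv h0) hF

theorem continuousAt (hF : HasPartials F a b z) : ContinuousAt F z :=
  HasFDerivAt.continuousAt hF

theorem differentiableAt (hF : HasPartials F a b z) : DifferentiableAt ℝ F z :=
  HasFDerivAt.differentiableAt hF

theorem hasDerivAt_right {x y : ℝ} (hF : HasPartials F a b (x, y)) :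
    HasDerivAt (fun y => F (x, y)) b y := by
  simpa using! hF.comp_hasDerivAt y ((hasDerivAt_const y x).prodMk (hasDerivAt_id y))

theorem norm_fderiv_le (hF : HasPartials F a b z) : ‖fderiv ℝ F z‖ ≤ |a| + |b| := by
  rw [HasFDerivAt.fderiv hF]
  refine (norm_add_le _ _).trans (add_le_add ?_ ?_) <;> rw [norm_smul]
  · exact mul_le_of_le_one_right (norm_nonneg _) (ContinuousLinearMap.norm_fst_le ..)
  · exact mul_le_of_le_one_right (norm_nonneg _) (ContinuousLinearMap.norm_snd_le ..)

theorem snd_mul_of_tendsto_zero {R : ℝ × ℝ → ℝ} {x : ℝ} (hR : Tendsto R (𝓝 (x, 0)) (𝓝 0)) :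
    HasPartials (fun z => z.2 * R z) 0 0 (x, 0) := by
  unfold HasPartials
  rw [hasFDerivAt_iff_isLittleO]
  simp only [zero_smul, add_zero, zero_apply, sub_zero, zero_mul]
  have snd_isBigO : (fun z : ℝ × ℝ => z.2) =O[𝓝 (x, 0)] fun z => z - (x, 0) :=
    Asymptotics.isBigO_of_le _ fun z => by
      have := norm_snd_le (z - (x, 0))
      simpa using this
  have R_isLittleO : R =o[𝓝 (x, 0)] fun _ => (1 : ℝ) := (Asymptotics.isLittleO_one_iff ℝ).2 hR
  simpa using snd_isBigO.norm_right.mul_isLittleO R_isLittleO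

theorem of_abs_le_sq_snd {D : ℝ × ℝ → ℝ} {C x : ℝ}
    (h : ∀ᶠ z : ℝ × ℝ in 𝓝 (x, 0), |D z| ≤ C * z.2 ^ 2) : HasPartials D 0 0 (x, 0) := by
  have quotient_tendsto : Tendsto (fun z : ℝ × ℝ => D z / z.2) (𝓝 (x, 0)) (𝓝 0) := by
    have majorant_tendsto : Tendsto (fun z : ℝ × ℝ => C * |z.2|) (𝓝 (x, 0)) (𝓝 0) := by
      have continuous_majorant : Continuous fun z : ℝ × ℝ => C * |z.2| := by fun_prop
      simpa using continuous_majorant.tendsto (x, 0)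
    refine squeeze_zero_norm' ?_ majorant_tendsto
    filter_upwards [h] with z hz
    rw [Real.norm_eq_abs, abs_div]
    rcases eq_or_ne z.2 0 with h0 | h0
    · simp [h0]
    · rwa [div_le_iff₀ (abs_pos.2 h0), mul_assoc, abs_mul_abs_self, ← sq]
  refine HasFDerivAt.congr_of_eventuallyEq (snd_mul_of_tendsto_zero quotient_tendsto) ?_
  filter_upwards [h] with z hz
  rcases eq_or_ne z.2 0 with h0 | h0
  · simpa [h0] using hz
  · rw [mul_div_cancel₀ _ h0]

end HasPartials

/-! ### The stream function of the saddle -/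

/-- The square of the Euclidean distance to the origin. -/
def radiusSq (x y : ℝ) : ℝ := x ^ 2 + y ^ 2

/-- The squared sine `y² / (x² + y²)` of the angle with the horizontal axis; it confines the
oscillations of the stream function to a cone about the vertical axis. -/
noncomputable def heightRatio (x y : ℝ) : ℝ := y ^ 2 / radiusSq x y

/-- The logarithm of the unperturbed stream function `y M(x² + y²)`, with `M = speedProfile`. -/
noncomputable def logBase (x y : ℝ) : ℝ := Real.log (y * speedProfile (radiusSq x y))

/-- The stream function `y M (1 + q g(log (y M)) / 20)`, with `M = speedProfile`,
`q = heightRatio` and `g = wiggle`. -/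
noncomputable def saddleStream (x y : ℝ) : ℝ :=
  y * speedProfile (radiusSq x y) * (1 + 1 / 20 * (heightRatio x y * wiggle (logBase x y)))

/-- The derivative of `saddleStream` in `y`, the horizontal component of the saddle field. -/
noncomputable def saddleFst (x y : ℝ) : ℝ :=
  speedProfile (radiusSq x y) * (1 + 2 * heightRatio x y * speedExponent (radiusSq x y) +
    1 / 20 * ((3 + 2 * heightRatio x y * speedExponent (radiusSq x y) - 2 * heightRatio x y) *
      (heightRatio x y * wiggle (logBase x y)) +
      (1 + 2 * heightRatio x y * speedExponent (radiusSq x y)) *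
        (heightRatio x y * wiggleDeriv (logBase x y))))

/-- The negative of the derivative of `saddleStream` in `x`, the vertical component of the saddle
field. -/
noncomputable def saddleSnd (x y : ℝ) : ℝ :=
  speedProfile (radiusSq x y) * (-(x * y / radiusSq x y) *
    (2 * speedExponent (radiusSq x y) +
    1 / 20 * ((2 * speedExponent (radiusSq x y) - 2) * (heightRatio x y * wiggle (logBase x y)) +
      2 * speedExponent (radiusSq x y) * (heightRatio x y * wiggleDeriv (logBase x y)))))

theorem radiusSq_nonneg (x y : ℝ) : 0 ≤ radiusSq x y := by unfold radiusSq; positivity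

theorem radiusSq_pos_of_right {y : ℝ} (x : ℝ) (hy : y ≠ 0) : 0 < radiusSq x y := by
  unfold radiusSq; positivity

theorem radiusSq_pos_of_left {x : ℝ} (hx : x ≠ 0) (y : ℝ) : 0 < radiusSq x y := by
  unfold radiusSq; positivity

theorem continuous_radiusSq : Continuous fun z : ℝ × ℝ => radiusSq z.1 z.2 := by
  unfold radiusSq; fun_prop

theorem continuous_speedProfile_radiusSq :
    Continuous fun z : ℝ × ℝ => speedProfile (radiusSq z.1 z.2) :=
  continuousOn_speedProfile.comp_continuous continuous_radiusSq fun _ => radiusSq_nonneg _ _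

theorem heightRatio_nonneg (x y : ℝ) : 0 ≤ heightRatio x y :=
  div_nonneg (sq_nonneg y) (radiusSq_nonneg x y)

theorem heightRatio_le_one (x y : ℝ) : heightRatio x y ≤ 1 :=
  div_le_one_of_le₀ (by unfold radiusSq; nlinarith) (radiusSq_nonneg x y)

theorem abs_mul_div_radiusSq_le (x y : ℝ) : |x * y / radiusSq x y| ≤ 1 := by
  rw [abs_div, abs_of_nonneg (radiusSq_nonneg x y)]
  refine div_le_one_of_le₀ ?_ (radiusSq_nonneg x y)
  rw [abs_mul, radiusSq]
  nlinarith [sq_nonneg (|x| - |y|), sq_abs x, sq_abs y, abs_nonneg x, abs_nonneg y]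

theorem two_mul_heightRatio_mul_speedExponent_mem_Icc (x y : ℝ) :
    2 * heightRatio x y * speedExponent (radiusSq x y) ∈ Icc 0 1 := by
  have ratio_nonneg := heightRatio_nonneg x y
  have ratio_le_one := heightRatio_le_one x y
  have exponent_nonneg := speedExponent_nonneg (radiusSq_nonneg x y)
  have exponent_le := speedExponent_le (radiusSq_nonneg x y)
  exact ⟨by positivity, by nlinarith⟩

theorem abs_two_mul_speedExponent_le {s : ℝ} (hs : 0 ≤ s) : |2 * speedExponent s| ≤ 1 := by
  rw [abs_of_nonneg (mul_nonneg zero_le_two (speedExponent_nonneg hs))]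
  linarith [speedExponent_le hs]

theorem hasPartials_radiusSq (x y : ℝ) :
    HasPartials (fun z => radiusSq z.1 z.2) (2 * x) (2 * y) (x, y) := by
  have hasPartials_sum := ((HasPartials.fst (x, y)).mul (HasPartials.fst (x, y))).add
    ((HasPartials.snd (x, y)).mul (HasPartials.snd (x, y)))
  simp only [← sq] at hasPartials_sum
  exact hasPartials_sum.congr_partials (by ring) (by ring)

theorem hasPartials_speedProfile {x y : ℝ} (hs : 0 < radiusSq x y) :
    HasPartials (fun z => speedProfile (radiusSq z.1 z.2))
      (speedExponent (radiusSq x y) * speedProfile (radiusSq x y) / radiusSq x y * (2 * x))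
      (speedExponent (radiusSq x y) * speedProfile (radiusSq x y) / radiusSq x y * (2 * y))
      (x, y) :=
  HasPartials.comp (F := fun z => radiusSq z.1 z.2) (hasDerivAt_speedProfile hs)
    (hasPartials_radiusSq x y)

theorem hasPartials_inv_radiusSq {x y : ℝ} (hs : 0 < radiusSq x y) :
    HasPartials (fun z => (radiusSq z.1 z.2)⁻¹) (-(radiusSq x y ^ 2)⁻¹ * (2 * x))
      (-(radiusSq x y ^ 2)⁻¹ * (2 * y)) (x, y) :=
  (hasPartials_radiusSq x y).inv hs.ne'

theorem hasPartials_heightRatio {x y : ℝ} (hs : 0 < radiusSq x y) :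
    HasPartials (fun z => heightRatio z.1 z.2) (-2 * x * y ^ 2 / radiusSq x y ^ 2)
      (2 * y / radiusSq x y - 2 * y ^ 3 / radiusSq x y ^ 2) (x, y) := by
  have hasPartials_product := ((HasPartials.snd (x, y)).mul (HasPartials.snd (x, y))).mul
    (hasPartials_inv_radiusSq hs)
  simp only [← sq, ← div_eq_mul_inv] at hasPartials_product
  refine hasPartials_product.congr_partials ?_ ?_ <;> field

theorem hasPartials_logBase {x y : ℝ} (hy : y ≠ 0) :
    HasPartials (fun z => logBase z.1 z.2)
      (speedExponent (radiusSq x y) / radiusSq x y * (2 * x))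
      (1 / y + speedExponent (radiusSq x y) / radiusSq x y * (2 * y)) (x, y) := by
  have radiusSq_pos := radiusSq_pos_of_right x hy
  have speedProfile_ne_zero := (speedProfile_pos radiusSq_pos).ne'
  have hasPartials_log := HasPartials.comp
    (F := fun z => z.2 * speedProfile (radiusSq z.1 z.2)) (z := (x, y))
    (Real.hasDerivAt_log (mul_ne_zero hy speedProfile_ne_zero))
    ((HasPartials.snd (x, y)).mul (hasPartials_speedProfile radiusSq_pos))
  refine hasPartials_log.congr_partials ?_ ?_ <;> simp only <;> field

theorem hasPartials_saddleStream_of_ne_zero {x y : ℝ} (hy : y ≠ 0) :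
    HasPartials (fun z => saddleStream z.1 z.2) (-saddleSnd x y) (saddleFst x y) (x, y) := by
  have radiusSq_ne_zero := (radiusSq_pos_of_right x hy).ne'
  have hasPartials_base := (HasPartials.snd (x, y)).mul
    (hasPartials_speedProfile (radiusSq_pos_of_right x hy))
  have hasPartials_wiggle := HasPartials.comp (F := fun z => logBase z.1 z.2) (z := (x, y))
    (hasDerivAt_wiggle _) (hasPartials_logBase hy)
  have hasPartials_perturbation := (HasPartials.const (1 / 20) (x, y)).mul
    ((hasPartials_heightRatio (radiusSq_pos_of_right x hy)).mul hasPartials_wiggle)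
  refine HasPartials.congr_partials
    (hasPartials_base.mul ((HasPartials.const 1 (x, y)).add hasPartials_perturbation)) ?_ ?_ <;>
  · simp only [saddleFst, saddleSnd, heightRatio]
    field

theorem speedProfile_mul_heightRatio_le (x y : ℝ) :
    speedProfile (radiusSq x y) * heightRatio x y ≤ 64 * √|y| := by
  have radiusSq_nonneg := radiusSq_nonneg x y
  have ratio_nonneg := heightRatio_nonneg x y
  have le_sqrt_of_mem {q : ℝ} (h0 : 0 ≤ q) (h1 : q ≤ 1) : q ≤ √q :=
    Real.le_sqrt_of_sq_le (by nlinarith)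
  have ratio_le_sqrt := le_sqrt_of_mem ratio_nonneg (heightRatio_le_one x y)
  have ratio_le_sqrt_sqrt : heightRatio x y ≤ √√(heightRatio x y) :=
    ratio_le_sqrt.trans (Real.sqrt_le_sqrt ratio_le_sqrt)
  have radiusSq_mul_ratio_le : radiusSq x y * heightRatio x y ≤ y ^ 2 := by
    rcases radiusSq_nonneg.eq_or_lt with h0 | h0
    · rw [← h0, zero_mul]; positivity
    · rw [heightRatio, mul_div_cancel₀ _ h0.ne']
  calc speedProfile (radiusSq x y) * heightRatio x y
      ≤ (64 * √√(radiusSq x y)) * √√(heightRatio x y) := by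
        gcongr
        exact speedProfile_le_sqrt_sqrt radiusSq_nonneg
    _ = 64 * √√(radiusSq x y * heightRatio x y) := by
        rw [mul_assoc, ← Real.sqrt_mul (Real.sqrt_nonneg _), ← Real.sqrt_mul radiusSq_nonneg]
    _ ≤ 64 * √√(y ^ 2) := by gcongr
    _ = 64 * √|y| := by rw [Real.sqrt_sq_eq_abs]

theorem tendsto_speedProfile_mul_heightRatio_mul_wiggle (x : ℝ) :
    Tendsto (fun z : ℝ × ℝ => speedProfile (radiusSq z.1 z.2) *
      (heightRatio z.1 z.2 * wiggle (logBase z.1 z.2))) (𝓝 (x, 0)) (𝓝 0) := by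
  have majorant_tendsto : Tendsto (fun z : ℝ × ℝ => 64 * √|z.2|) (𝓝 (x, 0)) (𝓝 0) := by
    have continuous_majorant : Continuous fun z : ℝ × ℝ => 64 * √|z.2| := by fun_prop
    simpa using continuous_majorant.tendsto (x, 0)
  refine squeeze_zero_norm (fun z => ?_) majorant_tendsto
  have product_nonneg :=
    mul_nonneg (speedProfile_nonneg (radiusSq z.1 z.2)) (heightRatio_nonneg z.1 z.2)
  rw [← mul_assoc, norm_mul, Real.norm_of_nonneg product_nonneg, Real.norm_eq_abs]
  exact (mul_le_of_le_one_right product_nonneg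
    ((abs_wiggle_le _).trans (by norm_num))).trans (speedProfile_mul_heightRatio_le z.1 z.2)

theorem hasPartials_saddleStream_axis (x : ℝ) :
    HasPartials (fun z => saddleStream z.1 z.2) (-saddleSnd x 0) (saddleFst x 0) (x, 0) := by
  have speedProfile_tendsto : Tendsto (fun z : ℝ × ℝ => speedProfile (radiusSq z.1 z.2) -
      speedProfile (radiusSq x 0)) (𝓝 (x, 0)) (𝓝 0) := by
    simpa using (continuous_speedProfile_radiusSq.tendsto (x, 0)).sub_const
      (speedProfile (radiusSq x 0))
  have remainder_tendsto := speedProfile_tendsto.add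
    ((tendsto_speedProfile_mul_heightRatio_mul_wiggle x).const_mul (1 / 20))
  rw [mul_zero, add_zero] at remainder_tendsto
  have stream_eq : (fun z : ℝ × ℝ => saddleStream z.1 z.2) = fun z : ℝ × ℝ =>
      z.2 * speedProfile (radiusSq x 0) + z.2 *
      ((speedProfile (radiusSq z.1 z.2) - speedProfile (radiusSq x 0)) +
      1 / 20 * (speedProfile (radiusSq z.1 z.2) *
        (heightRatio z.1 z.2 * wiggle (logBase z.1 z.2)))) := by
    funext z
    rw [saddleStream]
    ring
  rw [stream_eq]
  refine HasPartials.congr_partials (((HasPartials.snd (x, 0)).mul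
    (HasPartials.const (speedProfile (radiusSq x 0)) (x, 0))).add
      (HasPartials.snd_mul_of_tendsto_zero remainder_tendsto)) ?_ ?_
  · simp [saddleSnd]
  · simp [saddleFst, heightRatio]

theorem hasPartials_saddleStream (x y : ℝ) :
    HasPartials (fun z => saddleStream z.1 z.2) (-saddleSnd x y) (saddleFst x y) (x, y) := by
  rcases eq_or_ne y 0 with rfl | hy
  exacts [hasPartials_saddleStream_axis x, hasPartials_saddleStream_of_ne_zero hy]

theorem continuous_saddleStream : Continuous fun z : ℝ × ℝ => saddleStream z.1 z.2 :=
  continuous_iff_continuousAt.2 fun z => (hasPartials_saddleStream z.1 z.2).continuousAt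

theorem abs_wiggle_combination_le {A B a b : ℝ} (x y : ℝ) (hA : |A| ≤ a) (hB : |B| ≤ b) :
    |1 / 20 * (A * (heightRatio x y * wiggle (logBase x y)) +
      B * (heightRatio x y * wiggleDeriv (logBase x y)))| ≤
      (a / 40 + 3 * b / 20) * heightRatio x y := by
  have a_nonneg := (abs_nonneg A).trans hA
  have b_nonneg := (abs_nonneg B).trans hB
  have ratio_nonneg := heightRatio_nonneg x y
  calc _ ≤ 1 / 20 * (|A| * (heightRatio x y * |wiggle (logBase x y)|) +
        |B| * (heightRatio x y * |wiggleDeriv (logBase x y)|)) := by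
        rw [abs_mul, abs_of_pos (by norm_num : (0 : ℝ) < 1 / 20)]
        gcongr
        refine (abs_add_le _ _).trans_eq ?_
        simp only [abs_mul, abs_of_nonneg ratio_nonneg]
    _ ≤ 1 / 20 * (a * (heightRatio x y * (1 / 2)) + b * (heightRatio x y * 3)) := by
        gcongr
        exacts [abs_wiggle_le _, abs_wiggleDeriv_le _]
    _ = _ := by ring

theorem abs_saddleFst_sub_le (x y : ℝ) :
    |saddleFst x y - speedProfile (radiusSq x y) *
      (1 + 2 * heightRatio x y * speedExponent (radiusSq x y))| ≤
      speedProfile (radiusSq x y) * (2 / 5 * heightRatio x y) := by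
  have ratio_nonneg := heightRatio_nonneg x y
  have ratio_le_one := heightRatio_le_one x y
  obtain ⟨stretch_nonneg, stretch_le_one⟩ := two_mul_heightRatio_mul_speedExponent_mem_Icc x y
  rw [saddleFst, ← mul_sub, add_sub_cancel_left, abs_mul,
    abs_of_nonneg (speedProfile_nonneg (radiusSq x y))]
  refine mul_le_mul_of_nonneg_left ?_ (speedProfile_nonneg _)
  refine (abs_wiggle_combination_le (a := 4) (b := 2) x y ?_ ?_).trans_eq (by norm_num) <;>
  · rw [abs_le]
    constructor <;> linarith

theorem half_le_saddleFst (x y : ℝ) : speedProfile (radiusSq x y) / 2 ≤ saddleFst x y := by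
  have error_ge := (abs_le.1 (abs_saddleFst_sub_le x y)).1
  have stretch_nonneg := (two_mul_heightRatio_mul_speedExponent_mem_Icc x y).1
  have speed_nonneg := speedProfile_nonneg (radiusSq x y)
  nlinarith [heightRatio_le_one x y, mul_nonneg speed_nonneg stretch_nonneg]

theorem abs_saddleFst_le (x y : ℝ) : |saddleFst x y| ≤ 3 * speedProfile (radiusSq x y) := by
  have error_le := (abs_le.1 (abs_saddleFst_sub_le x y)).2
  have stretch_le_one := (two_mul_heightRatio_mul_speedExponent_mem_Icc x y).2
  have speed_nonneg := speedProfile_nonneg (radiusSq x y)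
  rw [abs_of_nonneg (by linarith [half_le_saddleFst x y])]
  nlinarith [heightRatio_le_one x y]

theorem abs_saddleSnd_add_le (x y : ℝ) :
    |saddleSnd x y + speedProfile (radiusSq x y) *
      (x * y / radiusSq x y * (2 * speedExponent (radiusSq x y)))| ≤
      speedProfile (radiusSq x y) * heightRatio x y := by
  have exponent_nonneg := speedExponent_nonneg (radiusSq_nonneg x y)
  have exponent_le := speedExponent_le (radiusSq_nonneg x y)
  have speed_nonneg := speedProfile_nonneg (radiusSq x y)
  have perturbation_le := abs_wiggle_combination_le (a := 2) (b := 1) x y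
    (A := 2 * speedExponent (radiusSq x y) - 2) (by rw [abs_le]; constructor <;> linarith)
    (abs_two_mul_speedExponent_le (radiusSq_nonneg x y))
  rw [saddleSnd, ← mul_add, neg_mul, mul_add (x * y / radiusSq x y), neg_add, neg_add_cancel_comm,
    abs_mul, abs_neg, abs_mul, abs_of_nonneg speed_nonneg]
  gcongr
  calc _ ≤ 1 * ((2 / 40 + 3 * 1 / 20) * heightRatio x y) :=
        mul_le_mul (abs_mul_div_radiusSq_le x y) perturbation_le (abs_nonneg _) zero_le_one
    _ ≤ heightRatio x y := by linarith [heightRatio_nonneg x y]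

theorem abs_saddleSnd_le (x y : ℝ) : |saddleSnd x y| ≤ 3 * speedProfile (radiusSq x y) := by
  have speed_nonneg := speedProfile_nonneg (radiusSq x y)
  have main_le : |speedProfile (radiusSq x y) *
      (x * y / radiusSq x y * (2 * speedExponent (radiusSq x y)))| ≤
      speedProfile (radiusSq x y) * (1 * 1) := by
    rw [abs_mul, abs_mul, abs_of_nonneg speed_nonneg]
    gcongr
    exacts [abs_mul_div_radiusSq_le x y, abs_two_mul_speedExponent_le (radiusSq_nonneg x y)]
  have := abs_le.1 (abs_saddleSnd_add_le x y)
  have := abs_le.1 main_le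
  have := mul_le_of_le_one_right speed_nonneg (heightRatio_le_one x y)
  rw [abs_le]
  constructor <;> linarith

/-! ### Derivative bounds off the axis -/

/-- Functions which, off the axis, are bounded and have partial derivatives bounded by
`(1 + |log (y M)|) / |z|`, up to constants. The saddle field is `M` times such functions. -/
def IsTame (F : ℝ × ℝ → ℝ) : Prop :=
  ∃ C : ℝ, 0 ≤ C ∧ ∀ x y : ℝ, y ≠ 0 → |F (x, y)| ≤ C ∧ ∃ a b : ℝ, HasPartials F a b (x, y) ∧
    √(radiusSq x y) * |a| ≤ C * (1 + |logBase x y|) ∧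
    √(radiusSq x y) * |b| ≤ C * (1 + |logBase x y|)

theorem mul_abs_leibniz_le {r a g f a' C D K : ℝ} (hr : 0 ≤ r) (hC : 0 ≤ C) (hf : |f| ≤ C)
    (hg : |g| ≤ D) (ha : r * |a| ≤ C * K) (ha' : r * |a'| ≤ D * K) :
    r * |a * g + f * a'| ≤ 2 * C * D * K := by
  have CK_nonneg : 0 ≤ C * K := le_trans (by positivity) ha
  calc r * |a * g + f * a'| ≤ r * (|a| * |g| + |f| * |a'|) := by
        rw [← abs_mul, ← abs_mul]
        gcongr
        exact abs_add_le _ _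
    _ = (r * |a|) * |g| + |f| * (r * |a'|) := by ring
    _ ≤ (C * K) * D + C * (D * K) := by gcongr
    _ = 2 * C * D * K := by ring

theorem mul_abs_add_le {r a a' A B : ℝ} (hr : 0 ≤ r) (ha : r * |a| ≤ A) (ha' : r * |a'| ≤ B) :
    r * |a + a'| ≤ A + B := by
  linarith [mul_le_mul_of_nonneg_left (abs_add_le a a') hr]

namespace IsTame

variable {F G : ℝ × ℝ → ℝ}

theorem const (c : ℝ) : IsTame fun _ => c := by
  refine ⟨|c|, abs_nonneg c, fun x y _ => ⟨le_rfl, 0, 0, HasPartials.const c _, ?_, ?_⟩⟩ <;>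
  · rw [abs_zero, mul_zero]
    positivity

theorem add (hF : IsTame F) (hG : IsTame G) : IsTame fun z => F z + G z := by
  obtain ⟨C, hC, hF⟩ := hF
  obtain ⟨D, hD, hG⟩ := hG
  refine ⟨C + D, by positivity, fun x y hy => ?_⟩
  obtain ⟨F_le, a, b, hasPartials_F, ha, hb⟩ := hF x y hy
  obtain ⟨G_le, a', b', hasPartials_G, ha', hb'⟩ := hG x y hy
  rw [add_mul]
  exact ⟨(abs_add_le _ _).trans (add_le_add F_le G_le), a + a', b + b',
    hasPartials_F.add hasPartials_G, mul_abs_add_le (Real.sqrt_nonneg _) ha ha',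
    mul_abs_add_le (Real.sqrt_nonneg _) hb hb'⟩

theorem mul (hF : IsTame F) (hG : IsTame G) : IsTame fun z => F z * G z := by
  obtain ⟨C, hC, hF⟩ := hF
  obtain ⟨D, hD, hG⟩ := hG
  refine ⟨2 * C * D, by positivity, fun x y hy => ?_⟩
  obtain ⟨F_le, a, b, hasPartials_F, ha, hb⟩ := hF x y hy
  obtain ⟨G_le, a', b', hasPartials_G, ha', hb'⟩ := hG x y hy
  refine ⟨?_, _, _, hasPartials_F.mul hasPartials_G,
    mul_abs_leibniz_le (Real.sqrt_nonneg _) hC F_le G_le ha ha',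
    mul_abs_leibniz_le (Real.sqrt_nonneg _) hC F_le G_le hb hb'⟩
  calc |F (x, y) * G (x, y)| = |F (x, y)| * |G (x, y)| := abs_mul _ _
    _ ≤ C * D := by gcongr
    _ ≤ 2 * C * D := by linarith [mul_nonneg hC hD]

end IsTame

theorem exists_polar (x : ℝ) {y : ℝ} (hy : y ≠ 0) : ∃ r α β : ℝ, 0 < r ∧ x = r * α ∧ y = r * β ∧
    radiusSq x y = r ^ 2 ∧ |α| ≤ 1 ∧ |β| ≤ 1 := by
  have radiusSq_pos := radiusSq_pos_of_right x hy
  have sqrt_pos := Real.sqrt_pos.2 radiusSq_pos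
  refine ⟨√(radiusSq x y), x / √(radiusSq x y), y / √(radiusSq x y), sqrt_pos,
    (mul_div_cancel₀ x sqrt_pos.ne').symm, (mul_div_cancel₀ y sqrt_pos.ne').symm,
    (Real.sq_sqrt radiusSq_pos.le).symm, ?_, ?_⟩ <;>
  · rw [abs_div, abs_of_pos sqrt_pos]
    refine div_le_one_of_le₀ (Real.abs_le_sqrt ?_) sqrt_pos.le
    unfold radiusSq
    nlinarith

theorem mul_abs_le_of_eq_div {r a P C : ℝ} (hr : 0 < r) (ha : a = P / r) (hP : |P| ≤ C) :
    r * |a| ≤ C := by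
  rwa [ha, abs_div, abs_of_pos hr, mul_div_cancel₀ _ hr.ne']

theorem abs_mul_add_mul_le {p k g g' C K : ℝ} (hp : |p| ≤ 2) (hk : |k| ≤ 2) (hg : |g| ≤ C)
    (hg' : |g'| ≤ C * K) (hK : 1 ≤ K) : |p * g + k * g'| ≤ 4 * C * K := by
  have C_nonneg := (abs_nonneg g).trans hg
  calc |p * g + k * g'| ≤ |p| * |g| + |k| * |g'| := by
        rw [← abs_mul, ← abs_mul]
        exact abs_add_le _ _
    _ ≤ 2 * C + 2 * (C * K) := by gcongr
    _ ≤ 4 * C * K := by nlinarith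

theorem mul_abs_partials_heightRatio_mul_le {r α β e g g' C K : ℝ} (hr : 0 < r) (hβ' : β ≠ 0)
    (hα : |α| ≤ 1) (hβ : |β| ≤ 1) (he0 : 0 ≤ e) (he : |2 * e| ≤ 1) (hg : |g| ≤ C)
    (hg' : |g'| ≤ C * K) (hK : 1 ≤ K) :
    r * |-2 * (r * α) * (r * β) ^ 2 / (r ^ 2) ^ 2 * g +
      (r * β) ^ 2 / r ^ 2 * (g' * (e / r ^ 2 * (2 * (r * α))))| ≤ 4 * C * K ∧
    r * |(2 * (r * β) / r ^ 2 - 2 * (r * β) ^ 3 / (r ^ 2) ^ 2) * g +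
      (r * β) ^ 2 / r ^ 2 * (g' * (1 / (r * β) + e / r ^ 2 * (2 * (r * β))))| ≤ 4 * C * K := by
  have β_sq_le : β ^ 2 ≤ 1 := (sq_le_one_iff_abs_le_one β).2 hβ
  have abs_α_mul_le : |α * β ^ 2| ≤ 1 := by
    rw [abs_mul, abs_of_nonneg (sq_nonneg β)]
    exact mul_le_one₀ hα (sq_nonneg β) β_sq_le
  have abs_β_mul_le {c : ℝ} (hc0 : 0 ≤ c) (hc2 : c ≤ 2) : |β * c| ≤ 2 := by
    rw [abs_mul, abs_of_nonneg hc0]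
    exact (mul_le_of_le_one_left hc0 hβ).trans hc2
  constructor
  · refine mul_abs_le_of_eq_div (P := -2 * (α * β ^ 2) * g + α * β ^ 2 * (2 * e) * g') hr
      (by field) (abs_mul_add_mul_le ?_ ?_ hg hg' hK)
    · rw [abs_mul, abs_neg, abs_two]
      linarith
    · rw [abs_mul]
      exact (mul_le_one₀ abs_α_mul_le (abs_nonneg _) he).trans one_le_two
  · refine mul_abs_le_of_eq_div (P := β * (2 * (1 - β ^ 2)) * g + β * (1 + 2 * e * β ^ 2) * g') hr
      (by field) (abs_mul_add_mul_le (abs_β_mul_le ?_ ?_) (abs_β_mul_le ?_ ?_) hg hg' hK)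
    · linarith
    · linarith [sq_nonneg β]
    · positivity
    · nlinarith [(abs_le.1 he).2, sq_nonneg β]

theorem isTame_heightRatio_mul {φ φ' : ℝ → ℝ} {C : ℝ} (hφ : ∀ u, HasDerivAt φ (φ' u) u)
    (φ_le : ∀ u, |φ u| ≤ C) (φ'_le : ∀ u, |φ' u| ≤ C * (1 + |u|)) :
    IsTame fun z => heightRatio z.1 z.2 * φ (logBase z.1 z.2) := by
  have C_nonneg := (abs_nonneg _).trans (φ_le 0)
  refine ⟨4 * C, by positivity, fun x y hy => ?_⟩
  refine ⟨?_, _, _, (hasPartials_heightRatio (radiusSq_pos_of_right x hy)).mul (HasPartials.comp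
    (F := fun z => logBase z.1 z.2) (z := (x, y)) (hφ _) (hasPartials_logBase hy)), ?_⟩
  · calc |heightRatio x y * φ (logBase x y)| = heightRatio x y * |φ (logBase x y)| := by
          rw [abs_mul, abs_of_nonneg (heightRatio_nonneg x y)]
      _ ≤ 1 * C := by
          gcongr
          exacts [heightRatio_le_one x y, φ_le _]
      _ ≤ 4 * C := by linarith
  · have exponent_nonneg := speedExponent_nonneg (radiusSq_nonneg x y)
    have exponent_le := abs_two_mul_speedExponent_le (radiusSq_nonneg x y)
    obtain ⟨r, α, β, hr, rfl, rfl, radiusSq_eq, hα, hβ⟩ := exists_polar x hy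
    simp only [heightRatio, radiusSq_eq, Real.sqrt_sq hr.le] at exponent_nonneg exponent_le ⊢
    exact mul_abs_partials_heightRatio_mul_le hr (right_ne_zero_of_mul hy) hα hβ exponent_nonneg
      exponent_le (φ_le _) (φ'_le _) (le_add_of_nonneg_right (abs_nonneg _))

theorem isTame_heightRatio : IsTame fun z => heightRatio z.1 z.2 := by
  simpa only [mul_one] using isTame_heightRatio_mul (φ := fun _ => 1) (φ' := fun _ => 0) (C := 1)
    (fun u => hasDerivAt_const u 1) (fun _ => by simp) (fun u => by rw [abs_zero]; positivity)

theorem isTame_heightRatio_mul_wiggle :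
    IsTame fun z => heightRatio z.1 z.2 * wiggle (logBase z.1 z.2) :=
  isTame_heightRatio_mul (C := 3) hasDerivAt_wiggle
    (fun u => (abs_wiggle_le u).trans (by norm_num))
    (fun u => (abs_wiggleDeriv_le u).trans (by linarith [abs_nonneg u]))

theorem isTame_heightRatio_mul_wiggleDeriv :
    IsTame fun z => heightRatio z.1 z.2 * wiggleDeriv (logBase z.1 z.2) :=
  isTame_heightRatio_mul (C := 18) hasDerivAt_wiggleDeriv
    (fun u => (abs_wiggleDeriv_le u).trans (by norm_num)) abs_wiggleDeriv₂_le

theorem isTame_mul_div_radiusSq : IsTame fun z => z.1 * z.2 / radiusSq z.1 z.2 := by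
  refine ⟨3, by norm_num, fun x y hy => ?_⟩
  have hasPartials_quotient := ((HasPartials.fst (x, y)).mul (HasPartials.snd (x, y))).mul
    (hasPartials_inv_radiusSq (radiusSq_pos_of_right x hy))
  refine ⟨(abs_mul_div_radiusSq_le x y).trans (by norm_num), _, _, hasPartials_quotient, ?_⟩
  have abs_sub_two_mul_le {α β : ℝ} (hα : |α| ≤ 1) (hβ : |β| ≤ 1) :
      |β - 2 * (α ^ 2 * β)| ≤ 3 * (1 + |logBase x y|) := by
    have α_sq_le := (sq_le_one_iff_abs_le_one α).2 hα
    calc |β - 2 * (α ^ 2 * β)| ≤ |β| + |2 * (α ^ 2 * β)| := abs_sub _ _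
      _ = |β| + 2 * (α ^ 2 * |β|) := by
          rw [abs_mul 2, abs_mul, abs_two, abs_of_nonneg (sq_nonneg α)]
      _ ≤ 1 + 2 * (1 * 1) := by gcongr
      _ ≤ 3 * (1 + |logBase x y|) := by linarith [abs_nonneg (logBase x y)]
  obtain ⟨r, α, β, hr, rfl, rfl, radiusSq_eq, hα, hβ⟩ := exists_polar x hy
  rw [radiusSq_eq, Real.sqrt_sq hr.le]
  exact ⟨mul_abs_le_of_eq_div hr (by field) (abs_sub_two_mul_le hα hβ),
    mul_abs_le_of_eq_div hr (by field) (abs_sub_two_mul_le hβ hα)⟩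

theorem isTame_speedExponent : IsTame fun z => speedExponent (radiusSq z.1 z.2) := by
  refine ⟨2, by norm_num, fun x y hy => ?_⟩
  have radiusSq_pos := radiusSq_pos_of_right x hy
  have deriv_le := abs_mul_deriv_speedExponent_le radiusSq_pos
  refine ⟨?_, _, _, HasPartials.comp (F := fun z => radiusSq z.1 z.2) (z := (x, y))
    (hasDerivAt_speedExponent radiusSq_pos) (hasPartials_radiusSq x y), ?_⟩
  · rw [abs_of_nonneg (speedExponent_nonneg radiusSq_pos.le)]
    linarith [speedExponent_le radiusSq_pos.le]
  generalize -speedExponent (radiusSq x y) / (1 + radiusSq x y) - 2 /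
    (logFactor (radiusSq x y) ^ 2 * radiusSq x y * (1 + radiusSq x y) ^ 2) = d at *
  obtain ⟨r, α, β, hr, rfl, rfl, radiusSq_eq, hα, hβ⟩ := exists_polar x hy
  rw [radiusSq_eq] at deriv_le ⊢
  rw [Real.sqrt_sq hr.le]
  have scaled_le {γ : ℝ} (hγ : |γ| ≤ 1) : r * |d * (2 * (r * γ))| ≤
      2 * (1 + |logBase (r * α) (r * β)|) := by
    refine mul_abs_le_of_eq_div (P := r ^ 2 * d * (2 * γ)) hr (by field) ?_
    calc |r ^ 2 * d * (2 * γ)| = r ^ 2 * |d| * (2 * |γ|) := by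
          rw [abs_mul, abs_mul, abs_mul, abs_two, abs_of_nonneg (sq_nonneg r)]
      _ ≤ 1 * (2 * 1) := by gcongr
      _ ≤ _ := by linarith [abs_nonneg (logBase (r * α) (r * β))]
  exact ⟨scaled_le hα, scaled_le hβ⟩

theorem exists_isTame_saddleFst : ∃ P : ℝ × ℝ → ℝ, IsTame P ∧
    ∀ z : ℝ × ℝ, saddleFst z.1 z.2 = speedProfile (radiusSq z.1 z.2) * P z := by
  have isTame_stretch := ((IsTame.const 2).mul isTame_heightRatio).mul isTame_speedExponent
  refine ⟨_, ((IsTame.const 1).add isTame_stretch).add ((IsTame.const (1 / 20)).mul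
    (((((IsTame.const 3).add isTame_stretch).add ((IsTame.const (-2)).mul isTame_heightRatio)).mul
      isTame_heightRatio_mul_wiggle).add
      (((IsTame.const 1).add isTame_stretch).mul isTame_heightRatio_mul_wiggleDeriv))),
    fun z => ?_⟩
  rw [saddleFst]
  ring

theorem exists_isTame_saddleSnd : ∃ P : ℝ × ℝ → ℝ, IsTame P ∧
    ∀ z : ℝ × ℝ, saddleSnd z.1 z.2 = speedProfile (radiusSq z.1 z.2) * P z := by
  have isTame_exponent := (IsTame.const 2).mul isTame_speedExponent
  refine ⟨_, ((IsTame.const (-1)).mul isTame_mul_div_radiusSq).mul (isTame_exponent.add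
    ((IsTame.const (1 / 20)).mul (((isTame_exponent.add (IsTame.const (-2))).mul
      isTame_heightRatio_mul_wiggle).add
      (isTame_exponent.mul isTame_heightRatio_mul_wiggleDeriv)))), fun z => ?_⟩
  rw [saddleSnd]
  ring

theorem speedProfile_le_sqrt_mul {s : ℝ} (hs : 0 ≤ s) :
    speedProfile s ≤ √s * logFactor s ^ 2 := by
  rw [speedProfile]
  gcongr
  exact div_le_self hs (by linarith)

theorem abs_partial_speedProfile_mul_le {r γ P a C K : ℝ} (hr : 0 < r) (hγ : |γ| ≤ 1)
    (hP : |P| ≤ C) (ha : r * |a| ≤ C * K) (hK : 1 ≤ K) :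
    |speedExponent (r ^ 2) * speedProfile (r ^ 2) / r ^ 2 * (2 * (r * γ)) * P +
      speedProfile (r ^ 2) * a| ≤ 2 * C * (logFactor (r ^ 2) ^ 2 * K) := by
  have C_nonneg := (abs_nonneg P).trans hP
  have speed_div_le : |speedProfile (r ^ 2) / r| ≤ logFactor (r ^ 2) ^ 2 := by
    rw [abs_of_nonneg (div_nonneg (speedProfile_nonneg _) hr.le), div_le_iff₀' hr]
    simpa only [Real.sqrt_sq hr.le] using speedProfile_le_sqrt_mul (sq_nonneg r)
  have factor : speedExponent (r ^ 2) * speedProfile (r ^ 2) / r ^ 2 * (2 * (r * γ)) * P +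
      speedProfile (r ^ 2) * a =
      speedProfile (r ^ 2) / r * (2 * speedExponent (r ^ 2) * γ * P + r * a) := by
    field
  calc _ ≤ logFactor (r ^ 2) ^ 2 * (|2 * speedExponent (r ^ 2)| * |γ| * |P| + r * |a|) := by
        rw [factor, abs_mul]
        gcongr
        refine (abs_add_le _ _).trans_eq ?_
        rw [abs_mul, abs_mul _ γ, abs_mul r, abs_of_pos hr]
    _ ≤ logFactor (r ^ 2) ^ 2 * (1 * 1 * C + C * K) := by
        gcongr
        exact abs_two_mul_speedExponent_le (sq_nonneg r)
    _ ≤ logFactor (r ^ 2) ^ 2 * (2 * C * K) := by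
        gcongr
        nlinarith
    _ = 2 * C * (logFactor (r ^ 2) ^ 2 * K) := by ring

theorem IsTame.exists_partials_speedProfile_mul_le {F P : ℝ × ℝ → ℝ} (hP : IsTame P)
    (hF : ∀ z, F z = speedProfile (radiusSq z.1 z.2) * P z) :
    ∃ C : ℝ, 0 ≤ C ∧ ∀ x y : ℝ, y ≠ 0 → ∃ a b : ℝ, HasPartials F a b (x, y) ∧
      |a| + |b| ≤ C * (logFactor (radiusSq x y) ^ 2 * (1 + |logBase x y|)) := by
  obtain ⟨C, hC, hP⟩ := hP
  rw [funext hF]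
  refine ⟨4 * C, by positivity, fun x y hy => ?_⟩
  obtain ⟨P_le, a, b, hasPartials_P, ha, hb⟩ := hP x y hy
  refine ⟨_, _, (hasPartials_speedProfile (radiusSq_pos_of_right x hy)).mul hasPartials_P, ?_⟩
  have one_le : 1 ≤ 1 + |logBase x y| := le_add_of_nonneg_right (abs_nonneg _)
  obtain ⟨r, α, β, hr, rfl, rfl, radiusSq_eq, hα, hβ⟩ := exists_polar x hy
  rw [radiusSq_eq, Real.sqrt_sq hr.le] at ha hb
  rw [radiusSq_eq]
  linarith [abs_partial_speedProfile_mul_le hr hα P_le ha one_le,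
    abs_partial_speedProfile_mul_le hr hβ P_le hb one_le]

/-! ### Regularity of the saddle field -/

theorem exists_eventually_speedProfile_mul_heightRatio_le_sq {x : ℝ} (hx : x ≠ 0) :
    ∃ C : ℝ, ∀ᶠ z : ℝ × ℝ in 𝓝 (x, 0),
      speedProfile (radiusSq z.1 z.2) * heightRatio z.1 z.2 ≤ C * z.2 ^ 2 := by
  have radiusSq_pos := radiusSq_pos_of_left hx 0
  refine ⟨64 / (radiusSq x 0 / 2), ?_⟩
  filter_upwards [(continuous_radiusSq.tendsto (x, 0)).eventually_const_lt
    (half_lt_self radiusSq_pos)] with z half_lt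
  rw [heightRatio]
  calc speedProfile (radiusSq z.1 z.2) * (z.2 ^ 2 / radiusSq z.1 z.2)
      ≤ 64 * (z.2 ^ 2 / (radiusSq x 0 / 2)) := by
        gcongr
        · exact div_nonneg (sq_nonneg _) (radiusSq_nonneg _ _)
        · exact speedProfile_le_const (radiusSq_nonneg _ _)
    _ = 64 / (radiusSq x 0 / 2) * z.2 ^ 2 := by ring

theorem differentiableAt_saddleFst_axis {x : ℝ} (hx : x ≠ 0) :
    DifferentiableAt ℝ (fun z : ℝ × ℝ => saddleFst z.1 z.2) (x, 0) := by
  obtain ⟨C, eventually_le⟩ := exists_eventually_speedProfile_mul_heightRatio_le_sq hx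
  have hasPartials_error : HasPartials
      (fun z => saddleFst z.1 z.2 - speedProfile (radiusSq z.1 z.2)) 0 0 (x, 0) := by
    refine HasPartials.of_abs_le_sq_snd (C := 2 * C) ?_
    filter_upwards [eventually_le] with z hz
    have error_le := abs_le.1 (abs_saddleFst_sub_le z.1 z.2)
    have exponent_nonneg := speedExponent_nonneg (radiusSq_nonneg z.1 z.2)
    have exponent_le := speedExponent_le (radiusSq_nonneg z.1 z.2)
    have product_nonneg :=
      mul_nonneg (speedProfile_nonneg (radiusSq z.1 z.2)) (heightRatio_nonneg z.1 z.2)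
    rw [abs_le]
    constructor <;> nlinarith [mul_nonneg product_nonneg exponent_nonneg,
      mul_nonneg product_nonneg (sub_nonneg.2 exponent_le)]
  simpa only [add_sub_cancel] using
    ((hasPartials_speedProfile (radiusSq_pos_of_left hx 0)).add hasPartials_error).differentiableAt

theorem differentiableAt_saddleSnd_axis {x : ℝ} (hx : x ≠ 0) :
    DifferentiableAt ℝ (fun z : ℝ × ℝ => saddleSnd z.1 z.2) (x, 0) := by
  have radiusSq_pos := radiusSq_pos_of_left hx 0
  obtain ⟨C, eventually_le⟩ := exists_eventually_speedProfile_mul_heightRatio_le_sq hx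
  have hasPartials_error : HasPartials (fun z => saddleSnd z.1 z.2 +
      speedProfile (radiusSq z.1 z.2) *
        (z.1 * z.2 / radiusSq z.1 z.2 * (2 * speedExponent (radiusSq z.1 z.2)))) 0 0 (x, 0) := by
    refine HasPartials.of_abs_le_sq_snd (C := C) ?_
    filter_upwards [eventually_le] with z hz
    exact (abs_saddleSnd_add_le z.1 z.2).trans hz
  have hasPartials_main := (hasPartials_speedProfile radiusSq_pos).mul
    ((((HasPartials.fst (x, 0)).mul (HasPartials.snd (x, 0))).mul
      (hasPartials_inv_radiusSq radiusSq_pos)).mul ((HasPartials.const 2 (x, 0)).mul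
        (HasPartials.comp (F := fun z => radiusSq z.1 z.2) (z := (x, 0))
          (hasDerivAt_speedExponent radiusSq_pos) (hasPartials_radiusSq x 0))))
  simp only [← div_eq_mul_inv] at hasPartials_main
  simpa only [Pi.sub_def, add_sub_cancel_right] using
    hasPartials_error.differentiableAt.sub hasPartials_main.differentiableAt

theorem differentiableAt_of_isTame {F P : ℝ × ℝ → ℝ} (hP : IsTame P)
    (hF : ∀ z, F z = speedProfile (radiusSq z.1 z.2) * P z)
    (hF_axis : ∀ x, x ≠ 0 → DifferentiableAt ℝ F (x, 0)) {z : ℝ × ℝ} (hz : z ≠ 0) :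
    DifferentiableAt ℝ F z := by
  obtain ⟨x, y⟩ := z
  rcases eq_or_ne y 0 with rfl | hy
  · exact hF_axis x fun hx => hz (by rw [hx]; rfl)
  · obtain ⟨C, -, exists_partials⟩ := hP.exists_partials_speedProfile_mul_le hF
    obtain ⟨a, b, hasPartials, -⟩ := exists_partials x y hy
    exact hasPartials.differentiableAt

theorem differentiableAt_saddleFst {z : ℝ × ℝ} (hz : z ≠ 0) :
    DifferentiableAt ℝ (fun z : ℝ × ℝ => saddleFst z.1 z.2) z := by
  obtain ⟨P, isTame_P, eq_mul⟩ := exists_isTame_saddleFst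
  exact differentiableAt_of_isTame isTame_P eq_mul (fun _ => differentiableAt_saddleFst_axis) hz

theorem differentiableAt_saddleSnd {z : ℝ × ℝ} (hz : z ≠ 0) :
    DifferentiableAt ℝ (fun z : ℝ × ℝ => saddleSnd z.1 z.2) z := by
  obtain ⟨P, isTame_P, eq_mul⟩ := exists_isTame_saddleSnd
  exact differentiableAt_of_isTame isTame_P eq_mul (fun _ => differentiableAt_saddleSnd_axis) hz

theorem continuous_of_abs_le_speedProfile {F : ℝ × ℝ → ℝ} {C : ℝ}
    (hF : ∀ z, |F z| ≤ C * speedProfile (radiusSq z.1 z.2))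
    (hd : ∀ z, z ≠ 0 → DifferentiableAt ℝ F z) : Continuous F := by
  rw [continuous_iff_continuousAt]
  intro z
  rcases eq_or_ne z 0 with rfl | hz
  · have profile_zero : C * speedProfile (radiusSq (0 : ℝ × ℝ).1 (0 : ℝ × ℝ).2) = 0 := by
      simp [radiusSq, speedProfile_zero]
    have majorant_tendsto := (continuous_speedProfile_radiusSq.const_mul C).tendsto 0
    rw [profile_zero] at majorant_tendsto
    rw [ContinuousAt, abs_nonpos_iff.1 ((hF 0).trans_eq profile_zero)]
    exact squeeze_zero_norm hF majorant_tendsto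
  · exact (hd z hz).continuousAt

theorem continuous_saddleFst : Continuous fun z : ℝ × ℝ => saddleFst z.1 z.2 :=
  continuous_of_abs_le_speedProfile (fun z => abs_saddleFst_le z.1 z.2)
    fun _ hz => differentiableAt_saddleFst hz

theorem continuous_saddleSnd : Continuous fun z : ℝ × ℝ => saddleSnd z.1 z.2 :=
  continuous_of_abs_le_speedProfile (fun z => abs_saddleSnd_le z.1 z.2)
    fun _ hz => differentiableAt_saddleSnd hz

theorem saddleStream_neg (x y : ℝ) : saddleStream x (-y) = -saddleStream x y := by
  simp only [saddleStream, heightRatio, logBase, radiusSq, neg_mul, Real.log_neg_eq_log, even_two,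
    Even.neg_pow]

theorem half_mul_le_saddleStream (x : ℝ) {y : ℝ} (hy : 0 ≤ y) :
    y * speedProfile (radiusSq x y) / 2 ≤ saddleStream x y := by
  have base_nonneg := mul_nonneg hy (speedProfile_nonneg (radiusSq x y))
  have oscillation_ge : -(1 / 2) ≤ heightRatio x y * wiggle (logBase x y) := by
    nlinarith [heightRatio_nonneg x y, heightRatio_le_one x y,
      (abs_le.1 (abs_wiggle_le (logBase x y))).1]
  rw [saddleStream]
  nlinarith

theorem tendsto_saddleStream_atTop (x : ℝ) : Tendsto (saddleStream x) atTop atTop := by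
  have half_speed_pos : 0 < speedProfile 1 / 2 := half_pos (speedProfile_pos one_pos)
  refine tendsto_atTop_mono' atTop ?_ (tendsto_id.atTop_mul_const half_speed_pos)
  filter_upwards [eventually_ge_atTop 1] with y hy
  have y_nonneg : 0 ≤ y := by linarith
  calc y * (speedProfile 1 / 2) ≤ y * (speedProfile (radiusSq x y) / 2) := by
        gcongr
        exact monotoneOn_speedProfile (by simp) (radiusSq_nonneg x y)
          (by unfold radiusSq; nlinarith)
    _ = y * speedProfile (radiusSq x y) / 2 := by ring
    _ ≤ saddleStream x y := half_mul_le_saddleStream x y_nonneg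

theorem surjective_saddleStream (x : ℝ) : Function.Surjective (saddleStream x) := by
  have continuous_stream : Continuous (saddleStream x) :=
    continuous_saddleStream.comp (Continuous.prodMk_right x)
  refine continuous_stream.surjective (tendsto_saddleStream_atTop x) ?_
  refine ((tendsto_neg_atTop_atBot.comp (tendsto_saddleStream_atTop x)).comp
    tendsto_neg_atBot_atTop).congr fun y => ?_
  simp [saddleStream_neg]

theorem isGraphStreamFunction_saddle :
    IsGraphStreamFunction saddleStream saddleFst saddleSnd 192 where
  hasFDerivAt x y := by
    have hasPartials := hasPartials_saddleStream x y
    rw [HasPartials] at hasPartials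
    convert! hasPartials using 1
    ext <;> simp
  cont_fst := continuous_saddleFst
  cont_snd := continuous_saddleSnd
  abs_fst_le x y := (abs_saddleFst_le x y).trans
    (by linarith [speedProfile_le_const (radiusSq_nonneg x y)])
  abs_snd_le x y := (abs_saddleSnd_le x y).trans
    (by linarith [speedProfile_le_const (radiusSq_nonneg x y)])
  pos x y hy := (half_pos (speedProfile_pos (radiusSq_pos_of_right x hy))).trans_le
    (half_le_saddleFst x y)
  map_zero x := by simp [saddleStream]
  surjective := surjective_saddleStream

/-! ### Weak derivatives in the plane -/

theorem integral_plane {E : Type*} [NormedAddCommGroup E] [NormedSpace ℝ E] (F : ℝ × ℝ → E) :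
    ∫ z : Euc 2, F (planeCLE z) = ∫ z, F z :=
  measurePreserving_planeCLE.integral_comp measurableEmbedding_planeCLE F

theorem exists_notMem_tsupport_of_le_norm {F E : Type*} [SeminormedAddCommGroup F] [Zero E]
    {g : F → E} (hg : HasCompactSupport g) :
    ∃ R : ℝ, 0 ≤ R ∧ ∀ z : F, R ≤ ‖z‖ → z ∉ tsupport g := by
  obtain ⟨R, R_pos, tsupport_subset⟩ := hg.isCompact.isBounded.subset_ball_lt 0 (0 : F)
  exact ⟨R, R_pos.le, fun z hz mem_tsupport =>
    hz.not_gt (mem_ball_zero_iff.1 (tsupport_subset mem_tsupport))⟩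

theorem integral_fderiv_prod_eq_zero {E : Type*} [NormedAddCommGroup E] [NormedSpace ℝ E]
    {g : ℝ × ℝ → E} (hc : Continuous g) (hs : HasCompactSupport g)
    (hd : ∀ z, z ≠ 0 → DifferentiableAt ℝ g z) (v : ℝ × ℝ)
    (hi : Integrable fun z => fderiv ℝ g z v) : ∫ z, fderiv ℝ g z v = 0 := by
  obtain ⟨R, R_nonneg, notMem_tsupport⟩ := exists_notMem_tsupport_of_le_norm hs
  have eq_zero {z : ℝ × ℝ} (hz : R ≤ ‖z‖) : g z = 0 :=
    image_eq_zero_of_notMem_tsupport (notMem_tsupport z hz)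
  have fderiv_eq_zero {z : ℝ × ℝ} (hz : R ≤ ‖z‖) : fderiv ℝ g z = 0 :=
    image_eq_zero_of_notMem_tsupport fun h => notMem_tsupport z hz (tsupport_fderiv_subset ℝ h)
  have box_eq : Icc (-R, -R) (R, R) = Metric.closedBall (0 : ℝ × ℝ) R := by
    rw [← Icc_prod_Icc, ← Prod.mk_zero_zero, ← closedBall_prod_same, Real.closedBall_eq_Icc,
      zero_sub, zero_add]
  have divergence_eq (z : ℝ × ℝ) : (v.1 • fderiv ℝ g z) (1, 0) + (v.2 • fderiv ℝ g z) (0, 1) =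
      fderiv ℝ g z v := by
    rw [smul_apply, smul_apply, ← map_smul, ← map_smul, ← map_add]
    simp
  have integral_box := integral_divergence_prod_Icc_of_hasFDerivAt_off_countable_of_le
    (fun z => v.1 • g z) (fun z => v.2 • g z)
    (fun z => v.1 • fderiv ℝ g z) (fun z => v.2 • fderiv ℝ g z) (-R, -R) (R, R)
    (Prod.mk_le_mk.2 ⟨by linarith, by linarith⟩) {0} (countable_singleton _)
    (hc.const_smul _).continuousOn (hc.const_smul _).continuousOn
    (fun z hz => (hd z hz.2).hasFDerivAt.const_smul _)
    (fun z hz => (hd z hz.2).hasFDerivAt.const_smul _)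
    (by simpa only [divergence_eq] using hi.integrableOn)
  have le_norm_right (x : ℝ) : R ≤ ‖(R, x)‖ ∧ R ≤ ‖(-R, x)‖ := by
    simp [Prod.norm_def, abs_of_nonneg R_nonneg]
  have le_norm_left (x : ℝ) : R ≤ ‖(x, R)‖ ∧ R ≤ ‖(x, -R)‖ := by
    simp [Prod.norm_def, abs_of_nonneg R_nonneg]
  simp_rw [divergence_eq] at integral_box
  rw [box_eq, setIntegral_eq_integral_of_forall_compl_eq_zero] at integral_box
  · simpa [eq_zero (le_norm_left _).1, eq_zero (le_norm_left _).2, eq_zero (le_norm_right _).1,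
      eq_zero (le_norm_right _).2] using integral_box
  · intro z hz
    rw [fderiv_eq_zero (not_le.1 fun h => hz (mem_closedBall_zero_iff.2 h)).le,
      zero_apply]

theorem integral_fderiv_plane_eq_zero {E : Type*} [NormedAddCommGroup E] [NormedSpace ℝ E]
    [CompleteSpace E] {ψ : Euc 2 → E} (hc : Continuous ψ) (hs : HasCompactSupport ψ)
    (hd : ∀ z, z ≠ 0 → DifferentiableAt ℝ ψ z) (v : Euc 2)
    (hi : Integrable fun z => fderiv ℝ ψ z v) : ∫ z, fderiv ℝ ψ z v = 0 := by
  have fderiv_eq (z : Euc 2) :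
      fderiv ℝ ψ z v = fderiv ℝ (ψ ∘ planeCLE.symm) (planeCLE z) (planeCLE v) := by
    rw [ContinuousLinearEquiv.comp_right_fderiv, ContinuousLinearMap.comp_apply,
      ContinuousLinearEquiv.coe_coe, planeCLE.symm_apply_apply, planeCLE.symm_apply_apply]
  simp_rw [fderiv_eq] at hi ⊢
  rw [integral_plane fun w => fderiv ℝ (ψ ∘ planeCLE.symm) w (planeCLE v)]
  exact integral_fderiv_prod_eq_zero (hc.comp planeCLE.symm.continuous)
    (hs.comp_homeomorph planeCLE.symm.toHomeomorph)
    (fun w hw => (hd _ (by simpa using hw)).comp w planeCLE.symm.differentiableAt) _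
    ((measurePreserving_planeCLE.integrable_comp_emb measurableEmbedding_planeCLE).1 hi)

theorem isWeakDeriv_fderiv {m : ℕ} {f : Euc 2 → Euc m} (hc : Continuous f)
    (hd : ∀ z, z ≠ 0 → DifferentiableAt ℝ f z) (hi : LocallyIntegrable (fderiv ℝ f)) :
    IsWeakDeriv f (fderiv ℝ f) := by
  refine ⟨hc.locallyIntegrable, hi, fun φ hφ hφs v => ?_⟩
  have differentiable_φ : Differentiable ℝ φ := hφ.differentiable (by simp)
  have continuous_fderiv_φ : Continuous fun z => fderiv ℝ φ z v :=
    (hφ.continuous_fderiv (by simp)).clm_apply continuous_const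
  have locallyIntegrable_fderiv_apply : LocallyIntegrable fun z => fderiv ℝ f z v := fun z =>
    let ⟨U, hU, integrableOn⟩ := hi z
    ⟨U, hU, integrableOn.apply_continuousLinearMap v⟩
  have integrable_left : Integrable fun z => fderiv ℝ φ z v • f z :=
    (continuous_fderiv_φ.smul hc).integrable_of_hasCompactSupport
      (hφs.fderiv_apply ℝ v).smul_right
  have integrable_right : Integrable fun z => φ z • fderiv ℝ f z v :=
    locallyIntegrable_fderiv_apply.integrable_smul_left_of_hasCompactSupport hφ.continuous hφs
  have leibniz : (fun z => fderiv ℝ (fun z => φ z • f z) z v) =ᵐ[volume]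
      fun z => fderiv ℝ φ z v • f z + φ z • fderiv ℝ f z v := by
    filter_upwards [Measure.ae_ne volume 0] with z hz
    rw [fderiv_fun_smul (differentiable_φ z) (hd z hz)]
    simp [add_comm]
  have integral_eq_zero := integral_fderiv_plane_eq_zero (ψ := fun z => φ z • f z)
    (hφ.continuous.smul hc) hφs.smul_right
    (fun z hz => (differentiable_φ z).smul (hd z hz)) v
    ((integrable_left.add integrable_right).congr leibniz.symm)
  rw [integral_congr_ae leibniz, integral_add integrable_left integrable_right]
    at integral_eq_zero
  exact eq_neg_of_add_eq_zero_left integral_eq_zero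

theorem integral_fderiv_mul_fderiv_comm {E : Type*} [NormedAddCommGroup E] [NormedSpace ℝ E]
    [FiniteDimensional ℝ E] [MeasurableSpace E] [BorelSpace E] {μ : Measure E}
    [μ.IsAddHaarMeasure] {φ f : E → ℝ} (hφ : ContDiff ℝ 2 φ) (hφs : HasCompactSupport φ)
    (hf : ContDiff ℝ 1 f) (v w : E) :
    ∫ z, fderiv ℝ φ z v * fderiv ℝ f z w ∂μ = ∫ z, fderiv ℝ φ z w * fderiv ℝ f z v ∂μ := by
  have contDiff_fderiv : ContDiff ℝ 1 (fderiv ℝ φ) := hφ.fderiv_right (by norm_num)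
  have contDiff_fderiv_apply (v : E) : ContDiff ℝ 1 fun z => fderiv ℝ φ z v :=
    contDiff_fderiv.clm_apply contDiff_const
  have continuous_fderiv_apply {g : E → ℝ} (hg : ContDiff ℝ 1 g) (v : E) :
      Continuous fun z => fderiv ℝ g z v :=
    (hg.continuous_fderiv (by simp)).clm_apply continuous_const
  have parts (v w : E) : ∫ z, fderiv ℝ φ z v * fderiv ℝ f z w ∂μ =
      -∫ z, fderiv ℝ (fun z => fderiv ℝ φ z v) z w * f z ∂μ := by
    refine integral_mul_fderiv_eq_neg_fderiv_mul_of_integrable ?_ ?_ ?_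
      (fun z _ => (contDiff_fderiv_apply v).differentiable (by simp) z)
      (fun z _ => hf.differentiable (by simp) z)
    · exact ((continuous_fderiv_apply (contDiff_fderiv_apply v) w).mul
        hf.continuous).integrable_of_hasCompactSupport
        ((hφs.fderiv_apply ℝ v).fderiv_apply ℝ w).mul_right
    · exact ((contDiff_fderiv_apply v).continuous.mul
        (continuous_fderiv_apply hf w)).integrable_of_hasCompactSupport
        (hφs.fderiv_apply ℝ v).mul_right
    · exact ((contDiff_fderiv_apply v).continuous.mul
        hf.continuous).integrable_of_hasCompactSupport (hφs.fderiv_apply ℝ v).mul_right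
  have fderiv_fderiv_apply (v w z : E) :
      fderiv ℝ (fun z => fderiv ℝ φ z v) z w = fderiv ℝ (fderiv ℝ φ) z w v := by
    rw [fderiv_clm_apply (contDiff_fderiv.differentiable (by simp) z) (differentiableAt_const v)]
    simp
  have symm (z : E) : fderiv ℝ (fderiv ℝ φ) z w v = fderiv ℝ (fderiv ℝ φ) z v w :=
    hφ.contDiffAt.isSymmSndFDerivAt (by simp) w v
  simp only [parts, fderiv_fderiv_apply, symm]

namespace IsGraphStreamFunction

variable {H b₁ b₂ : ℝ → ℝ → ℝ} {B : ℝ}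

theorem hasFDerivAt_plane (h : IsGraphStreamFunction H b₁ b₂ B) (z : Euc 2) :
    HasFDerivAt (fun z : Euc 2 => H (z 0) (z 1))
      ((b₁ (z 0) (z 1) • ContinuousLinearMap.snd ℝ ℝ ℝ -
        b₂ (z 0) (z 1) • ContinuousLinearMap.fst ℝ ℝ ℝ) ∘L (planeCLE : Euc 2 →L[ℝ] ℝ × ℝ)) z :=
  HasFDerivAt.comp (g := fun w : ℝ × ℝ => H w.1 w.2) z (h.hasFDerivAt (z 0) (z 1))
    planeCLE.hasFDerivAt

theorem isDivFree_planeField (h : IsGraphStreamFunction H b₁ b₂ B) :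
    IsDivFree (planeField b₁ b₂) := by
  refine ⟨h.continuous_planeField.locallyIntegrable, fun φ hφ hφs => ?_⟩
  set e₀ : Euc 2 := EuclideanSpace.single 0 1
  set e₁ : Euc 2 := EuclideanSpace.single 1 1
  set stream : Euc 2 → ℝ := fun z => H (z 0) (z 1)
  have contDiff_stream : ContDiff ℝ 1 stream := h.contDiff.comp planeCLE.contDiff
  have fderiv_stream_fst (z : Euc 2) : fderiv ℝ stream z e₀ = -b₂ (z 0) (z 1) := by
    rw [(h.hasFDerivAt_plane z).fderiv]
    simp [e₀]
  have fderiv_stream_snd (z : Euc 2) : fderiv ℝ stream z e₁ = b₁ (z 0) (z 1) := by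
    rw [(h.hasFDerivAt_plane z).fderiv]
    simp [e₁]
  have field_eq (z : Euc 2) :
      planeField b₁ b₂ z = fderiv ℝ stream z e₁ • e₀ - fderiv ℝ stream z e₀ • e₁ := by
    rw [fderiv_stream_fst, fderiv_stream_snd]
    ext i
    fin_cases i <;> simp [planeField, planeCLE, e₀, e₁]
  have integrable_mul (v w : Euc 2) : Integrable fun z => fderiv ℝ φ z v * fderiv ℝ stream z w :=
    (((hφ.continuous_fderiv (by simp)).clm_apply continuous_const).mul
      ((contDiff_stream.continuous_fderiv (by simp)).clm_apply
        continuous_const)).integrable_of_hasCompactSupport (hφs.fderiv_apply ℝ v).mul_right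
  calc ∫ z, fderiv ℝ φ z (planeField b₁ b₂ z)
      = ∫ z, (fderiv ℝ φ z e₀ * fderiv ℝ stream z e₁ - fderiv ℝ φ z e₁ * fderiv ℝ stream z e₀) := by
        simp only [field_eq, map_sub, map_smul, smul_eq_mul, mul_comm]
    _ = 0 := by
        rw [integral_sub (integrable_mul _ _) (integrable_mul _ _), sub_eq_zero]
        exact integral_fderiv_mul_fderiv_comm (contDiff_infty.1 hφ 2) hφs
          contDiff_stream e₀ e₁

end IsGraphStreamFunction

/-! ### Integrability of the derivative of the saddle field -/

theorem log_one_add_inv_radiusSq_le (x : ℝ) {y : ℝ} (hy : y ≠ 0) :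
    Real.log (1 + (radiusSq x y)⁻¹) ≤ 1 + 2 * |Real.log y| := by
  have sq_pos : 0 < y ^ 2 := by positivity
  have inv_radiusSq_pos := inv_pos.2 (radiusSq_pos_of_right x hy)
  have log_two_le : Real.log 2 ≤ 1 := by
    linarith [Real.log_le_sub_one_of_pos (by norm_num : (0 : ℝ) < 2)]
  have log_le_log_sq : Real.log (1 + (radiusSq x y)⁻¹) ≤ Real.log (1 + (y ^ 2)⁻¹) := by
    gcongr
    exact le_add_of_nonneg_left (sq_nonneg x)
  rcases le_total 1 (y ^ 2) with one_le_sq | sq_le_one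
  · have log_le_log_two : Real.log (1 + (y ^ 2)⁻¹) ≤ Real.log 2 :=
      Real.log_le_log (by positivity) (by linarith [inv_le_one_of_one_le₀ one_le_sq])
    linarith [abs_nonneg (Real.log y)]
  · have log_le_log_mul : Real.log (1 + (y ^ 2)⁻¹) ≤ Real.log (2 * (y ^ 2)⁻¹) :=
      Real.log_le_log (by positivity) (by linarith [(one_le_inv₀ sq_pos).2 sq_le_one])
    rw [Real.log_mul (by norm_num) (by positivity), Real.log_inv, Real.log_pow,
      Nat.cast_ofNat] at log_le_log_mul
    linarith [neg_abs_le (Real.log y)]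

theorem logFactor_radiusSq_le (x : ℝ) {y : ℝ} (hy : y ≠ 0) :
    logFactor (radiusSq x y) ≤ 9 * (1 + |Real.log y|) := by
  rw [logFactor]
  linarith [log_one_add_inv_radiusSq_le x hy, abs_nonneg (Real.log y)]

theorem neg_log_one_add_inv_le_log_speedProfile {s : ℝ} (hs : 0 < s) :
    -(1 / 2) * Real.log (1 + s⁻¹) ≤ Real.log (speedProfile s) := by
  have ratio_pos : 0 < s / (1 + s) := by positivity
  have ratio_eq : s / (1 + s) = (1 + s⁻¹)⁻¹ := by
    field_simp
    ring
  have sqrt_le : √(s / (1 + s)) ≤ speedProfile s :=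
    le_mul_of_one_le_right (Real.sqrt_nonneg _)
      (one_le_pow₀ (by linarith [eight_le_logFactor hs.le]))
  have log_le_log := Real.log_le_log (Real.sqrt_pos.2 ratio_pos) sqrt_le
  rw [Real.log_sqrt ratio_pos.le, ratio_eq, Real.log_inv] at log_le_log
  linarith

theorem abs_log_speedProfile_radiusSq_le (x : ℝ) {y : ℝ} (hy : y ≠ 0) :
    |Real.log (speedProfile (radiusSq x y))| ≤ 63 + |Real.log y| := by
  have radiusSq_pos := radiusSq_pos_of_right x hy
  have log_le := Real.log_le_sub_one_of_pos (speedProfile_pos radiusSq_pos)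
  have profile_le := speedProfile_le_const radiusSq_pos.le
  have le_log := neg_log_one_add_inv_le_log_speedProfile radiusSq_pos
  have log_inv_le := log_one_add_inv_radiusSq_le x hy
  have log_nonneg := abs_nonneg (Real.log y)
  exact abs_le.2 ⟨by linarith, by linarith⟩

theorem one_add_abs_logBase_le (x : ℝ) {y : ℝ} (hy : y ≠ 0) :
    1 + |logBase x y| ≤ 64 * (1 + |Real.log y|) := by
  rw [logBase, Real.log_mul hy (speedProfile_pos (radiusSq_pos_of_right x hy)).ne']
  linarith [abs_add_le (Real.log y) (Real.log (speedProfile (radiusSq x y))),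
    abs_log_speedProfile_radiusSq_le x hy, abs_nonneg (Real.log y)]

theorem IsTame.exists_partials_le_log {F P : ℝ × ℝ → ℝ} (hP : IsTame P)
    (hF : ∀ z, F z = speedProfile (radiusSq z.1 z.2) * P z) :
    ∃ C : ℝ, 0 ≤ C ∧ ∀ x y : ℝ, y ≠ 0 → ∃ a b : ℝ, HasPartials F a b (x, y) ∧
      |a| + |b| ≤ C * (1 + |Real.log y|) ^ 3 := by
  obtain ⟨C, C_nonneg, exists_partials⟩ := hP.exists_partials_speedProfile_mul_le hF
  refine ⟨C * (9 ^ 2 * 64), by positivity, fun x y hy => ?_⟩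
  obtain ⟨a, b, hasPartials, le⟩ := exists_partials x y hy
  have logFactor_pos := logFactor_pos (radiusSq_nonneg x y)
  refine ⟨a, b, hasPartials, le.trans ?_⟩
  calc C * (logFactor (radiusSq x y) ^ 2 * (1 + |logBase x y|))
      ≤ C * ((9 * (1 + |Real.log y|)) ^ 2 * (64 * (1 + |Real.log y|))) := by
        gcongr
        exacts [logFactor_radiusSq_le x hy, one_add_abs_logBase_le x hy]
    _ = C * (9 ^ 2 * 64) * (1 + |Real.log y|) ^ 3 := by ring

theorem hasFDerivAt_planeField {b₁ b₂ : ℝ → ℝ → ℝ} {z : Euc 2}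
    (h₁ : DifferentiableAt ℝ (fun w : ℝ × ℝ => b₁ w.1 w.2) (planeCLE z))
    (h₂ : DifferentiableAt ℝ (fun w : ℝ × ℝ => b₂ w.1 w.2) (planeCLE z)) :
    HasFDerivAt (planeField b₁ b₂)
      ((planeCLE.symm : ℝ × ℝ →L[ℝ] Euc 2) ∘L
        ((fderiv ℝ (fun w : ℝ × ℝ => b₁ w.1 w.2) (planeCLE z)).prod
          (fderiv ℝ (fun w : ℝ × ℝ => b₂ w.1 w.2) (planeCLE z)) ∘L
        (planeCLE : Euc 2 →L[ℝ] ℝ × ℝ))) z :=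
  planeCLE.symm.hasFDerivAt.comp z
    ((h₁.hasFDerivAt.prodMk h₂.hasFDerivAt).comp z planeCLE.hasFDerivAt)

theorem differentiableAt_planeField_saddle {z : Euc 2} (hz : z ≠ 0) :
    DifferentiableAt ℝ (planeField saddleFst saddleSnd) z :=
  have hz' : planeCLE z ≠ 0 := planeCLE.map_ne_zero_iff.2 hz
  (hasFDerivAt_planeField (differentiableAt_saddleFst hz')
    (differentiableAt_saddleSnd hz')).differentiableAt

theorem exists_norm_fderiv_planeField_saddle_le : ∃ C : ℝ, ∀ z : Euc 2, z 1 ≠ 0 →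
    ‖fderiv ℝ (planeField saddleFst saddleSnd) z‖ ≤ C * (1 + |Real.log (z 1)|) ^ 3 := by
  obtain ⟨P, isTame_P, fst_eq⟩ := exists_isTame_saddleFst
  obtain ⟨Q, isTame_Q, snd_eq⟩ := exists_isTame_saddleSnd
  obtain ⟨C, -, exists_partials_fst⟩ := IsTame.exists_partials_le_log
    (F := fun w => saddleFst w.1 w.2) isTame_P fst_eq
  obtain ⟨D, -, exists_partials_snd⟩ := IsTame.exists_partials_le_log
    (F := fun w => saddleSnd w.1 w.2) isTame_Q snd_eq
  refine ⟨‖(planeCLE.symm : ℝ × ℝ →L[ℝ] Euc 2)‖ *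
    ((C + D) * ‖(planeCLE : Euc 2 →L[ℝ] ℝ × ℝ)‖), fun z hz => ?_⟩
  obtain ⟨a, b, partials_fst, fst_le⟩ := exists_partials_fst (z 0) (z 1) hz
  obtain ⟨c, d, partials_snd, snd_le⟩ := exists_partials_snd (z 0) (z 1) hz
  rw [(hasFDerivAt_planeField partials_fst.differentiableAt
    partials_snd.differentiableAt).fderiv]
  have norm_prod_le : ‖(fderiv ℝ (fun w : ℝ × ℝ => saddleFst w.1 w.2) (planeCLE z)).prod
      (fderiv ℝ (fun w : ℝ × ℝ => saddleSnd w.1 w.2) (planeCLE z))‖ ≤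
      (C + D) * (1 + |Real.log (z 1)|) ^ 3 := by
    rw [ContinuousLinearMap.opNorm_prod, add_mul]
    refine (max_le_add_of_nonneg (norm_nonneg _) (norm_nonneg _)).trans (add_le_add ?_ ?_)
    exacts [partials_fst.norm_fderiv_le.trans fst_le, partials_snd.norm_fderiv_le.trans snd_le]
  refine (ContinuousLinearMap.opNorm_comp_le _ _).trans ?_
  rw [mul_assoc]
  gcongr
  refine (ContinuousLinearMap.opNorm_comp_le _ _).trans ?_
  rw [mul_right_comm]
  gcongr

theorem integrableOn_abs_rpow_Icc {s : ℝ} (hs : -1 < s) {R : ℝ} (hR : 0 ≤ R) :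
    IntegrableOn (fun y : ℝ => |y| ^ s) (Icc (-R) R) := by
  have integrable_right : IntervalIntegrable (fun y : ℝ => |y| ^ s) volume 0 R := by
    refine (intervalIntegral.intervalIntegrable_rpow' hs).congr fun y hy => ?_
    rw [uIoc_of_le hR] at hy
    simp only [abs_of_pos hy.1]
  have integrable_left : IntervalIntegrable (fun y : ℝ => |y| ^ s) volume (-R) 0 := by
    have integrable_neg := (IntervalIntegrable.iff_comp_neg (f := fun y : ℝ => |y| ^ s)).1
      integrable_right
    simpa only [abs_neg, neg_zero] using integrable_neg.symm
  rw [← intervalIntegrable_iff_integrableOn_Icc_of_le (by linarith)]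
  exact integrable_left.trans integrable_right

theorem one_add_abs_log_le {ε R y : ℝ} (hε : 0 < ε) (hR : 1 ≤ R) (hy : y ≠ 0) (hyR : |y| ≤ R) :
    1 + |Real.log y| ≤ (1 + Real.log R + 1 / ε) * (R / |y|) ^ ε := by
  have abs_pos : 0 < |y| := abs_pos.2 hy
  have one_le_div : 1 ≤ R / |y| := (one_le_div abs_pos).2 hyR
  have one_le_rpow : 1 ≤ (R / |y|) ^ ε := Real.one_le_rpow one_le_div hε.le
  have log_R_nonneg : 0 ≤ Real.log R := Real.log_nonneg hR
  have log_div : Real.log (R / |y|) = Real.log R - Real.log y := by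
    rw [Real.log_div (by positivity) abs_pos.ne', Real.log_abs]
  have log_div_le : Real.log (R / |y|) ≤ (R / |y|) ^ ε / ε :=
    Real.log_le_rpow_div (by positivity) hε
  have log_div_nonneg : 0 ≤ Real.log (R / |y|) := Real.log_nonneg one_le_div
  calc 1 + |Real.log y| ≤ (1 + Real.log R) + Real.log (R / |y|) := by
        have : |Real.log y| ≤ Real.log R + Real.log (R / |y|) :=
          abs_le.2 ⟨by linarith, by linarith⟩
        linarith
    _ ≤ (1 + Real.log R) * (R / |y|) ^ ε + (R / |y|) ^ ε / ε :=
        add_le_add (le_mul_of_one_le_right (by positivity) one_le_rpow) log_div_le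
    _ = (1 + Real.log R + 1 / ε) * (R / |y|) ^ ε := by ring

theorem integrableOn_one_add_abs_log_rpow {s : ℝ} (hs : 0 < s) {R : ℝ} (hR : 1 ≤ R) :
    IntegrableOn (fun y : ℝ => (1 + |Real.log y|) ^ s) (Icc (-R) R) := by
  set ε := 1 / (2 * s) with ε_def
  set C := 1 + Real.log R + 1 / ε
  have C_nonneg : 0 ≤ C := by
    have := Real.log_nonneg hR
    positivity
  refine Integrable.mono' ((integrableOn_abs_rpow_Icc (s := -(1 / 2)) (by norm_num)
    (by linarith)).const_mul (C ^ s * R ^ (1 / 2 : ℝ)))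
    (by fun_prop : Measurable fun y : ℝ => (1 + |Real.log y|) ^ s).aestronglyMeasurable ?_
  filter_upwards [ae_restrict_of_ae (Measure.ae_ne volume 0), ae_restrict_mem measurableSet_Icc]
    with y hy mem_Icc
  have abs_pos : 0 < |y| := abs_pos.2 hy
  calc ‖(1 + |Real.log y|) ^ s‖ = (1 + |Real.log y|) ^ s :=
        Real.norm_of_nonneg (by positivity)
    _ ≤ (C * (R / |y|) ^ ε) ^ s := by
        gcongr
        exact one_add_abs_log_le (by positivity) hR hy (abs_le.2 mem_Icc)
    _ = C ^ s * (R / |y|) ^ (1 / 2 : ℝ) := by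
        rw [Real.mul_rpow C_nonneg (by positivity), ← Real.rpow_mul (by positivity)]
        congr 2
        rw [ε_def]
        field
    _ = C ^ s * R ^ (1 / 2 : ℝ) * |y| ^ (-(1 / 2) : ℝ) := by
        rw [Real.div_rpow (by linarith) abs_pos.le, Real.rpow_neg abs_pos.le]
        ring

theorem memLp_one_add_abs_log_pow {p : ℝ≥0∞} (hp1 : 1 ≤ p) (hp : p < ⊤) {R : ℝ} (hR : 1 ≤ R) :
    MemLp (fun y : ℝ => (1 + |Real.log y|) ^ 3) p (volume.restrict (Icc (-R) R)) := by
  have p_pos : 0 < p.toReal := ENNReal.toReal_pos (by positivity) hp.ne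
  rw [← integrable_norm_rpow_iff (by fun_prop) (by positivity) hp.ne]
  refine (integrableOn_one_add_abs_log_rpow (s := 3 * p.toReal) (by positivity) hR).congr
    (Eventually.of_forall fun y => ?_)
  change _ = ‖(1 + |Real.log y|) ^ 3‖ ^ p.toReal
  rw [Real.norm_of_nonneg (by positivity), ← Real.rpow_natCast, ← Real.rpow_mul (by positivity),
    Nat.cast_ofNat]

theorem memLpLoc_one_add_abs_log_pow {p : ℝ≥0∞} (hp1 : 1 ≤ p) (hp : p < ⊤) :
    MemLpLoc (fun z : Euc 2 => (1 + |Real.log (z 1)|) ^ 3) p := by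
  intro K hK
  obtain ⟨R, norm_le⟩ := hK.isBounded.exists_norm_le
  set S := max R 1
  have memLp_square := (memLp_one_add_abs_log_pow hp1 hp (le_max_right R 1)).comp_snd
    (volume.restrict (Icc (-S) S))
  rw [Measure.prod_restrict, ← Measure.volume_eq_prod] at memLp_square
  have memLp_preimage := memLp_square.comp_measurePreserving
    (measurePreserving_planeCLE.restrict_preimage_emb measurableEmbedding_planeCLE
      (Icc (-S) S ×ˢ Icc (-S) S))
  refine MemLp.mono_measure (Measure.restrict_mono (fun z hz => ?_) le_rfl) memLp_preimage
  have coord_mem (i : Fin 2) : z i ∈ Icc (-S) S :=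
    abs_le.1 ((PiLp.norm_apply_le z i).trans ((norm_le z hz).trans (le_max_left R 1)))
  exact ⟨coord_mem 0, coord_mem 1⟩

theorem memLpLoc_fderiv_planeField_saddle {p : ℝ≥0∞} (hp1 : 1 ≤ p) (hp : p < ⊤) :
    MemLpLoc (fderiv ℝ (planeField saddleFst saddleSnd)) p := by
  intro K hK
  obtain ⟨C, norm_fderiv_le⟩ := exists_norm_fderiv_planeField_saddle_le
  refine (memLpLoc_one_add_abs_log_pow hp1 hp K hK).of_le_mul (c := C)
    (measurable_fderiv ℝ _).aestronglyMeasurable ?_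
  filter_upwards [ae_restrict_of_ae ae_plane_snd_ne_zero] with z hz
  rw [Real.norm_of_nonneg (by positivity)]
  exact norm_fderiv_le z hz

theorem memW1pLoc_planeField_saddle {p : ℝ≥0∞} (hp1 : 1 ≤ p) (hp : p < ⊤) :
    MemW1pLoc (planeField saddleFst saddleSnd) p := by
  have continuous_field := isGraphStreamFunction_saddle.continuous_planeField
  have locallyIntegrable_fderiv :
      LocallyIntegrable (fderiv ℝ (planeField saddleFst saddleSnd)) :=
    locallyIntegrable_iff.2 fun K hK => memLp_one_iff_integrable.1
      (memLpLoc_fderiv_planeField_saddle le_rfl ENNReal.one_lt_top K hK)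
  refine ⟨fun K hK => ?_, _, isWeakDeriv_fderiv continuous_field
    (fun z hz => differentiableAt_planeField_saddle hz) locallyIntegrable_fderiv,
    memLpLoc_fderiv_planeField_saddle hp1 hp⟩
  have : IsFiniteMeasure (volume.restrict K) := ⟨by simpa using hK.measure_lt_top⟩
  exact MemLp.of_bound continuous_field.aestronglyMeasurable (2 * 192)
    (Eventually.of_forall isGraphStreamFunction_saddle.norm_planeField_le)

/-! ### The speed on the crests -/

/-- The horizontal speed of the flow of the unperturbed stream function `y M(x² + y²)`, where
`M = speedProfile`. -/
noncomputable def baseSpeed (x y : ℝ) : ℝ :=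
  speedProfile (radiusSq x y) * (1 + 2 * heightRatio x y * speedExponent (radiusSq x y))

theorem baseSpeed_le (x y : ℝ) : baseSpeed x y ≤ 2 * speedProfile (radiusSq x y) := by
  rw [baseSpeed, mul_comm]
  gcongr
  · exact speedProfile_nonneg _
  · linarith [(two_mul_heightRatio_mul_speedExponent_mem_Icc x y).2]

theorem baseSpeed_pos (x : ℝ) {y : ℝ} (hy : y ≠ 0) : 0 < baseSpeed x y :=
  mul_pos (speedProfile_pos (radiusSq_pos_of_right x hy))
    (by linarith [(two_mul_heightRatio_mul_speedExponent_mem_Icc x y).1])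

theorem hasDerivAt_baseSpeed (x : ℝ) {y : ℝ} (hy : y ≠ 0) :
    HasDerivAt (baseSpeed x) (2 * y * speedProfile (radiusSq x y) / radiusSq x y *
      (speedExponent (radiusSq x y) *
          (1 + 2 * heightRatio x y * speedExponent (radiusSq x y)) +
        2 * (1 - heightRatio x y) * speedExponent (radiusSq x y) +
        2 * heightRatio x y * (radiusSq x y * (-speedExponent (radiusSq x y) / (1 + radiusSq x y) -
          2 / (logFactor (radiusSq x y) ^ 2 * radiusSq x y * (1 + radiusSq x y) ^ 2))))) y := by
  have radiusSq_pos := radiusSq_pos_of_right x hy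
  have hasPartials_baseSpeed := (hasPartials_speedProfile radiusSq_pos).mul
    ((HasPartials.const 1 (x, y)).add
      (((HasPartials.const 2 (x, y)).mul (hasPartials_heightRatio radiusSq_pos)).mul
        (HasPartials.comp (F := fun z => radiusSq z.1 z.2) (z := (x, y))
          (hasDerivAt_speedExponent radiusSq_pos) (hasPartials_radiusSq x y))))
  convert! hasPartials_baseSpeed.hasDerivAt_right using 1
  have cube_eq : 2 * y ^ 3 / radiusSq x y ^ 2 = 2 * y * heightRatio x y / radiusSq x y := by
    rw [heightRatio]; field
  simp only [cube_eq]
  generalize -speedExponent (radiusSq x y) / (1 + radiusSq x y) - 2 /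
    (logFactor (radiusSq x y) ^ 2 * radiusSq x y * (1 + radiusSq x y) ^ 2) = exponentDeriv
  field

theorem le_mul_deriv_speedExponent {s : ℝ} (hs : 0 < s) :
    -(speedExponent s * (s / (1 + s) + 1 / 8)) ≤
      s * (-speedExponent s / (1 + s) - 2 / (logFactor s ^ 2 * s * (1 + s) ^ 2)) := by
  have logFactor_ne_zero := (logFactor_pos hs.le).ne'
  have log_term_le : 2 / (logFactor s ^ 2 * (1 + s) ^ 2) ≤ speedExponent s / 8 :=
    calc 2 / (logFactor s ^ 2 * (1 + s) ^ 2) ≤ 2 / (8 ^ 2 * (1 + s)) := by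
          gcongr
          · exact eight_le_logFactor hs.le
          · exact le_self_pow₀ (by linarith) two_ne_zero
      _ = 1 / 4 / (1 + s) / 8 := by field
      _ ≤ speedExponent s / 8 := by gcongr; exact le_speedExponent hs.le
  calc -(speedExponent s * (s / (1 + s) + 1 / 8))
      = -(speedExponent s * (s / (1 + s))) - speedExponent s / 8 := by ring
    _ ≤ -(speedExponent s * (s / (1 + s))) - 2 / (logFactor s ^ 2 * (1 + s) ^ 2) := by gcongr
    _ = _ := by field

theorem heightRatio_mul_le_three (x : ℝ) {y : ℝ} (hy : y ≠ 0) (hy' : y ^ 2 ≤ 9 / 25) :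
    heightRatio x y * (9 / 4 + 2 * (radiusSq x y / (1 + radiusSq x y))) ≤ 3 := by
  have radiusSq_pos := radiusSq_pos_of_right x hy
  have ratio_nonneg := heightRatio_nonneg x y
  rcases le_total (radiusSq x y) (3 / 5) with radiusSq_le | le_radiusSq
  · have damping_le : radiusSq x y / (1 + radiusSq x y) ≤ 3 / 8 := by
      rw [div_le_div_iff₀ (by positivity) (by norm_num)]; linarith
    nlinarith [heightRatio_le_one x y]
  · have damping_le : radiusSq x y / (1 + radiusSq x y) ≤ 1 :=
      (div_le_one (by positivity)).2 (by linarith)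
    have ratio_le : heightRatio x y ≤ 3 / 5 := by
      rw [heightRatio, div_le_iff₀ radiusSq_pos]; linarith
    nlinarith

theorem monotoneOn_baseSpeed (x : ℝ) : MonotoneOn (baseSpeed x) (Ioc 0 (3 / 5)) := by
  refine monotoneOn_of_hasDerivWithinAt_nonneg (convex_Ioc 0 (3 / 5))
    (fun y hy => (hasDerivAt_baseSpeed x hy.1.ne').continuousAt.continuousWithinAt)
    (fun y hy => (hasDerivAt_baseSpeed x (interior_subset hy).1.ne').hasDerivWithinAt)
    fun y hy => ?_
  obtain ⟨y_pos, y_le⟩ := interior_subset hy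
  have exponent_nonneg := speedExponent_nonneg (radiusSq_nonneg x y)
  have ratio_nonneg := heightRatio_nonneg x y
  have := speedProfile_nonneg (radiusSq x y)
  have := radiusSq_nonneg x y
  refine mul_nonneg (by positivity) ?_
  have deriv_term_ge := mul_le_mul_of_nonneg_left
    (le_mul_deriv_speedExponent (radiusSq_pos_of_right x y_pos.ne'))
    (mul_nonneg zero_le_two ratio_nonneg)
  have slack_nonneg := mul_nonneg exponent_nonneg
    (sub_nonneg.2 (heightRatio_mul_le_three x y_pos.ne' (by nlinarith)))
  have square_nonneg := mul_nonneg ratio_nonneg (sq_nonneg (speedExponent (radiusSq x y)))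
  linarith

/-- The levels `exp (-√(n π))`, on which the perturbation of the stream function vanishes. -/
noncomputable def crest (n : ℕ) : ℝ := Real.exp (-√(n * Real.pi))

/-- The absolute value of the derivative of `wiggle` at the logarithm of the `n`-th crest. -/
noncomputable def crestSlope (n : ℕ) : ℝ := 2 * (n * Real.pi) / (1 + n * Real.pi)

theorem crest_pos (n : ℕ) : 0 < crest n := Real.exp_pos _

theorem crest_strictAnti : StrictAnti crest := fun m n hmn => by
  have := Real.pi_pos
  unfold crest
  gcongr

theorem tendsto_crest : Tendsto crest atTop (𝓝 0) :=
  Real.tendsto_exp_neg_atTop_nhds_zero.comp (Real.tendsto_sqrt_atTop.comp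
    (tendsto_natCast_atTop_atTop.atTop_mul_const Real.pi_pos))

theorem log_crest_sq (n : ℕ) : Real.log (crest n) ^ 2 = n * Real.pi := by
  rw [crest, Real.log_exp, neg_sq, Real.sq_sqrt (mul_nonneg n.cast_nonneg Real.pi_pos.le)]

theorem wiggle_log_crest (n : ℕ) : wiggle (Real.log (crest n)) = 0 := by
  rw [wiggle, log_crest_sq, Real.sin_nat_mul_pi, mul_zero, zero_div]

theorem wiggleDeriv_log_crest (n : ℕ) :
    wiggleDeriv (Real.log (crest n)) = (-1) ^ n * crestSlope n := by
  rw [wiggleDeriv, log_crest_sq, Real.sin_nat_mul_pi, Real.cos_nat_mul_pi, zero_mul, zero_add,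
    crestSlope]

theorem crestSlope_nonneg (n : ℕ) : 0 ≤ crestSlope n := by
  have := Real.pi_pos
  unfold crestSlope
  positivity

theorem crestSlope_le_two (n : ℕ) : crestSlope n ≤ 2 := by
  have := Real.pi_pos
  rw [crestSlope, div_le_iff₀ (by positivity)]
  linarith

theorem three_le_mul_pi {n : ℕ} (hn : 1 ≤ n) : 3 ≤ n * Real.pi := by
  have : (1 : ℝ) ≤ n := mod_cast hn
  nlinarith [Real.pi_gt_three]

theorem one_le_crestSlope {n : ℕ} (hn : 1 ≤ n) : 1 ≤ crestSlope n := by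
  have := three_le_mul_pi hn
  rw [crestSlope, le_div_iff₀ (by linarith)]
  linarith

/-- `streamHeight` for the saddle stream function. -/
noncomputable abbrev saddleHeight (x c : ℝ) : ℝ := streamHeight saddleStream x c

/-- `streamSpeed` for the saddle stream function. -/
noncomputable abbrev saddleSpeed (c x : ℝ) : ℝ := streamSpeed saddleStream saddleFst c x

/-- `streamClock` for the saddle stream function. -/
noncomputable abbrev saddleClock (c x : ℝ) : ℝ := streamClock saddleStream saddleFst c x

/-- `streamAbscissa` for the saddle stream function. -/
noncomputable abbrev saddleAbscissa (c τ : ℝ) : ℝ := streamAbscissa saddleStream saddleFst c τ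

theorem saddleHeight_pos (x : ℝ) {c : ℝ} (hc : 0 < c) : 0 < saddleHeight x c := by
  have h := isGraphStreamFunction_saddle
  rwa [← (h.strictMono x).lt_iff_lt, h.stream_height, h.map_zero]

theorem exists_mul_speedProfile_radiusSq_eq (x : ℝ) {c : ℝ} (hc : 0 ≤ c) :
    ∃ y, y * speedProfile (radiusSq x y) = c := by
  have continuous_stream : Continuous fun y => y * speedProfile (radiusSq x y) :=
    continuous_id.mul (continuous_speedProfile_radiusSq.comp (Continuous.prodMk_right x))
  have profile_one_pos := speedProfile_pos one_pos
  set top := 1 + c / speedProfile 1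
  have one_le_top : 1 ≤ top := le_add_of_nonneg_right (by positivity)
  have le_top : c ≤ top * speedProfile (radiusSq x top) :=
    calc c ≤ top * speedProfile 1 := by
          rw [add_mul, div_mul_cancel₀ _ profile_one_pos.ne']; linarith
      _ ≤ top * speedProfile (radiusSq x top) := by
          gcongr
          exact monotoneOn_speedProfile (mem_Ici.2 zero_le_one) (radiusSq_nonneg x top)
            (by unfold radiusSq; nlinarith)
  obtain ⟨y, -, hy⟩ := intermediate_value_Icc (zero_le_one.trans one_le_top)
    continuous_stream.continuousOn (show c ∈ Icc _ _ from ⟨by simpa using hc, le_top⟩)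
  exact ⟨y, hy⟩

theorem saddleHeight_crest_mul_speedProfile (x : ℝ) (n : ℕ) :
    saddleHeight x (crest n) * speedProfile (radiusSq x (saddleHeight x (crest n))) =
      crest n := by
  obtain ⟨y, hy⟩ := exists_mul_speedProfile_radiusSq_eq x (crest_pos n).le
  have stream_eq : saddleStream x y = crest n := by
    rw [saddleStream, logBase, hy, wiggle_log_crest, mul_zero, mul_zero, add_zero, mul_one]
  have height_eq : saddleHeight x (crest n) = y := by
    rw [← stream_eq]; exact isGraphStreamFunction_saddle.height_stream x y
  rw [height_eq, hy]

theorem saddleSpeed_crest (x : ℝ) (n : ℕ) : saddleSpeed (crest n) x =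
    baseSpeed x (saddleHeight x (crest n)) *
      (1 + (-1) ^ n * (1 / 20 * (heightRatio x (saddleHeight x (crest n)) * crestSlope n))) := by
  have logBase_eq : logBase x (saddleHeight x (crest n)) = Real.log (crest n) := by
    rw [logBase, saddleHeight_crest_mul_speedProfile]
  change saddleFst x (saddleHeight x (crest n)) = _
  rw [saddleFst, logBase_eq, wiggle_log_crest, wiggleDeriv_log_crest, baseSpeed]
  ring

theorem saddleHeight_crest_le {n : ℕ} (hn : crest n ≤ 3 / 5 * speedProfile (9 / 25)) (x : ℝ) :
    saddleHeight x (crest n) ≤ 3 / 5 := by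
  by_contra! lt_height
  have profile_pos := speedProfile_pos (by norm_num : (0 : ℝ) < 9 / 25)
  have profile_le : speedProfile (9 / 25) ≤ speedProfile (radiusSq x (saddleHeight x (crest n))) :=
    monotoneOn_speedProfile (mem_Ici.2 (by norm_num)) (radiusSq_nonneg _ _)
      (by unfold radiusSq; nlinarith)
  nlinarith [saddleHeight_crest_mul_speedProfile x n]

theorem saddleHeight_crest_succ_le (x : ℝ) (n : ℕ) :
    saddleHeight x (crest (n + 1)) ≤ saddleHeight x (crest n) := by
  have h := isGraphStreamFunction_saddle
  rw [← (h.strictMono x).le_iff_le, h.stream_height, h.stream_height]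
  exact (crest_strictAnti n.lt_succ_self).le

theorem baseSpeed_le_saddleSpeed_even (x : ℝ) (j : ℕ) :
    baseSpeed x (saddleHeight x (crest (2 * j))) ≤ saddleSpeed (crest (2 * j)) x := by
  have ratio_mul_slope_nonneg :=
    mul_nonneg (heightRatio_nonneg x (saddleHeight x (crest (2 * j)))) (crestSlope_nonneg (2 * j))
  rw [saddleSpeed_crest, (even_two_mul j).neg_one_pow, one_mul]
  exact le_mul_of_one_le_right
    (baseSpeed_pos x (saddleHeight_pos x (crest_pos (2 * j))).ne').le (by linarith)

theorem baseSpeed_odd_le_saddleSpeed_even {j : ℕ}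
    (hj : crest (2 * j) ≤ 3 / 5 * speedProfile (9 / 25)) (x : ℝ) :
    baseSpeed x (saddleHeight x (crest (2 * j + 1))) ≤ saddleSpeed (crest (2 * j)) x := by
  have height_le := saddleHeight_crest_le hj x
  have height_succ_le := saddleHeight_crest_succ_le x (2 * j)
  exact (monotoneOn_baseSpeed x ⟨saddleHeight_pos x (crest_pos _), height_succ_le.trans height_le⟩
    ⟨saddleHeight_pos x (crest_pos _), height_le⟩ height_succ_le).trans
    (baseSpeed_le_saddleSpeed_even x j)

/-- The excess of the slowness `1 / saddleSpeed` at an odd crest over that at the preceding even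
crest. -/
noncomputable def slownessGap (j : ℕ) (x : ℝ) : ℝ :=
  1 / saddleSpeed (crest (2 * j + 1)) x - 1 / saddleSpeed (crest (2 * j)) x

theorem le_slownessGap {j : ℕ} (hj : crest (2 * j) ≤ 3 / 5 * speedProfile (9 / 25)) (x : ℝ) :
    1 / 40 * heightRatio x (saddleHeight x (crest (2 * j + 1))) *
      (saddleHeight x (crest (2 * j + 1)) / crest (2 * j + 1)) ≤ slownessGap j x := by
  have even_slowness_le := one_div_le_one_div_of_le
    (baseSpeed_pos x (saddleHeight_pos x (crest_pos (2 * j + 1))).ne')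
    (baseSpeed_odd_le_saddleSpeed_even hj x)
  rw [slownessGap, saddleSpeed_crest x (2 * j + 1), (odd_two_mul_add_one j).neg_one_pow]
  have height_pos := saddleHeight_pos x (crest_pos (2 * j + 1))
  have height_mul_profile := saddleHeight_crest_mul_speedProfile x (2 * j + 1)
  set height := saddleHeight x (crest (2 * j + 1))
  have base_pos := baseSpeed_pos x height_pos.ne'
  set base := baseSpeed x height
  have ratio_nonneg := heightRatio_nonneg x height
  have ratio_le_one := heightRatio_le_one x height
  have one_le_slope := one_le_crestSlope (n := 2 * j + 1) (by omega)
  have slope_le_two := crestSlope_le_two (2 * j + 1)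
  set defect := 1 / 20 * (heightRatio x height * crestSlope (2 * j + 1)) with defect_def
  have le_defect : 1 / 20 * heightRatio x height ≤ defect := by rw [defect_def]; nlinarith
  have defect_lt_one : defect < 1 := by rw [defect_def]; nlinarith
  have odd_slowness_ge : 1 / base + defect * (1 / base) ≤ 1 / (base * (1 + -1 * defect)) := by
    rw [← one_add_mul, mul_one_div,
      div_le_div_iff₀ base_pos (mul_pos base_pos (by linarith))]
    nlinarith [mul_nonneg base_pos.le (sq_nonneg defect)]
  have base_slowness_ge : 1 / 2 * (height / crest (2 * j + 1)) ≤ 1 / base :=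
    calc 1 / 2 * (height / crest (2 * j + 1))
        = 1 / (2 * speedProfile (radiusSq x height)) := by
          rw [← height_mul_profile]
          have := (speedProfile_pos (radiusSq_pos_of_right x height_pos.ne')).ne'
          field
      _ ≤ 1 / base := one_div_le_one_div_of_le base_pos (baseSpeed_le x height)
  have : 0 < crest (2 * j + 1) := crest_pos _
  have gain_le : 1 / 20 * heightRatio x height * (1 / 2 * (height / crest (2 * j + 1))) ≤
      defect * (1 / base) := by gcongr
  linarith

theorem slownessGap_nonneg {j : ℕ} (hj : crest (2 * j) ≤ 3 / 5 * speedProfile (9 / 25)) (x : ℝ) :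
    0 ≤ slownessGap j x := by
  have := heightRatio_nonneg x (saddleHeight x (crest (2 * j + 1)))
  have := saddleHeight_pos x (crest_pos (2 * j + 1))
  have := crest_pos (2 * j + 1)
  exact le_trans (by positivity) (le_slownessGap hj x)

theorem continuous_slownessGap (j : ℕ) : Continuous (slownessGap j) :=
  (isGraphStreamFunction_saddle.continuous_one_div_speed (crest_pos _).ne').sub
    (isGraphStreamFunction_saddle.continuous_one_div_speed (crest_pos _).ne')

theorem integral_slownessGap (j : ℕ) (x x' : ℝ) : ∫ r in x..x', slownessGap j r =
    (saddleClock (crest (2 * j + 1)) x' - saddleClock (crest (2 * j + 1)) x) -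
      (saddleClock (crest (2 * j)) x' - saddleClock (crest (2 * j)) x) := by
  have h := isGraphStreamFunction_saddle
  have odd_ne_zero := (crest_pos (2 * j + 1)).ne'
  have even_ne_zero := (crest_pos (2 * j)).ne'
  rw [h.clock_sub odd_ne_zero, h.clock_sub even_ne_zero]
  exact intervalIntegral.integral_sub
    ((h.continuous_one_div_speed odd_ne_zero).intervalIntegrable _ _)
    ((h.continuous_one_div_speed even_ne_zero).intervalIntegrable _ _)

/-- The half width of the interval around `0` over which the gain of time is estimated, chosen so
that the level set of the `n`-th crest stays at height at least `crestWidth n` above it. -/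
noncomputable def crestWidth (n : ℕ) : ℝ := √(crest n / (1024 * (n * Real.pi)))

theorem crestWidth_sq (n : ℕ) : crestWidth n ^ 2 = crest n / (1024 * (n * Real.pi)) :=
  Real.sq_sqrt (by have := crest_pos n; have := Real.pi_pos; positivity)

theorem crestWidth_sq_le {n : ℕ} (hn : 1 ≤ n) : crestWidth n ^ 2 ≤ crest n := by
  rw [crestWidth_sq]
  exact div_le_self (crest_pos n).le (by linarith [three_le_mul_pi hn])

theorem logFactor_two_mul_crestWidth_sq_le {n : ℕ} (hn : 1 ≤ n) :
    logFactor (2 * crestWidth n ^ 2) ≤ 18 * √(n * Real.pi) := by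
  have three_le := three_le_mul_pi hn
  rw [crestWidth_sq, crest, logFactor, Real.exp_neg]
  set v := √((n : ℝ) * Real.pi)
  have v_sq : n * Real.pi = v ^ 2 := (Real.sq_sqrt (by linarith)).symm
  have one_le_v : 1 ≤ v := Real.one_le_sqrt.2 (by linarith)
  have one_add_inv_le : 1 + (2 * ((Real.exp v)⁻¹ / (1024 * v ^ 2)))⁻¹ ≤
      2 ^ 10 * v ^ 2 * Real.exp v := by
    have inv_eq : (2 * ((Real.exp v)⁻¹ / (1024 * v ^ 2)))⁻¹ = 512 * v ^ 2 * Real.exp v := by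
      field_simp; norm_num
    have one_le_mul : 1 ≤ v ^ 2 * Real.exp v :=
      one_le_mul_of_one_le_of_one_le (one_le_pow₀ one_le_v) (Real.one_le_exp (by linarith))
    linarith
  have log_le : Real.log (1 + (2 * ((Real.exp v)⁻¹ / (1024 * v ^ 2)))⁻¹) ≤
      10 * Real.log 2 + 2 * Real.log v + v := by
    refine (Real.log_le_log (by positivity) one_add_inv_le).trans_eq ?_
    rw [Real.log_mul (by positivity) (by positivity), Real.log_mul (by norm_num) (by positivity),
      Real.log_exp, Real.log_pow, Real.log_pow]
    norm_cast
  rw [v_sq]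
  linarith [Real.log_two_lt_d9, Real.log_le_sub_one_of_pos (by linarith : 0 < v)]

theorem crestWidth_mul_speedProfile_le {n : ℕ} (hn : 1 ≤ n) :
    crestWidth n * speedProfile (2 * crestWidth n ^ 2) ≤ crest n := by
  have three_le := three_le_mul_pi hn
  have width_nonneg : 0 ≤ crestWidth n := Real.sqrt_nonneg _
  have logFactor_nonneg := (logFactor_pos (by positivity : 0 ≤ 2 * crestWidth n ^ 2)).le
  have sqrt_le : √(2 * crestWidth n ^ 2 / (1 + 2 * crestWidth n ^ 2)) ≤ 2 * crestWidth n := by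
    rw [Real.sqrt_le_left (by positivity)]
    exact (div_le_self (by positivity) (by linarith [sq_nonneg (crestWidth n)])).trans
      (by linarith [sq_nonneg (crestWidth n)])
  calc crestWidth n * speedProfile (2 * crestWidth n ^ 2)
      ≤ crestWidth n * (2 * crestWidth n * (18 * √(n * Real.pi)) ^ 2) := by
        rw [speedProfile]
        gcongr
        exact logFactor_two_mul_crestWidth_sq_le hn
    _ = 648 * (√(n * Real.pi)) ^ 2 * crestWidth n ^ 2 := by ring
    _ = 648 / 1024 * crest n := by
        rw [crestWidth_sq, Real.sq_sqrt (by linarith)]; field_simp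
    _ ≤ crest n := by linarith [crest_pos n]

theorem crestWidth_le_saddleHeight {n : ℕ} (hn : 1 ≤ n) {x : ℝ} (hx : |x| ≤ crestWidth n) :
    crestWidth n ≤ saddleHeight x (crest n) := by
  by_contra! height_lt
  have height_pos := saddleHeight_pos x (crest_pos n)
  have profile_le : speedProfile (radiusSq x (saddleHeight x (crest n))) ≤
      speedProfile (2 * crestWidth n ^ 2) := by
    refine monotoneOn_speedProfile (radiusSq_nonneg _ _)
      (mem_Ici.2 (mul_nonneg zero_le_two (sq_nonneg _))) ?_
    rw [radiusSq, two_mul, ← sq_abs x]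
    gcongr
  have profile_pos := speedProfile_pos (radiusSq_pos_of_right x height_pos.ne')
  nlinarith [saddleHeight_crest_mul_speedProfile x n, crestWidth_mul_speedProfile_le hn]

theorem half_le_heightRatio {x y : ℝ} (hy : y ≠ 0) (hxy : |x| ≤ |y|) : 1 / 2 ≤ heightRatio x y := by
  have sq_le := sq_le_sq.2 hxy
  rw [heightRatio, div_le_div_iff₀ two_pos (radiusSq_pos_of_right x hy), radiusSq]
  linarith

theorem crestWidth_div_crest_le_slownessGap {j : ℕ}
    (hj : crest (2 * j) ≤ 3 / 5 * speedProfile (9 / 25)) {x : ℝ}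
    (hx : |x| ≤ crestWidth (2 * j + 1)) :
    1 / 80 * (crestWidth (2 * j + 1) / crest (2 * j + 1)) ≤ slownessGap j x := by
  have width_le := crestWidth_le_saddleHeight (n := 2 * j + 1) (by omega) hx
  have height_pos := saddleHeight_pos x (crest_pos (2 * j + 1))
  have half_le_ratio := half_le_heightRatio height_pos.ne'
    ((hx.trans width_le).trans (le_abs_self _))
  have := crest_pos (2 * j + 1)
  calc 1 / 80 * (crestWidth (2 * j + 1) / crest (2 * j + 1))
      ≤ 1 / 80 * (saddleHeight x (crest (2 * j + 1)) / crest (2 * j + 1)) := by gcongr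
    _ = 1 / 40 * (1 / 2) * (saddleHeight x (crest (2 * j + 1)) / crest (2 * j + 1)) := by ring
    _ ≤ 1 / 40 * heightRatio x (saddleHeight x (crest (2 * j + 1))) *
        (saddleHeight x (crest (2 * j + 1)) / crest (2 * j + 1)) := by gcongr
    _ ≤ slownessGap j x := le_slownessGap hj x

theorem le_integral_slownessGap {j : ℕ} (hj : crest (2 * j) ≤ 3 / 5 * speedProfile (9 / 25))
    {x x' : ℝ} (hx : x ≤ -crestWidth (2 * j + 1)) (hx' : crestWidth (2 * j + 1) ≤ x') :
    1 / (40960 * ((2 * j + 1 : ℕ) * Real.pi)) ≤ ∫ r in x..x', slownessGap j r := by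
  have width_nonneg : 0 ≤ crestWidth (2 * j + 1) := Real.sqrt_nonneg _
  have crest_ne_zero := (crest_pos (2 * j + 1)).ne'
  set width := crestWidth (2 * j + 1) with width_def
  have intervalIntegrable_gap (a b : ℝ) : IntervalIntegrable (slownessGap j) volume a b :=
    (continuous_slownessGap j).intervalIntegrable a b
  calc 1 / (40960 * ((2 * j + 1 : ℕ) * Real.pi))
      = 1 / 40 * (width ^ 2 / crest (2 * j + 1)) := by
        rw [width_def, crestWidth_sq]; field_simp; norm_num
    _ = ∫ _r in -width..width, 1 / 80 * (width / crest (2 * j + 1)) := by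
        rw [intervalIntegral.integral_const, smul_eq_mul]; ring
    _ ≤ ∫ r in -width..width, slownessGap j r :=
        intervalIntegral.integral_mono_on (by linarith) intervalIntegrable_const
          (intervalIntegrable_gap _ _)
          fun r hr => crestWidth_div_crest_le_slownessGap hj (abs_le.2 hr)
    _ ≤ ∫ r in x..x', slownessGap j r :=
        intervalIntegral.integral_mono_interval hx (by linarith) hx'
          (Eventually.of_forall (slownessGap_nonneg hj)) (intervalIntegrable_gap _ _)

/-! ### The passage past the saddle point -/

theorem speedProfile_sq_div_two_le_saddleSpeed (c x : ℝ) :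
    speedProfile (x ^ 2) / 2 ≤ saddleSpeed c x := by
  have profile_le : speedProfile (x ^ 2) ≤ speedProfile (radiusSq x (saddleHeight x c)) :=
    monotoneOn_speedProfile (mem_Ici.2 (sq_nonneg x)) (radiusSq_nonneg _ _)
      (le_add_of_nonneg_right (sq_nonneg _))
  change _ ≤ saddleFst x (saddleHeight x c)
  linarith [half_le_saddleFst x (saddleHeight x c)]

theorem hasDerivAt_four_div_logFactor_sq {x : ℝ} (hx : 0 < x) :
    HasDerivAt (fun x => 4 / logFactor (x ^ 2))
      (8 / (x * (1 + x ^ 2) * logFactor (x ^ 2) ^ 2)) x := by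
  have logFactor_ne_zero := (logFactor_pos (sq_nonneg x)).ne'
  have hasDerivAt_logFactor_sq := HasDerivAt.comp (h₂ := logFactor) x
    (hasDerivAt_logFactor (by positivity)) (hasDerivAt_sq x)
  convert! (hasDerivAt_const x (4 : ℝ)).fun_div hasDerivAt_logFactor_sq logFactor_ne_zero using 1
  simp only [Function.comp_apply]
  field_simp
  norm_num

theorem one_div_saddleSpeed_le (c : ℝ) {x : ℝ} (hx : 0 < x) (hx1 : x ≤ 1) :
    1 / saddleSpeed c x ≤ 8 / (x * (1 + x ^ 2) * logFactor (x ^ 2) ^ 2) := by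
  have logFactor_pos := logFactor_pos (sq_nonneg x)
  have sq_le_one : x ^ 2 ≤ 1 := pow_le_one₀ hx.le hx1
  have half_le_sqrt : x / 2 ≤ √(x ^ 2 / (1 + x ^ 2)) := by
    refine Real.le_sqrt_of_sq_le ?_
    rw [div_pow, div_le_div_iff₀ (by norm_num) (by positivity)]
    nlinarith
  have le_speed : x * logFactor (x ^ 2) ^ 2 / 4 ≤ saddleSpeed c x :=
    calc x * logFactor (x ^ 2) ^ 2 / 4 = x / 2 * logFactor (x ^ 2) ^ 2 / 2 := by ring
      _ ≤ speedProfile (x ^ 2) / 2 := by rw [speedProfile]; gcongr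
      _ ≤ saddleSpeed c x := speedProfile_sq_div_two_le_saddleSpeed c x
  calc 1 / saddleSpeed c x ≤ 1 / (x * logFactor (x ^ 2) ^ 2 / 4) :=
        one_div_le_one_div_of_le (by positivity) le_speed
    _ = 8 / (x * 2 * logFactor (x ^ 2) ^ 2) := by field_simp; norm_num
    _ ≤ 8 / (x * (1 + x ^ 2) * logFactor (x ^ 2) ^ 2) := by gcongr; linarith

theorem saddleClock_sub_le {c : ℝ} (hc : c ≠ 0) {x a : ℝ} (hx : 0 < x) (hxa : x ≤ a)
    (ha : a ≤ 1) :
    saddleClock c a - saddleClock c x ≤ 4 / logFactor (a ^ 2) - 4 / logFactor (x ^ 2) := by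
  have hasDerivAt_defect {r : ℝ} (hr : 0 < r) :=
    (hasDerivAt_four_div_logFactor_sq hr).fun_sub
      (isGraphStreamFunction_saddle.hasDerivAt_clock hc r)
  have monotoneOn_defect := monotoneOn_of_hasDerivWithinAt_nonneg (convex_Ioc (0 : ℝ) 1)
    (fun r hr => (hasDerivAt_defect hr.1).continuousAt.continuousWithinAt)
    (fun r hr => (hasDerivAt_defect (interior_subset hr).1).hasDerivWithinAt)
    fun r hr => sub_nonneg.2
      (one_div_saddleSpeed_le c (interior_subset hr).1 (interior_subset hr).2)
  linarith [monotoneOn_defect ⟨hx, hxa.trans ha⟩ ⟨hx.trans_le hxa, ha⟩ hxa]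

theorem saddleClock_le {c : ℝ} (hc : c ≠ 0) {a : ℝ} (ha : 0 < a) (ha1 : a ≤ 1) :
    saddleClock c a ≤ 4 / logFactor (a ^ 2) := by
  have clock_tendsto : Tendsto (saddleClock c) (𝓝[>] 0) (𝓝 0) := by
    have := (isGraphStreamFunction_saddle.contDiff_clock hc).continuous.tendsto 0
    rw [streamClock_zero] at this
    exact this.mono_left nhdsWithin_le_nhds
  have clock_sub_tendsto := (tendsto_const_nhds (x := saddleClock c a)).sub clock_tendsto
  rw [sub_zero] at clock_sub_tendsto
  refine le_of_tendsto clock_sub_tendsto ?_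
  filter_upwards [Ioo_mem_nhdsGT ha] with x hx
  have := logFactor_pos (sq_nonneg x)
  have : 0 ≤ 4 / logFactor (x ^ 2) := by positivity
  linarith [saddleClock_sub_le hc hx.1 hx.2.le ha1]

theorem saddleStream_neg_left (x y : ℝ) : saddleStream (-x) y = saddleStream x y := by
  simp only [saddleStream, heightRatio, logBase, radiusSq, even_two, Even.neg_pow]

theorem saddleFst_neg_left (x y : ℝ) : saddleFst (-x) y = saddleFst x y := by
  simp only [saddleFst, heightRatio, logBase, radiusSq, even_two, Even.neg_pow]

theorem saddleSpeed_neg_right (c x : ℝ) : saddleSpeed c (-x) = saddleSpeed c x := by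
  simp only [saddleSpeed, streamSpeed, streamHeight, saddleFst_neg_left,
    funext (saddleStream_neg_left x)]

theorem saddleClock_neg_right (c x : ℝ) : saddleClock c (-x) = -saddleClock c x := by
  rcases eq_or_ne c 0 with rfl | hc
  · simp [saddleClock, streamClock]
  · have reflect := intervalIntegral.integral_comp_neg (a := 0) (b := x)
      (fun r => 1 / saddleSpeed c r)
    simp only [saddleSpeed_neg_right, neg_zero] at reflect
    simp only [saddleClock, streamClock, hc, if_false]
    rw [intervalIntegral.integral_symm, reflect]

theorem le_saddleAbscissa {c : ℝ} (hc : c ≠ 0) {a : ℝ} (ha : 0 < a) (ha1 : a ≤ 1) {x t : ℝ}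
    (hx : -a ≤ x) (ht : 8 / logFactor (a ^ 2) ≤ t) :
    a ≤ saddleAbscissa c (saddleClock c x + t) := by
  have h := isGraphStreamFunction_saddle
  rw [← (h.strictMono_clock hc).le_iff_le, h.clock_abscissa hc]
  have clock_le := saddleClock_le hc ha ha1
  have neg_clock_le : -saddleClock c a ≤ saddleClock c x :=
    saddleClock_neg_right c a ▸ (h.strictMono_clock hc).monotone hx
  have two_passages : 8 / logFactor (a ^ 2) = 4 / logFactor (a ^ 2) + 4 / logFactor (a ^ 2) := by
    ring
  change saddleClock c a ≤ saddleClock c x + t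
  linarith

theorem eight_div_logFactor_exp_sq_le {t : ℝ} (ht : 0 < t) :
    8 / logFactor (Real.exp (-(4 / t)) ^ 2) ≤ t := by
  have log_le := Real.log_le_log (inv_pos.2 (pow_pos (Real.exp_pos (-(4 / t))) 2))
    (le_add_of_nonneg_left zero_le_one)
  rw [Real.log_inv, Real.log_pow, Real.log_exp] at log_le
  have le_logFactor : 8 / t ≤ logFactor (Real.exp (-(4 / t)) ^ 2) :=
    calc 8 / t = -((2 : ℕ) * -(4 / t)) := by push_cast; ring
      _ ≤ Real.log (1 + (Real.exp (-(4 / t)) ^ 2)⁻¹) := log_le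
      _ ≤ logFactor (Real.exp (-(4 / t)) ^ 2) := le_add_of_nonneg_left (by norm_num)
  exact (div_le_comm₀ ht (logFactor_pos (sq_nonneg _))).1 le_logFactor

theorem saddleClock_sub_le_of_le {c : ℝ} (hc : c ≠ 0) {a x x' : ℝ} (ha : 0 < a) (hax : a ≤ x)
    (hxx' : x ≤ x') :
    saddleClock c x' - saddleClock c x ≤ (x' - x) * (2 / speedProfile (a ^ 2)) := by
  have h := isGraphStreamFunction_saddle
  have profile_pos : 0 < speedProfile (a ^ 2) := speedProfile_pos (by positivity)
  have slowness_le (r : ℝ) (hr : r ∈ Icc x x') :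
      1 / saddleSpeed c r ≤ 2 / speedProfile (a ^ 2) := by
    have profile_le : speedProfile (a ^ 2) ≤ speedProfile (r ^ 2) :=
      monotoneOn_speedProfile (mem_Ici.2 (sq_nonneg a)) (mem_Ici.2 (sq_nonneg r))
        (pow_le_pow_left₀ ha.le (hax.trans hr.1) 2)
    calc 1 / saddleSpeed c r ≤ 1 / (speedProfile (a ^ 2) / 2) :=
          one_div_le_one_div_of_le (by positivity)
            (by linarith [speedProfile_sq_div_two_le_saddleSpeed c r])
      _ = 2 / speedProfile (a ^ 2) := one_div_div _ _
  calc saddleClock c x' - saddleClock c x = ∫ r in x..x', 1 / saddleSpeed c r := h.clock_sub hc x x'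
    _ ≤ ∫ _r in x..x', 2 / speedProfile (a ^ 2) :=
        intervalIntegral.integral_mono_on hxx'
          ((h.continuous_one_div_speed hc).intervalIntegrable _ _) intervalIntegrable_const
          slowness_le
    _ = (x' - x) * (2 / speedProfile (a ^ 2)) := by
        rw [intervalIntegral.integral_const, smul_eq_mul]

/-- The time `integral_slownessGap` lost on the odd crest becomes a distance of the same order. -/
theorem le_saddleAbscissa_sub {j : ℕ} (hj : crest (2 * j) ≤ 3 / 5 * speedProfile (9 / 25))
    {a x t : ℝ} (ha : crestWidth (2 * j + 1) ≤ a) (ha0 : 0 < a) (hx : x ≤ -crestWidth (2 * j + 1))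
    (hodd : a ≤ saddleAbscissa (crest (2 * j + 1)) (saddleClock (crest (2 * j + 1)) x + t)) :
    speedProfile (a ^ 2) / 2 * (1 / (40960 * ((2 * j + 1 : ℕ) * Real.pi))) ≤
      saddleAbscissa (crest (2 * j)) (saddleClock (crest (2 * j)) x + t) -
        saddleAbscissa (crest (2 * j + 1)) (saddleClock (crest (2 * j + 1)) x + t) := by
  have h := isGraphStreamFunction_saddle
  have even_ne_zero := (crest_pos (2 * j)).ne'
  have odd_clock : saddleClock _ (saddleAbscissa _ _) = _ :=
    h.clock_abscissa (crest_pos (2 * j + 1)).ne' (saddleClock (crest (2 * j + 1)) x + t)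
  have even_clock : saddleClock _ (saddleAbscissa _ _) = _ :=
    h.clock_abscissa even_ne_zero (saddleClock (crest (2 * j)) x + t)
  have gain_le := le_integral_slownessGap hj hx (ha.trans hodd)
  rw [integral_slownessGap] at gain_le
  set odd := saddleAbscissa (crest (2 * j + 1)) (saddleClock (crest (2 * j + 1)) x + t)
  set even := saddleAbscissa (crest (2 * j)) (saddleClock (crest (2 * j)) x + t)
  set gain := 1 / (40960 * (((2 * j + 1 : ℕ) : ℝ) * Real.pi))
  have gain_pos : 0 < gain := by have := Real.pi_pos; positivity
  have odd_le_even : odd ≤ even := by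
    rw [← (h.strictMono_clock even_ne_zero).le_iff_le]
    change saddleClock _ odd ≤ saddleClock _ even
    linarith
  have profile_pos : 0 < speedProfile (a ^ 2) := speedProfile_pos (by positivity)
  have clock_le := saddleClock_sub_le_of_le even_ne_zero ha0 hodd odd_le_even
  calc speedProfile (a ^ 2) / 2 * gain
      ≤ speedProfile (a ^ 2) / 2 * ((even - odd) * (2 / speedProfile (a ^ 2))) := by
        gcongr; linarith
    _ = even - odd := by field

theorem exists_gain_saddleAbscissa {t : ℝ} (ht : 0 < t) : ∃ a v : ℝ, 0 < a ∧ 0 < v ∧ ∃ N : ℕ,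
    ∀ j, N ≤ j → ∀ x ∈ Icc (-a) (-(a / 2)),
      v / (2 * j + 1 : ℕ) ≤
        saddleAbscissa (crest (2 * j)) (saddleClock (crest (2 * j)) x + t) -
        saddleAbscissa (crest (2 * j + 1)) (saddleClock (crest (2 * j + 1)) x + t) := by
  set a := Real.exp (-(4 / t))
  have a_pos : 0 < a := Real.exp_pos _
  have a_le_one : a ≤ 1 := Real.exp_le_one_iff.2 (neg_nonpos.2 (by positivity))
  have profile_pos : 0 < speedProfile (a ^ 2) := speedProfile_pos (by positivity)
  have threshold_pos : 0 < 3 / 5 * speedProfile (9 / 25) :=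
    mul_pos (by norm_num) (speedProfile_pos (by norm_num))
  obtain ⟨N, hN⟩ := eventually_atTop.1 ((tendsto_crest.eventually_le_const threshold_pos).and
    (tendsto_crest.eventually_le_const (by positivity : 0 < (a / 2) ^ 2)))
  refine ⟨a, speedProfile (a ^ 2) / 2 * (1 / (40960 * Real.pi)), a_pos,
    by have := Real.pi_pos; positivity, N, fun j hj x hx => ?_⟩
  have width_le : crestWidth (2 * j + 1) ≤ a / 2 :=
    le_of_sq_le_sq ((crestWidth_sq_le (by omega)).trans (hN (2 * j + 1) (by omega)).2)
      (by positivity)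
  refine le_trans (le_of_eq ?_) (le_saddleAbscissa_sub (hN (2 * j) (by omega)).1
    (width_le.trans (by linarith)) a_pos (by linarith [hx.2])
    (le_saddleAbscissa (crest_pos _).ne' a_pos a_le_one hx.1 (eight_div_logFactor_exp_sq_le ht)))
  field

/-! ### The variation along a decreasing sequence -/

/-- The variation of `w` in `U`, defined by duality with test functions, is at most `C`. -/
def VariationLE (w : ℝ → ℝ) (U : Set ℝ) (C : ℝ) : Prop :=
  ∀ g : ℝ → ℝ, ContDiff ℝ 1 g → HasCompactSupport g → tsupport g ⊆ U → (∀ c, |g c| ≤ 1) →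
    ∫ c, deriv g c * w c ≤ C

/-- A smooth step from `0` to `1` on `[p, p + δ]`. -/
noncomputable def smoothStep (p δ c : ℝ) : ℝ := Real.smoothTransition ((c - p) / δ)

theorem contDiff_smoothStep (p δ : ℝ) : ContDiff ℝ 1 (smoothStep p δ) :=
  Real.smoothTransition.contDiff.comp (by fun_prop : ContDiff ℝ 1 fun c => (c - p) / δ)

theorem continuous_deriv_smoothStep (p δ : ℝ) : Continuous (deriv (smoothStep p δ)) :=
  (contDiff_smoothStep p δ).continuous_deriv le_rfl

theorem hasDerivAt_smoothStep (p δ c : ℝ) :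
    HasDerivAt (smoothStep p δ) (deriv (smoothStep p δ) c) c :=
  ((contDiff_smoothStep p δ).differentiable one_ne_zero c).hasDerivAt

theorem smoothStep_nonneg (p δ c : ℝ) : 0 ≤ smoothStep p δ c := Real.smoothTransition.nonneg _

theorem smoothStep_le_one (p δ c : ℝ) : smoothStep p δ c ≤ 1 := Real.smoothTransition.le_one _

section

variable {p δ c : ℝ}

theorem smoothStep_of_le (hδ : 0 < δ) (hc : c ≤ p) : smoothStep p δ c = 0 :=
  Real.smoothTransition.zero_of_nonpos (div_nonpos_of_nonpos_of_nonneg (by linarith) hδ.le)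

theorem smoothStep_of_ge (hδ : 0 < δ) (hc : p + δ ≤ c) : smoothStep p δ c = 1 :=
  Real.smoothTransition.one_of_one_le ((one_le_div hδ).2 (by linarith))

theorem monotone_smoothStep (p : ℝ) (hδ : 0 < δ) : Monotone (smoothStep p δ) :=
  fun _ _ hcc' => Real.smoothTransition.monotone (by gcongr)

theorem antitone_smoothStep_left (hδ : 0 < δ) (c : ℝ) : Antitone fun p => smoothStep p δ c :=
  fun _ _ hpp' => Real.smoothTransition.monotone (by gcongr)

theorem deriv_smoothStep_eq_zero (hδ : 0 < δ) (hc : c ∉ Ioo p (p + δ)) :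
    deriv (smoothStep p δ) c = 0 := by
  rw [mem_Ioo, not_and_or, not_lt, not_lt] at hc
  rcases hc with c_le | le_c
  · refine IsLocalMin.deriv_eq_zero (Eventually.of_forall fun x => ?_)
    rw [smoothStep_of_le hδ c_le]
    exact smoothStep_nonneg _ _ _
  · refine IsLocalMax.deriv_eq_zero (Eventually.of_forall fun x => ?_)
    rw [smoothStep_of_ge hδ le_c]
    exact smoothStep_le_one _ _ _

theorem integral_deriv_smoothStep (p : ℝ) (hδ : 0 < δ) : ∫ c, deriv (smoothStep p δ) c = 1 := by
  have support_subset : Function.support (deriv (smoothStep p δ)) ⊆ Ioc p (p + δ) :=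
    Function.support_subset_iff'.2 fun c hc =>
      deriv_smoothStep_eq_zero hδ fun mem_Ioo => hc (Ioo_subset_Ioc_self mem_Ioo)
  rw [← intervalIntegral.integral_eq_integral_of_support_subset support_subset,
    intervalIntegral.integral_eq_sub_of_hasDerivAt (fun c _ => hasDerivAt_smoothStep p δ c)
      ((continuous_deriv_smoothStep p δ).intervalIntegrable _ _),
    smoothStep_of_ge hδ le_rfl, smoothStep_of_le hδ le_rfl, sub_zero]

theorem integrable_deriv_smoothStep_mul (hδ : 0 < δ) {w : ℝ → ℝ}
    (hw : ContinuousOn w (Icc p (p + δ))) :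
    Integrable fun c => deriv (smoothStep p δ) c * w c := by
  refine ((continuous_deriv_smoothStep p δ).continuousOn.mul
    hw).integrableOn_Icc.integrable_of_forall_notMem_eq_zero fun c hc => ?_
  rw [Pi.mul_apply, deriv_smoothStep_eq_zero hδ fun mem_Ioo => hc (Ioo_subset_Icc_self mem_Ioo),
    zero_mul]

end

theorem tendsto_integral_deriv_smoothStep_mul {p : ℝ} {U : Set ℝ} (hU : U ∈ 𝓝 p) {w : ℝ → ℝ}
    (hw : ContinuousOn w U) :
    Tendsto (fun δ => ∫ c, deriv (smoothStep p δ) c * w c) (𝓝[>] 0) (𝓝 (w p)) := by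
  obtain ⟨r, r_pos, subset_U⟩ := Metric.nhds_basis_closedBall.mem_iff.1 hU
  set S := Icc (p - r) (p + r)
  rw [Real.closedBall_eq_Icc] at subset_U
  have S_mem_nhds : S ∈ 𝓝 p := Icc_mem_nhds (by linarith) (by linarith)
  have deriv_eq_zero_off {u : Set ℝ} (hu : u ∈ 𝓝 p) :
      ∀ᶠ δ in 𝓝[>] (0 : ℝ), ∀ c ∉ u, deriv (smoothStep p δ) c = 0 := by
    obtain ⟨ε, ε_pos, subset_u⟩ := Metric.nhds_basis_ball.mem_iff.1 hu
    filter_upwards [Ioo_mem_nhdsGT ε_pos] with δ hδ c hc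
    refine deriv_smoothStep_eq_zero hδ.1 fun mem_Ioo => hc (subset_u ?_)
    rw [Real.ball_eq_Ioo]
    exact ⟨by linarith [mem_Ioo.1], by linarith [mem_Ioo.2, hδ.2]⟩
  have integral_eq (f : ℝ → ℝ) : ∀ᶠ δ in 𝓝[>] (0 : ℝ),
      ∫ c in S, deriv (smoothStep p δ) c * f c = ∫ c, deriv (smoothStep p δ) c * f c := by
    filter_upwards [deriv_eq_zero_off S_mem_nhds] with δ hδ
    exact setIntegral_eq_integral_of_forall_compl_eq_zero fun c hc => by rw [hδ c hc, zero_mul]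
  refine Tendsto.congr' (integral_eq w) ?_
  refine tendsto_setIntegral_peak_smul_of_integrableOn_of_tendsto measurableSet_Icc
    measurableSet_Icc subset_rfl (mem_nhdsWithin_of_mem_nhds S_mem_nhds)
    isCompact_Icc.measure_ne_top ?_ (fun u hu hpu => ?_) ?_
    (Eventually.of_forall fun δ => (continuous_deriv_smoothStep p δ).aestronglyMeasurable)
    (hw.mono subset_U).integrableOn_Icc
    (tendsto_nhdsWithin_of_tendsto_nhds (hw.continuousAt hU))
  · filter_upwards [self_mem_nhdsWithin] with δ hδ c _
      using (monotone_smoothStep p hδ).deriv_nonneg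
  · rw [Metric.tendstoUniformlyOn_iff]
    intro ε hε
    filter_upwards [deriv_eq_zero_off (hu.mem_nhds hpu)] with δ hδ c hc
    rwa [hδ c hc.2, Pi.zero_apply, dist_self]
  · refine tendsto_const_nhds.congr' ?_
    filter_upwards [integral_eq 1, self_mem_nhdsWithin] with δ integral_eq hδ
    simp only [Pi.one_apply, mul_one] at integral_eq
    rw [integral_eq, integral_deriv_smoothStep p hδ]

/-- For a decreasing sequence `p`, minus the sum of the indicators of the intervals
`[p (2 * j + 1), p (2 * j)]`, smoothed at scale `δ`. -/
noncomputable def alternatingStep (p : ℕ → ℝ) (δ : ℝ) (m : ℕ) (c : ℝ) : ℝ :=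
  ∑ j ∈ Finset.range m, (smoothStep (p (2 * j)) δ c - smoothStep (p (2 * j + 1)) δ c)

section

variable {p : ℕ → ℝ} {δ : ℝ}

theorem contDiff_alternatingStep (p : ℕ → ℝ) (δ : ℝ) (m : ℕ) :
    ContDiff ℝ 1 (alternatingStep p δ m) :=
  ContDiff.sum fun _ _ => (contDiff_smoothStep _ δ).sub (contDiff_smoothStep _ δ)

theorem smoothStep_sub_le_alternatingStep (hp : Antitone p) (hδ : 0 < δ) (m : ℕ) (c : ℝ) :
    smoothStep (p 0) δ c - smoothStep (p (2 * m)) δ c ≤ alternatingStep p δ m c := by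
  induction m with
  | zero => simp [alternatingStep]
  | succ m ih =>
    have step_le : smoothStep (p (2 * m + 1)) δ c ≤ smoothStep (p (2 * (m + 1))) δ c :=
      antitone_smoothStep_left hδ c (hp (by omega))
    rw [alternatingStep] at ih ⊢
    rw [Finset.sum_range_succ]
    linarith

theorem abs_alternatingStep_le_one (hp : Antitone p) (hδ : 0 < δ) (m : ℕ) (c : ℝ) :
    |alternatingStep p δ m c| ≤ 1 := by
  have nonpos : alternatingStep p δ m c ≤ 0 := Finset.sum_nonpos fun j _ =>
    sub_nonpos.2 (antitone_smoothStep_left hδ c (hp (2 * j).le_succ))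
  refine abs_le.2 ⟨?_, by linarith⟩
  linarith [smoothStep_sub_le_alternatingStep hp hδ m c, smoothStep_nonneg (p 0) δ c,
    smoothStep_le_one (p (2 * m)) δ c]

theorem alternatingStep_eq_zero (hp : Antitone p) (hδ : 0 < δ) {m : ℕ} {c : ℝ}
    (hc : c ∉ Icc (p (2 * m)) (p 0 + δ)) : alternatingStep p δ m c = 0 := by
  rw [mem_Icc, not_and_or, not_le, not_le] at hc
  refine Finset.sum_eq_zero fun j hj => sub_eq_zero.2 ?_
  rw [Finset.mem_range] at hj
  rcases hc with c_lt | lt_c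
  · rw [smoothStep_of_le hδ (c_lt.le.trans (hp (by omega))),
      smoothStep_of_le hδ (c_lt.le.trans (hp (by omega)))]
  · rw [smoothStep_of_ge hδ (by linarith [hp (2 * j).zero_le]),
      smoothStep_of_ge hδ (by linarith [hp (2 * j + 1).zero_le])]

theorem integral_deriv_alternatingStep_mul {w : ℝ → ℝ}
    (hw : ∀ n, Integrable fun c => deriv (smoothStep (p n) δ) c * w c) (m : ℕ) :
    ∫ c, deriv (alternatingStep p δ m) c * w c =
      ∑ j ∈ Finset.range m, ((∫ c, deriv (smoothStep (p (2 * j)) δ) c * w c) -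
        ∫ c, deriv (smoothStep (p (2 * j + 1)) δ) c * w c) := by
  have deriv_eq (c : ℝ) : deriv (alternatingStep p δ m) c = ∑ j ∈ Finset.range m,
      (deriv (smoothStep (p (2 * j)) δ) c - deriv (smoothStep (p (2 * j + 1)) δ) c) :=
    (HasDerivAt.fun_sum fun j _ =>
      (hasDerivAt_smoothStep (p (2 * j)) δ c).sub (hasDerivAt_smoothStep _ δ c)).deriv
  simp_rw [deriv_eq, Finset.sum_mul, sub_mul]
  refine (integral_finsetSum _ fun j _ => (hw (2 * j)).sub (hw (2 * j + 1))).trans ?_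
  exact Finset.sum_congr rfl fun j _ => integral_sub (hw _) (hw _)

end

theorem VariationLE.sum_sub_le {w : ℝ → ℝ} {U : Set ℝ} {C : ℝ} (h : VariationLE w U C)
    (hw : ContinuousOn w U) (hU : IsOpen U) (hU' : U.OrdConnected) {p : ℕ → ℝ} (hp : Antitone p)
    (hpU : ∀ n, p n ∈ U) (m : ℕ) :
    ∑ j ∈ Finset.range m, (w (p (2 * j)) - w (p (2 * j + 1))) ≤ C := by
  have tendsto_sum := tendsto_finsetSum (Finset.range m) fun j _ =>
    (tendsto_integral_deriv_smoothStep_mul (hU.mem_nhds (hpU (2 * j))) hw).sub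
      (tendsto_integral_deriv_smoothStep_mul (hU.mem_nhds (hpU (2 * j + 1))) hw)
  refine le_of_tendsto tendsto_sum ?_
  have add_tendsto : Tendsto (fun δ => p 0 + δ) (𝓝[>] 0) (𝓝 (p 0)) :=
    tendsto_nhdsWithin_of_tendsto_nhds
      (by simpa using tendsto_const_nhds (x := p 0).add (tendsto_id (x := 𝓝 (0 : ℝ))))
  filter_upwards [self_mem_nhdsWithin, add_tendsto (hU.mem_nhds (hpU 0))] with δ hδ add_mem
  have integrable (n : ℕ) : Integrable fun c => deriv (smoothStep (p n) δ) c * w c :=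
    integrable_deriv_smoothStep_mul hδ <| hw.mono <| (Icc_subset_Icc_right
      (add_le_add_left (hp n.zero_le) δ)).trans (hU'.out (hpU n) add_mem)
  have support_subset : Function.support (alternatingStep p δ m) ⊆ Icc (p (2 * m)) (p 0 + δ) :=
    Function.support_subset_iff'.2 fun c hc => alternatingStep_eq_zero hp hδ hc
  rw [← integral_deriv_alternatingStep_mul integrable]
  exact h _ (contDiff_alternatingStep p δ m)
    (HasCompactSupport.of_support_subset_isCompact isCompact_Icc support_subset)
    ((closure_minimal support_subset isClosed_Icc).trans (hU'.out (hpU _) add_mem))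
    (abs_alternatingStep_le_one hp hδ m)

/-! ### Averages of the flow over the level sets -/

/-- The abscissa at time `t` of the point which starts above `x` on the level set `{H = c}`. -/
noncomputable def flowAbscissa (H b₁ : ℝ → ℝ → ℝ) (t c x : ℝ) : ℝ :=
  streamAbscissa H b₁ c (streamClock H b₁ c x + t)

theorem planeFlow_fst (H b₁ : ℝ → ℝ → ℝ) (t : ℝ) (z : Euc 2) :
    planeFlow H b₁ t z 0 = flowAbscissa H b₁ t (H (z 0) (z 1)) (z 0) := by
  simp [planeFlow, streamFlow, streamPoint, streamCoord, flowAbscissa]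

/-- The integral of the abscissa at time `t` over the points which start on the level set
`{H = c}`, with weight `ζ`. -/
noncomputable def averagedAbscissa (H b₁ : ℝ → ℝ → ℝ) (t : ℝ) (ζ : ℝ → ℝ) (c : ℝ) : ℝ :=
  ∫ x, ζ x * flowAbscissa H b₁ t c x

/-- A vertical field, constant along the level sets of `H` up to the cutoff `ζ` in the abscissa.
Testing the variation of the flow with it yields the variation of `averagedAbscissa`. -/
noncomputable def verticalField (H : ℝ → ℝ → ℝ) (ζ g : ℝ → ℝ) (z : Euc 2) : Euc 2 :=
  (ζ (z 0) * g (H (z 0) (z 1))) • EuclideanSpace.single 1 1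

theorem MemBVLocReal.congr_ae {d : ℕ} {u v : Euc d → ℝ} (hu : MemBVLocReal u)
    (huv : u =ᵐ[volume] v) : MemBVLocReal v := by
  refine ⟨fun x => (hu.1 x).congr huv, fun V hVo hVb => ?_⟩
  have integral_eq (φ : Euc d → Euc d) :
      ∫ x, v x * classicalDiv φ x = ∫ x, u x * classicalDiv φ x := by
    refine integral_congr_ae ?_
    filter_upwards [huv] with x hx
    rw [hx]
  simpa only [integral_eq] using hu.2 V hVo hVb

namespace IsGraphStreamFunction

variable {H b₁ b₂ : ℝ → ℝ → ℝ} {B : ℝ}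

theorem isCompact_strip (h : IsGraphStreamFunction H b₁ b₂ B) {A Q : Set ℝ} (hA : IsCompact A)
    (hQ : IsCompact Q) : IsCompact {z : ℝ × ℝ | z.1 ∈ A ∧ H z.1 z.2 ∈ Q} := by
  have strip_eq : {z : ℝ × ℝ | z.1 ∈ A ∧ H z.1 z.2 ∈ Q} =
      (fun z : ℝ × ℝ => (z.1, streamHeight H z.1 z.2)) '' (A ×ˢ Q) := by
    ext ⟨x, y⟩
    constructor
    · rintro ⟨hx, hy⟩
      exact ⟨(x, H x y), ⟨hx, hy⟩, by simp [h.height_stream]⟩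
    · rintro ⟨⟨x, c⟩, ⟨hx, hc⟩, ⟨⟩⟩
      exact ⟨hx, by simpa [h.stream_height] using hc⟩
  rw [strip_eq]
  exact (hA.prod hQ).image (continuous_fst.prodMk h.continuous_height)

theorem integral_stream_section (h : IsGraphStreamFunction H b₁ b₂ B) (x : ℝ) (f : ℝ → ℝ) :
    ∫ y, f (H x y) * b₁ x y = ∫ c, f c := by
  have speed_nonneg (y : ℝ) : 0 ≤ b₁ x y :=
    (h.strictMono x).monotone.deriv_nonneg.trans_eq (h.hasDerivAt_snd x y).deriv
  have change_of_variables := integral_image_eq_integral_abs_deriv_smul MeasurableSet.univ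
    (fun y _ => (h.hasDerivAt_snd x y).hasDerivWithinAt) (h.strictMono x).injective.injOn f
  rw [image_univ, (h.surjective x).range_eq, setIntegral_univ, setIntegral_univ]
    at change_of_variables
  simp only [change_of_variables, smul_eq_mul, abs_of_nonneg (speed_nonneg _), mul_comm]

theorem integral_stream (h : IsGraphStreamFunction H b₁ b₂ B) {F : ℝ × ℝ → ℝ} (hF : Continuous F)
    (hFs : HasCompactSupport F) :
    ∫ z : ℝ × ℝ, F (z.1, H z.1 z.2) * b₁ z.1 z.2 = ∫ c, ∫ x, F (x, c) := by
  have continuous_integrand : Continuous fun z : ℝ × ℝ => F (z.1, H z.1 z.2) * b₁ z.1 z.2 :=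
    (hF.comp (continuous_fst.prodMk h.contDiff.continuous)).mul h.cont_fst
  have compact_support : HasCompactSupport fun z : ℝ × ℝ => F (z.1, H z.1 z.2) * b₁ z.1 z.2 := by
    refine HasCompactSupport.intro (h.isCompact_strip (hFs.image continuous_fst)
      (hFs.image continuous_snd)) fun z hz => ?_
    rw [image_eq_zero_of_notMem_tsupport (f := F) (x := (z.1, H z.1 z.2))
      fun hm => hz ⟨⟨_, hm, rfl⟩, ⟨_, hm, rfl⟩⟩, zero_mul]
  rw [Measure.volume_eq_prod, integral_prod _
    (continuous_integrand.integrable_of_hasCompactSupport compact_support)]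
  simp only [fun x => h.integral_stream_section x fun c => F (x, c)]
  exact integral_integral_swap (f := fun x c => F (x, c)) (hF.integrable_of_hasCompactSupport hFs)

theorem continuousOn_flowAbscissa (h : IsGraphStreamFunction H b₁ b₂ B) (t : ℝ) :
    ContinuousOn (fun z : ℝ × ℝ => flowAbscissa H b₁ t z.1 z.2) ({0}ᶜ ×ˢ univ) := by
  have continuous_off_zero : Continuous fun z : {c : ℝ // c ≠ 0} × ℝ =>
      flowAbscissa H b₁ t z.1 z.2 :=
    h.continuous_abscissa.comp (continuous_fst.prodMk (h.continuous_clock.add continuous_const))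
  rw [continuousOn_iff_continuous_domRestrict]
  exact continuous_off_zero.comp
    (by fun_prop : Continuous fun z : ({0}ᶜ ×ˢ univ : Set (ℝ × ℝ)) =>
      ((⟨z.1.1, z.2.1⟩, z.1.2) : {c : ℝ // c ≠ 0} × ℝ))

theorem continuous_flowAbscissa (h : IsGraphStreamFunction H b₁ b₂ B) (t : ℝ) {c : ℝ}
    (hc : c ≠ 0) : Continuous (flowAbscissa H b₁ t c) :=
  (h.continuousOn_flowAbscissa t).comp_continuous (f := fun x => (c, x)) (by fun_prop)
    fun _ => ⟨hc, mem_univ _⟩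

section

variable {ζ : ℝ → ℝ}

theorem continuousOn_averagedAbscissa (h : IsGraphStreamFunction H b₁ b₂ B) (t : ℝ)
    (hζ : Continuous ζ) (hζs : HasCompactSupport ζ) :
    ContinuousOn (averagedAbscissa H b₁ t ζ) {0}ᶜ :=
  continuousOn_integral_of_compact_support hζs
    ((hζ.comp continuous_snd).continuousOn.mul (h.continuousOn_flowAbscissa t))
    fun _ x _ hx => by rw [image_eq_zero_of_notMem_tsupport hx, zero_mul]

theorem mul_integral_le_averagedAbscissa_sub (h : IsGraphStreamFunction H b₁ b₂ B) {t : ℝ}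
    (hζ : Continuous ζ) (hζs : HasCompactSupport ζ) (hζ0 : ∀ x, 0 ≤ ζ x) {c c' : ℝ} (hc : c ≠ 0)
    (hc' : c' ≠ 0) {d : ℝ}
    (hd : ∀ x ∈ Function.support ζ, d ≤ flowAbscissa H b₁ t c x - flowAbscissa H b₁ t c' x) :
    d * ∫ x, ζ x ≤ averagedAbscissa H b₁ t ζ c - averagedAbscissa H b₁ t ζ c' := by
  have integrable {c : ℝ} (hc : c ≠ 0) : Integrable fun x => ζ x * flowAbscissa H b₁ t c x :=
    (hζ.mul (h.continuous_flowAbscissa t hc)).integrable_of_hasCompactSupport hζs.mul_right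
  rw [averagedAbscissa, averagedAbscissa, ← integral_sub (integrable hc) (integrable hc'),
    ← integral_const_mul]
  refine integral_mono ((hζ.integrable_of_hasCompactSupport hζs).const_mul d)
    ((integrable hc).sub (integrable hc')) fun x => ?_
  by_cases hx : x ∈ Function.support ζ
  · linarith [mul_le_mul_of_nonneg_left (hd x hx) (hζ0 x)]
  · simp [Function.notMem_support.1 hx]

theorem integral_planeFlow_mul (h : IsGraphStreamFunction H b₁ b₂ B) (t : ℝ) (hζ : Continuous ζ)
    (hζs : HasCompactSupport ζ) {k : ℝ → ℝ} (hk : Continuous k) (hks : HasCompactSupport k)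
    (hk0 : tsupport k ⊆ {0}ᶜ) :
    ∫ z : Euc 2, planeFlow H b₁ t z 0 * (ζ (z 0) * (k (H (z 0) (z 1)) * b₁ (z 0) (z 1))) =
      ∫ c, k c * averagedAbscissa H b₁ t ζ c := by
  set F : ℝ × ℝ → ℝ := fun z => k z.2 * (ζ z.1 * flowAbscissa H b₁ t z.2 z.1)
  have support_subset : Function.support F ⊆ tsupport ζ ×ˢ tsupport k := fun z hz =>
    ⟨subset_tsupport ζ (left_ne_zero_of_mul (right_ne_zero_of_mul hz)),
      subset_tsupport k (left_ne_zero_of_mul hz)⟩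
  have tsupport_subset : tsupport F ⊆ univ ×ˢ {0}ᶜ :=
    (closure_minimal support_subset ((isClosed_tsupport ζ).prod (isClosed_tsupport k))).trans
      (prod_mono (subset_univ _) hk0)
  have continuousOn_F : ContinuousOn F (univ ×ˢ {0}ᶜ) :=
    (hk.comp continuous_snd).continuousOn.mul <| (hζ.comp continuous_fst).continuousOn.mul <|
      (h.continuousOn_flowAbscissa t).comp continuous_swap.continuousOn fun _ hz => hz.symm
  have continuous_F : Continuous F := continuousOn_F.continuous_of_tsupport_subset
    (isOpen_univ.prod isOpen_compl_singleton) tsupport_subset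
  calc _ = ∫ z : Euc 2, F (z 0, H (z 0) (z 1)) * b₁ (z 0) (z 1) := by
        refine integral_congr_ae (Eventually.of_forall fun z => ?_)
        simp only [F, planeFlow_fst]
        ring
    _ = ∫ z : ℝ × ℝ, F (z.1, H z.1 z.2) * b₁ z.1 z.2 :=
        integral_plane fun z => F (z.1, H z.1 z.2) * b₁ z.1 z.2
    _ = ∫ c, ∫ x, F (x, c) := h.integral_stream continuous_F
        (HasCompactSupport.of_support_subset_isCompact (hζs.prod hks) support_subset)
    _ = ∫ c, k c * averagedAbscissa H b₁ t ζ c := by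
        simp only [F, averagedAbscissa, integral_const_mul]

variable {g : ℝ → ℝ}

theorem contDiff_verticalField (h : IsGraphStreamFunction H b₁ b₂ B) (hζ : ContDiff ℝ 1 ζ)
    (hg : ContDiff ℝ 1 g) : ContDiff ℝ 1 (verticalField H ζ g) :=
  ((hζ.comp (contDiff_fst.comp planeCLE.contDiff)).mul
    (hg.comp (h.contDiff.comp planeCLE.contDiff))).smul contDiff_const

theorem classicalDiv_verticalField (h : IsGraphStreamFunction H b₁ b₂ B) (hζ : ContDiff ℝ 1 ζ)
    (hg : ContDiff ℝ 1 g) (z : Euc 2) : classicalDiv (verticalField H ζ g) z =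
      ζ (z 0) * (deriv g (H (z 0) (z 1)) * b₁ (z 0) (z 1)) := by
  have hasFDerivAt_cutoff := (hζ.differentiable one_ne_zero (z 0)).hasDerivAt.comp_hasFDerivAt z
    (EuclideanSpace.proj (𝕜 := ℝ) (ι := Fin 2) 0 : Euc 2 →L[ℝ] ℝ).hasFDerivAt
  have hasFDerivAt_level := (hg.differentiable one_ne_zero
    (H (z 0) (z 1))).hasDerivAt.comp_hasFDerivAt z (h.hasFDerivAt_plane z)
  have fderiv_eq : fderiv ℝ (verticalField H ζ g) z = _ :=
    ((hasFDerivAt_cutoff.mul hasFDerivAt_level).smul_const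
      (EuclideanSpace.single 1 1 : Euc 2)).fderiv
  rw [classicalDiv, Fin.sum_univ_two, fderiv_eq]
  simp

theorem norm_verticalField_le_one (H : ℝ → ℝ → ℝ) (hζ : ∀ x, |ζ x| ≤ 1) (hg : ∀ c, |g c| ≤ 1)
    (z : Euc 2) : ‖verticalField H ζ g z‖ ≤ 1 := by
  rw [verticalField, norm_smul, PiLp.norm_single, norm_one, mul_one, Real.norm_eq_abs, abs_mul]
  exact mul_le_one₀ (hζ _) (abs_nonneg _) (hg _)

theorem support_verticalField_subset (H : ℝ → ℝ → ℝ) (ζ g : ℝ → ℝ) :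
    Function.support (verticalField H ζ g) ⊆
      planeCLE.symm '' {z | z.1 ∈ tsupport ζ ∧ H z.1 z.2 ∈ tsupport g} := fun z hz =>
  have coefficient_ne_zero : ζ (z 0) * g (H (z 0) (z 1)) ≠ 0 := left_ne_zero_of_smul hz
  ⟨planeCLE z, ⟨subset_tsupport ζ (left_ne_zero_of_mul coefficient_ne_zero),
    subset_tsupport g (right_ne_zero_of_mul coefficient_ne_zero)⟩, planeCLE.symm_apply_apply z⟩

theorem exists_variationLE_averagedAbscissa (h : IsGraphStreamFunction H b₁ b₂ B) {t : ℝ}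
    (hX : MemBVLocReal fun z => planeFlow H b₁ t z 0) (hζ : ContDiff ℝ 1 ζ)
    (hζs : HasCompactSupport ζ) (hζ1 : ∀ x, |ζ x| ≤ 1) {U : Set ℝ} (hU : Bornology.IsBounded U)
    (hU0 : U ⊆ {0}ᶜ) : ∃ C, VariationLE (averagedAbscissa H b₁ t ζ) U C := by
  have isCompact_image {Q : Set ℝ} (hQ : IsCompact Q) :
      IsCompact (planeCLE.symm '' {z | z.1 ∈ tsupport ζ ∧ H z.1 z.2 ∈ Q}) :=
    (h.isCompact_strip hζs hQ).image planeCLE.symm.continuous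
  obtain ⟨R, subset_ball⟩ := (isCompact_image hU.isCompact_closure).isBounded.subset_ball 0
  obtain ⟨C, hC⟩ := hX.2 _ (Metric.isOpen_ball (ε := R)) Metric.isBounded_ball
  refine ⟨C, fun g hg hgs hgU hg1 => ?_⟩
  have support_subset := support_verticalField_subset H ζ g
  have tsupport_subset : tsupport (verticalField H ζ g) ⊆ Metric.ball 0 R :=
    (closure_minimal support_subset (isCompact_image hgs).isClosed).trans
      ((image_mono fun _ => And.imp_right fun mem => subset_closure (hgU mem)).trans subset_ball)
  have pairing_le :
      ∫ z, planeFlow H b₁ t z 0 * classicalDiv (verticalField H ζ g) z ≤ C :=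
    hC ⟨verticalField H ζ g, h.contDiff_verticalField hζ hg,
      HasCompactSupport.of_support_subset_isCompact (isCompact_image hgs) support_subset,
      tsupport_subset, norm_verticalField_le_one H hζ1 hg1, rfl⟩
  simp only [h.classicalDiv_verticalField hζ hg] at pairing_le
  rwa [h.integral_planeFlow_mul t hζ.continuous hζs (hg.continuous_deriv le_rfl) hgs.deriv
    (tsupport_deriv_subset.trans (hgU.trans hU0))] at pairing_le

end

end IsGraphStreamFunction

/-! ### Infinite variation of the flow -/

theorem exists_lt_sum_of_div_le {κ : ℝ} (hκ : 0 < κ) {d : ℕ → ℝ}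
    (hd : ∀ j : ℕ, κ * (1 / (j + 1)) ≤ d j) (C : ℝ) : ∃ m, C < ∑ j ∈ Finset.range m, d j := by
  obtain ⟨m, hm⟩ := ((Real.tendsto_sum_range_one_div_nat_succ_atTop.const_mul_atTop
    hκ).eventually_gt_atTop C).exists
  refine ⟨m, hm.trans_le ?_⟩
  rw [Finset.mul_sum]
  exact Finset.sum_le_sum fun j _ => hd j

theorem crest_mem_Ioo (n : ℕ) : crest n ∈ Ioo 0 2 :=
  ⟨crest_pos n, (Real.exp_le_one_iff.2 (neg_nonpos.2 (Real.sqrt_nonneg _))).trans_lt one_lt_two⟩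

theorem not_memBVLocReal_planeFlow_saddle {t : ℝ} (ht : 0 < t) :
    ¬ MemBVLocReal fun z => planeFlow saddleStream saddleFst t z 0 := by
  intro hBV
  have h := isGraphStreamFunction_saddle
  obtain ⟨a, v, a_pos, v_pos, N, gain⟩ := exists_gain_saddleAbscissa ht
  let ζ : ContDiffBump (-(3 * a / 4)) := ⟨a / 8, a / 4, by positivity, by linarith⟩
  have support_ζ : Function.support ζ ⊆ Icc (-a) (-(a / 2)) := by
    rw [ζ.support_eq, Real.ball_eq_Ioo]
    exact Ioo_subset_Icc_self.trans
      (Icc_subset_Icc (by dsimp only [ζ]; linarith) (by dsimp only [ζ]; linarith))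
  have Ioo_subset : Ioo (0 : ℝ) 2 ⊆ {0}ᶜ := fun c hc => hc.1.ne'
  obtain ⟨C, variation_le⟩ := h.exists_variationLE_averagedAbscissa hBV ζ.contDiff
    ζ.hasCompactSupport (fun x => (abs_of_nonneg ζ.nonneg).trans_le ζ.le_one)
    (Metric.isBounded_Ioo 0 2) Ioo_subset
  set average := averagedAbscissa saddleStream saddleFst t ζ
  have oscillation (j : ℕ) (hj : N ≤ j) :
      v / (2 * j + 1 : ℕ) * ∫ x, ζ x ≤ average (crest (2 * j)) - average (crest (2 * j + 1)) :=
    h.mul_integral_le_averagedAbscissa_sub ζ.continuous ζ.hasCompactSupport (fun _ => ζ.nonneg)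
      (crest_pos _).ne' (crest_pos _).ne' fun x hx => gain j hj x (support_ζ hx)
  have integral_pos : 0 < ∫ x, ζ x := ζ.integral_pos
  have divergent (j : ℕ) : v * (∫ x, ζ x) / (2 * N + 2) * (1 / (j + 1)) ≤
      average (crest (2 * N + 2 * j)) - average (crest (2 * N + (2 * j + 1))) := by
    refine le_trans ?_ (mul_add 2 N j ▸ oscillation (N + j) (by omega))
    rw [div_mul_div_comm, mul_one, div_mul_eq_mul_div]
    refine div_le_div_of_nonneg_left (by positivity) (by positivity) ?_
    push_cast
    nlinarith [(by positivity : (0 : ℝ) ≤ N * j)]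
  obtain ⟨m, C_lt⟩ := exists_lt_sum_of_div_le (by positivity) divergent C
  exact C_lt.not_ge <| variation_le.sum_sub_le
    ((h.continuousOn_averagedAbscissa t ζ.continuous ζ.hasCompactSupport).mono Ioo_subset)
    isOpen_Ioo ordConnected_Ioo (p := fun n => crest (2 * N + n))
    (fun n n' hn => crest_strictAnti.antitone (by omega)) (fun n => crest_mem_Ioo _) m

theorem proposition1p5 :
    ∃ b : Euc 2 → Euc 2,
      MemLp b (⊤ : ℝ≥0∞) volume ∧
      IsDivFree b ∧
      (∀ p : ℝ≥0∞, 1 ≤ p → p < ⊤ → MemW1pLoc b p) ∧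
      (∀ᵐ z : Euc 2, 0 < b z 0) ∧
      -- a regular Lagrangian flow exists for all times
      (∃ X : ℝ → Euc 2 → Euc 2, IsRegularLagrangianFlow ⊤ (fun _ => b) X) ∧
      -- on every time interval it is unique up to a null set of initial points
      (∀ (T : EReal) (X Y : ℝ → Euc 2 → Euc 2),
        IsRegularLagrangianFlow T (fun _ => b) X → IsRegularLagrangianFlow T (fun _ => b) Y →
          ∀ᵐ z : Euc 2, ∀ t : ℝ, 0 ≤ t → (t : EReal) < T → X t z = Y t z) ∧
      -- and at no positive time is it of locally bounded variation
      (∀ (T : EReal) (X : ℝ → Euc 2 → Euc 2), IsRegularLagrangianFlow T (fun _ => b) X →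
        ∀ t : ℝ, 0 < t → (t : EReal) < T → ¬ MemBVLoc (X t)) := by
  have h := isGraphStreamFunction_saddle
  refine ⟨planeField saddleFst saddleSnd, memLp_top_of_bound
    h.continuous_planeField.aestronglyMeasurable _ (Eventually.of_forall h.norm_planeField_le),
    h.isDivFree_planeField, fun p hp1 hp => memW1pLoc_planeField_saddle hp1 hp, ?_,
    ⟨_, h.isRegularLagrangianFlow_planeFlow⟩, fun T X Y hX hY => ?_, fun T X hX t ht htT hBV => ?_⟩
  · filter_upwards [ae_plane_snd_ne_zero] with z hz
    exact h.pos (z 0) (z 1) hz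
  · filter_upwards [h.regularLagrangianFlow_eq hX, h.regularLagrangianFlow_eq hY]
      with z hXz hYz t ht htT
    rw [hXz t ht htT, hYz t ht htT]
  · refine not_memBVLocReal_planeFlow_saddle ht ((hBV 0).congr_ae ?_)
    filter_upwards [h.regularLagrangianFlow_eq hX] with z hz
    rw [hz t ht.le htT]
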